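/- **Setting.** Let $I$ be an index set, $P$ a free abelian group, $P^\vee=\operatorname{Hom}(P,\mathbb Z)$. A super Borcherds–Cartan datum consists of an integer matrix $A=(a_{ij})_{i,j\in I}$ with $a_{ii}\in\{2,0,-2,-4,\dots\}$, $a_{ij}\le 0$ for $i\ne j$, positive integers $d_i$ with $d_ia_{ij}=d_ja_{ji}$, elements $\alpha_i\in P$ (linearly independent) and $h_i\in P^\vee$ with $\langle h_i,\alpha_j\rangle=a_{ij}$, and a parity $p:I\to\{0,1\}$ such that $a_{ij}$ is even for all $j$ whenever $p(i)=1$; for every $i$ there is $\Lambda_i\in P$ with $\langle h_j,\Lambda_i\rangle=\delta_{ij}$. Put $I^{\rm re}=\{i: a_{ii}=2\}$, $I^{\rm im}=\{i: a_{ii}\le 0\}$, $I^\infty=(I^{\rm re}\times\{1\})\sqcup(I^{\rm im}\times\mathbb Z_{>0})$, $(\alpha_i,\alpha_j)=d_ia_{ij}$, $q_i=q^{d_i}$, $p(li)\in\{0,1\}$ the residue of $l\,p(i)$ mod $2$, $Q_+=\sum_i\mathbb Z_{\ge0}\alpha_i$, $[n]_i=\frac{((-1)^{p(i)}q_i)^n-q_i^{-n}}{(-1)^{p(i)}q_i-q_i^{-1}}$,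 with the associated factorials and binomial coefficients. **The algebra $U^+$.** Let $F$ be the free $\mathbb Q(q)$-algebra on $a_{il}$, $(i,l)\in I^\infty$, graded by parity ($p(a_{il})=p(li)$), by $|a_{il}|=l\alpha_i$, and by $\mathbb N I^\infty$ ($a_{il}$ has degree $(i,l)$). Let $F\otimes F$ have the product $(x_1\otimes x_2)(x_3\otimes x_4)=(-1)^{p(x_2)p(x_3)}q^{(|x_2|,|x_3|)}x_1x_3\otimes x_2x_4$, let $\varrho:F\to F\otimes F$ be the algebra homomorphism with $\varrho(a_{il})=a_{il}\otimes1+1\otimes a_{il}$, and let $(\cdot,\cdot)$ be the bilinear form on $F$ with $(1,1)=1$, $(a_{il},a_{jk})=\delta_{ij}\delta_{lk}(1-(-1)^{p(li)}q_i^{2l})^{-1}$, $(x,yy')=(\varrho(x),y\otimes y')$, $(xx',y)=(x\otimes x',\varrho(y))$. Let $\mathscr R$ be its radical, $U^+=F/\mathscr R$, and $U^+_\nu$ the image of $F_\nu$ for $\nu\in\mathbb N I^\infty$. **The algebra $U$.** $U=U_q(\mathfrak g)$ is the $\mathbb Q(q)$-superalgebra generated by $a_{il},b_{il}$ (of parity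 $p(li)$), $(i,l)\in I^\infty$, and even $q^h$, $h\in P^\vee$, with relations: $q^0=1$, $q^hq^{h'}=q^{h+h'}$; $q^ha_{il}q^{-h}=q^{l\langle h,\alpha_i\rangle}a_{il}$, $q^hb_{il}q^{-h}=q^{-l\langle h,\alpha_i\rangle}b_{il}$; for $i\in I^{\rm re}$, $(j,k)\in I^\infty$, $(j,k)\neq(i,1)$ and $N=1-ka_{ij}$, $$\sum_{t+t'=N}(-1)^{t'}(-1)^{p(i)(t'p(kj)+\binom{t'}2)}\begin{bmatrix}N\\t'\end{bmatrix}_i a_i^{t}a_{jk}a_i^{t'}=0$$ and the same with $b$ in place of $a$ (here $a_i=a_{i1}$, $b_i=b_{i1}$); $a_{il}a_{jk}-(-1)^{p(li)p(kj)}a_{jk}a_{il}=b_{il}b_{jk}-(-1)^{p(li)p(kj)}b_{jk}b_{il}=0$ if $a_{ij}=0$; and $$a_{il}b_{jk}-(-1)^{p(li)p(kj)}b_{jk}a_{il}=\delta_{ij}\delta_{kl}\frac{K_i^l-K_i^{-l}}{1-(-1)^{p(li)}q_i^{2l}},\qquad K_i^l=q^{ld_ih_i}.$$ Let $x\mapsto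 x^+$ and $x\mapsto x^-$ be the algebra homomorphisms $F\to U$ with $a_{il}^+=a_{il}$, $a_{il}^-=b_{il}$. Let $S:U\to U$ be the linear map with $S(a_{il})=-K_i^{-l}a_{il}$, $S(b_{il})=-b_{il}K_i^l$, $S(q^h)=q^{-h}$ and $S(xy)=(-1)^{p(x)p(y)}S(y)S(x)$ for homogeneous $x,y$. **The category $O_{int}$** consists of the $U$-supermodules $M=M_{\bar0}\oplus M_{\bar1}$ such that: (a) $M=\bigoplus_{\mu\in P}M_\mu$, where $M_\mu=\{m: q^hm=q^{\langle h,\mu\rangle}m\ \forall h\in P^\vee\}=(M_\mu\cap M_{\bar 0})\oplus(M_\mu\cap M_{\bar 1})$ and $\dim M_\mu<\infty$; (b) there are $\lambda_1,\dots,\lambda_r\in P$ such that all $\mu$ with $M_\mu\ne0$ lie in $\bigcup_j(\lambda_j-Q_+)$; (c) $b_i$ is locally nilpotent on $M$ for $i\in I^{\rm re}$; and for $i\in I^{\rm im}$: (d) $\langle h_i,\mu\rangle\ge0$ whenever $M_\mu\neq0$; (e) $b_{il}M_\mu=0$ for all $l>0$ if $\langle h_i,\mu\rangle=0$; (f) $a_{il}M_\mu=0$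 for all $l>0$ with $\langle h_i,\mu\rangle\le-la_{ii}$. **Proposition.** For each $\nu\in\mathbb N I^\infty$ let $B_\nu$ be a basis of $U^+_\nu$ and $\{b^*\}_{b\in B_\nu}$ the dual basis with respect to $(\cdot,\cdot)$, and choose arbitrary representatives of all these elements in $F_\nu$. Let $\operatorname{ht}(\nu)$ be the number of parts of $\nu$ (with multiplicity) and $e(\nu)=\sum_{p<q}p(l_pi_p)\,p(l_qi_q)$ for $\nu=\sum_p(i_p,l_p)$. Let $M\in O_{int}$. Then for every $m\in M$ only finitely many $\nu$ admit $b\in B_\nu$ with $b^{*+}m\ne0$, and the partial sums $$\Omega_{\le n}m=\sum_{\operatorname{ht}(\nu)\le n}\ \sum_{b\in B_\nu}(-1)^{\operatorname{ht}(\nu)+e(\nu)}S(b^-)\,b^{*+}m$$ are independent of $n$ for $n$ large. Their eventual value $\Omega(m)=\sum_{\nu}\sum_{b\in B_\nu}(-1)^{\operatorname{ht}(\nu)+e(\nu)}S(b^-)\,b^{*+}m$ defines a linear map $\Omega:M\to M$, and for all $(i,l)\in I^\infty$, as operators on $M$, $$K_i^{-l}a_{il}\Omega=K_i^l\Omega a_{il},\qquad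 \Omega b_{il}=b_{il}K_i^l\Omega K_i^l,\qquad \Omega K_i^l=K_i^l\Omega .$$ -/

import Mathlib

open scoped TensorProduct

/-- The ground field `ℚ(q)`. -/
abbrev Kq : Type := RatFunc ℚ

/-- The indeterminate `q`. -/
noncomputable abbrev qv : Kq := RatFunc.X

/-- A super Borcherds-Cartan datum with index set `I` and weight lattice `P` (a free abelian group,
the freeness being a type class assumption where the datum is used).  The dual weight lattice is
`Module.Dual ℤ P`.  Since `P` is free, linear independence of the simple roots over `ℤ` is the same
as linear independence over `ℂ` in `ℂ ⊗ P`. -/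
structure SuperBorcherdsCartanDatum (I P : Type*) [AddCommGroup P] where
  /-- the Borcherds-Cartan matrix -/
  A : I → I → ℤ
  /-- the symmetrizing diagonal matrix -/
  d : I → ℕ
  /-- the simple roots -/
  root : I → P
  /-- the simple coroots -/
  coroot : I → Module.Dual ℤ P
  /-- the odd indices -/
  odd : Set I
  diag : ∀ i, A i i = 2 ∨ (A i i ≤ 0 ∧ Even (A i i))
  offdiag : ∀ i j, i ≠ j → A i j ≤ 0
  d_pos : ∀ i, 0 < d i
  symm : ∀ i j, (d i : ℤ) * A i j = (d j : ℤ) * A j i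
  pairing : ∀ i j, coroot i (root j) = A i j
  linearIndependent_root : LinearIndependent ℤ root
  even_of_odd : ∀ i ∈ odd, ∀ j, Even (A i j)
  exists_fundamentalWeight : ∀ i, ∃ Λ : P, coroot i Λ = 1 ∧ ∀ j, j ≠ i → coroot j Λ = 0

namespace SuperBorcherdsCartanDatum

variable {I P : Type*} [AddCommGroup P] (D : SuperBorcherdsCartanDatum I P)

/-- `I^∞ = (I^re × {1}) ⊔ (I^im × ℤ_{>0})`. -/
def Iinf : Type _ := {x : I × ℕ+ // D.A x.1 x.1 = 2 → x.2 = 1}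

variable {D} in
/-- the index `i` of `(i, l)` -/
def Iinf.idx (x : D.Iinf) : I := x.1.1

variable {D} in
/-- the number `l` of `(i, l)` -/
def Iinf.mul (x : D.Iinf) : ℕ := x.1.2

/-- the pair `(i, 1)`, abbreviated `i` -/
def simple (i : I) : D.Iinf := ⟨(i, 1), fun _ => rfl⟩

/-- the pairing `(l α_i, k α_j) = l k d_i a_ij` -/
def form₀ (x y : D.Iinf) : ℤ := (x.mul : ℤ) * (y.mul : ℤ) * ((D.d x.idx : ℤ) * D.A x.idx y.idx)

open Classical in
/-- the parity `p(i) ∈ {0, 1}` of an index -/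
noncomputable def par (i : I) : ℕ := if i ∈ D.odd then 1 else 0

/-- the parity `p(li) ∈ {0, 1}` of `a_il` and `b_il` -/
noncomputable def parity (x : D.Iinf) : ℕ := (x.mul * D.par x.idx) % 2

/-- `q_i = q ^ d_i` -/
noncomputable def qi (i : I) : Kq := qv ^ D.d i

/-- `1 - (-1)^{p(li)} q_i^{2l}` -/
noncomputable def cden (x : D.Iinf) : Kq := 1 - (-1) ^ D.parity x * D.qi x.idx ^ (2 * x.mul)

/-- `[n]_i = (((-1)^{p(i)} q_i)^n - q_i^{-n}) / ((-1)^{p(i)} q_i - q_i^{-1})` -/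
noncomputable def qint (i : I) (n : ℕ) : Kq :=
  (((-1) ^ D.par i * D.qi i) ^ n - (D.qi i ^ n)⁻¹) / ((-1) ^ D.par i * D.qi i - (D.qi i)⁻¹)

/-- `[n]_i^!` -/
noncomputable def qfact (i : I) (n : ℕ) : Kq := ∏ s ∈ Finset.Icc 1 n, D.qint i s

/-- the binomial coefficient `[n; t]_i` for `0 ≤ t ≤ n` -/
noncomputable def qbinom (i : I) (n t : ℕ) : Kq :=
  D.qfact i n / (D.qfact i t * D.qfact i (n - t))

/-! ### The free superalgebra `F` and its bilinear form -/

/-- The free algebra `F` on the generators `a_il`. -/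
abbrev F : Type _ := FreeAlgebra Kq D.Iinf

/-- the generator `a_il` of `F` -/
noncomputable abbrev gen (x : D.Iinf) : D.F := FreeAlgebra.ι Kq x

/-- The content in `ℕ I^∞` of a word in the generators. -/
noncomputable def content (w : List D.Iinf) : D.Iinf →₀ ℕ :=
  (w.map fun x => Finsupp.single x 1).sum

/-- The monomial `a_{x₁} ⋯ a_{xₙ}`. -/
noncomputable def word (w : List D.Iinf) : D.F := (w.map D.gen).prod

/-- The homogeneous component `F_ν` for `ν ∈ ℕ I^∞`. -/
noncomputable def Fdeg (ν : D.Iinf →₀ ℕ) : Submodule Kq D.F :=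
  Submodule.span Kq {x | ∃ w : List D.Iinf, D.content w = ν ∧ x = D.word w}

/-- The algebra automorphism of `F` which multiplies a homogeneous `y` by
`(-1)^{p(a_x) p(y)} q^{(|a_x|, |y|)}`. -/
noncomputable def twist (x : D.Iinf) : D.F →ₐ[Kq] D.F :=
  FreeAlgebra.lift Kq fun y =>
    ((-1 : Kq) ^ (D.parity x * D.parity y) * qv ^ D.form₀ x y) • D.gen y

/-- Left multiplication by `a_x ⊗ 1 + 1 ⊗ a_x` in `F ⊗ F`, for the product
`(x₁ ⊗ x₂)(x₃ ⊗ x₄) = (-1)^{p(x₂) p(x₃)} q^{(|x₂|, |x₃|)} x₁ x₃ ⊗ x₂ x₄`: one has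
`(a_x ⊗ 1)(y ⊗ z) = a_x y ⊗ z` and
`(1 ⊗ a_x)(y ⊗ z) = (-1)^{p(a_x) p(y)} q^{(|a_x|, |y|)} y ⊗ a_x z`. -/
noncomputable def leftMulRho (x : D.Iinf) : Module.End Kq (D.F ⊗[Kq] D.F) :=
  TensorProduct.map (LinearMap.mulLeft Kq (D.gen x)) LinearMap.id
    + TensorProduct.map (D.twist x).toLinearMap (LinearMap.mulLeft Kq (D.gen x))

/-- The algebra homomorphism `ϱ : F → F ⊗ F` (twisted product on `F ⊗ F`) with
`ϱ(a_x) = a_x ⊗ 1 + 1 ⊗ a_x`; so `ϱ(a_{x₁} ⋯ a_{xₙ}) = ϱ(a_{x₁}) (⋯ (ϱ(a_{xₙ}) (1 ⊗ 1)))`. -/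
noncomputable def rho : D.F →ₗ[Kq] D.F ⊗[Kq] D.F :=
  (LinearMap.applyₗ ((1 : D.F) ⊗ₜ[Kq] (1 : D.F))).comp
    (FreeAlgebra.lift Kq D.leftMulRho).toLinearMap

/-- The linear form `ξ_x` on `F` which takes the value `(1 - (-1)^{p(li)} q_i^{2l})⁻¹` on
`a_x`, where `x = (i, l)`, and `0` on all the other monomials. -/
noncomputable def xi (x : D.Iinf) : D.F →ₗ[Kq] Kq :=
  (D.cden x)⁻¹ • (FreeAlgebra.basisFreeMonoid Kq D.Iinf).coord (FreeMonoid.of x)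

/-- The product `f g = (f ⊗ g) ∘ ϱ` of two linear forms on `F`, as a linear map in `g`. -/
noncomputable def convol (f : D.F →ₗ[Kq] Kq) : Module.End Kq (D.F →ₗ[Kq] Kq) where
  toFun g := ((TensorProduct.lid Kq Kq).toLinearMap.comp (TensorProduct.map f g)).comp D.rho
  map_add' g h := by
    rw [TensorProduct.map_add_right, LinearMap.comp_add, LinearMap.add_comp]
  map_smul' c g := by
    rw [TensorProduct.map_smul_right, LinearMap.comp_smul, LinearMap.smul_comp]; rfl

/-- The algebra homomorphism `φ : F → F^*` with `φ(a_x) = ξ_x`, followed by the inclusion of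
`F^*` in the space of linear forms; the unit of `F^*` is the counit of `F`. -/
noncomputable def phi : D.F →ₗ[Kq] D.F →ₗ[Kq] Kq :=
  (LinearMap.applyₗ (FreeAlgebra.algebraMapInv : D.F →ₐ[Kq] Kq).toLinearMap).comp
    (FreeAlgebra.lift Kq fun x => D.convol (D.xi x)).toLinearMap

/-- The bilinear form `(x, y) = φ(y)(x)` on `F`. -/
noncomputable def form (x y : D.F) : Kq := D.phi y x

/-- The radical of the bilinear form; `U^+ = F / radical`. -/
noncomputable def radical : Submodule Kq D.F where
  carrier := {x | ∀ y, D.form x y = 0}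
  add_mem' hx hy z := by simpa [form] using by rw [show D.phi z _ = 0 from hx z,
    show D.phi z _ = 0 from hy z, add_zero]
  zero_mem' z := by simp [form]
  smul_mem' c x hx z := by simpa [form] using Or.inr (hx z)

/-- The vector space `U^+ = F / radical`. -/
abbrev Uplus : Type _ := D.F ⧸ D.radical

/-- The component `U^+_ν`, the image of `F_ν`, for `ν ∈ ℕ I^∞`. -/
noncomputable def UplusDeg (ν : D.Iinf →₀ ℕ) : Submodule Kq D.Uplus :=
  (D.Fdeg ν).map D.radical.mkQ

/-! ### The quantum Borcherds-Bozec superalgebra -/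

/-- Generators `a_il`, `b_il`, `q^h`. -/
inductive Gen : Type _
  | a (x : D.Iinf)
  | b (x : D.Iinf)
  | t (h : Module.Dual ℤ P)

variable {D} in
/-- The parity of the generators. -/
noncomputable def Gen.parity : D.Gen → ℕ
  | .a x => D.parity x
  | .b x => D.parity x
  | .t _ => 0

/-- The coefficient `(-1)^{t'} (-1)^{p(i)(t' p(kj) + binom(t', 2))} [N; t']_i`. -/
noncomputable def serreCoeff (i : I) (pj N t' : ℕ) : Kq :=
  (-1) ^ t' * (-1) ^ (D.par i * (t' * pj + t'.choose 2)) * D.qbinom i N t'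

/-- `∑_{t + t' = N} (-1)^{t'} (-1)^{p(i)(t' p(kj) + binom(t', 2))} [N; t']_i u^t v u^{t'}`,
with `N = 1 - k a_ij` where `y = (j, k)`; one has `a_ij ≤ 0` in the relations below. -/
noncomputable def serre {R : Type*} [Ring R] [Algebra Kq R] (i : I) (y : D.Iinf) (u v : R) : R :=
  ∑ t' ∈ Finset.range ((1 - (y.mul : ℤ) * D.A i y.idx).toNat + 1),
    D.serreCoeff i (D.parity y) (1 - (y.mul : ℤ) * D.A i y.idx).toNat t' •
      (u ^ ((1 - (y.mul : ℤ) * D.A i y.idx).toNat - t') * v * u ^ t')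

/-- The element `l d_i h_i` of the dual weight lattice, so that `K_i^l = q^{l d_i h_i}`. -/
def kap (x : D.Iinf) : Module.Dual ℤ P := ((x.mul : ℤ) * (D.d x.idx : ℤ)) • D.coroot x.idx

open FreeAlgebra in
/-- The defining relations. -/
inductive Rel : FreeAlgebra Kq D.Gen → FreeAlgebra Kq D.Gen → Prop
  | t_zero : Rel (ι Kq (.t 0)) 1
  | t_add (h h') : Rel (ι Kq (.t h) * ι Kq (.t h')) (ι Kq (.t (h + h')))
  | t_a (h x) : Rel (ι Kq (.t h) * ι Kq (.a x) * ι Kq (.t (-h)))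
      (qv ^ ((x.mul : ℤ) * h (D.root x.idx)) • ι Kq (.a x))
  | t_b (h x) : Rel (ι Kq (.t h) * ι Kq (.b x) * ι Kq (.t (-h)))
      (qv ^ (-((x.mul : ℤ) * h (D.root x.idx))) • ι Kq (.b x))
  | serre_a (i y) : D.A i i = 2 → y ≠ D.simple i →
      Rel (D.serre i y (ι Kq (.a (D.simple i))) (ι Kq (.a y))) 0
  | serre_b (i y) : D.A i i = 2 → y ≠ D.simple i →
      Rel (D.serre i y (ι Kq (.b (D.simple i))) (ι Kq (.b y))) 0
  | comm_a (x y) : D.A x.idx y.idx = 0 →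
      Rel (ι Kq (.a x) * ι Kq (.a y)
        - (-1 : Kq) ^ (D.parity x * D.parity y) • (ι Kq (.a y) * ι Kq (.a x))) 0
  | comm_b (x y) : D.A x.idx y.idx = 0 →
      Rel (ι Kq (.b x) * ι Kq (.b y)
        - (-1 : Kq) ^ (D.parity x * D.parity y) • (ι Kq (.b y) * ι Kq (.b x))) 0
  | a_b_ne (x y) : x ≠ y →
      Rel (ι Kq (.a x) * ι Kq (.b y)
        - (-1 : Kq) ^ (D.parity x * D.parity y) • (ι Kq (.b y) * ι Kq (.a x))) 0
  | a_b_self (x) :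
      Rel (ι Kq (.a x) * ι Kq (.b x)
        - (-1 : Kq) ^ (D.parity x * D.parity x) • (ι Kq (.b x) * ι Kq (.a x)))
        ((D.cden x)⁻¹ • (ι Kq (.t (D.kap x)) - ι Kq (.t (-D.kap x))))

/-- The quantum Borcherds-Bozec superalgebra `U_q(𝔤)`. -/
def U : Type _ := RingQuot D.Rel

noncomputable instance : Ring D.U := inferInstanceAs (Ring (RingQuot D.Rel))

noncomputable instance : Algebra Kq D.U := inferInstanceAs (Algebra Kq (RingQuot D.Rel))

/-- the projection from the free algebra on the generators -/
noncomputable def proj : FreeAlgebra Kq D.Gen →ₐ[Kq] D.U := RingQuot.mkAlgHom Kq D.Rel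

/-- the image in `U_q(𝔤)` of a generator -/
noncomputable def g (z : D.Gen) : D.U := D.proj (FreeAlgebra.ι Kq z)

/-- the generator `a_il` -/
noncomputable def a (x : D.Iinf) : D.U := D.g (.a x)

/-- the generator `b_il` -/
noncomputable def b (x : D.Iinf) : D.U := D.g (.b x)

/-- the generator `q^h` -/
noncomputable def t (h : Module.Dual ℤ P) : D.U := D.g (.t h)

/-- `K_i^l`, where `x = (i, l)` -/
noncomputable def K (x : D.Iinf) : D.U := D.t (D.kap x)

/-- `K_i^{-l}`, where `x = (i, l)` -/
noncomputable def Kinv (x : D.Iinf) : D.U := D.t (-D.kap x)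

/-- The algebra homomorphism `x ↦ x^+` with `a_il^+ = a_il`. -/
noncomputable def plus : D.F →ₐ[Kq] D.U := FreeAlgebra.lift Kq D.a

/-- The algebra homomorphism `x ↦ x^-` with `a_il^- = b_il`. -/
noncomputable def minus : D.F →ₐ[Kq] D.U := FreeAlgebra.lift Kq D.b

end SuperBorcherdsCartanDatum

namespace SuperBorcherdsCartanDatum

variable {I P : Type*} [AddCommGroup P] (D : SuperBorcherdsCartanDatum I P)

/-! ### The antipode -/

theorem map_serre {R R' : Type*} [Ring R] [Algebra Kq R] [Ring R'] [Algebra Kq R'] (f : R →ₐ[Kq] R')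
    (i : I) (y : D.Iinf) (u v : R) : f (D.serre i y u v) = D.serre i y (f u) (f v) := by
  simp [serre, map_sum]

theorem serre_smul {R : Type*} [Ring R] [Algebra Kq R] (i : I) (y : D.Iinf) (c e : Kq) (u v : R) :
    D.serre i y (c • u) (e • v)
      = (c ^ (1 - (y.mul : ℤ) * D.A i y.idx).toNat * e) • D.serre i y u v := by
  unfold serre
  rw [Finset.smul_sum]
  refine Finset.sum_congr rfl fun t ht => ?_
  generalize (1 - (y.mul : ℤ) * D.A i y.idx).toNat = N at *
  have hN : N = (N - t) + t := by have := Finset.mem_range.1 ht; omega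
  rw [smul_pow, smul_pow, smul_mul_assoc, smul_mul_smul_comm, mul_smul_comm, smul_mul_assoc,
    smul_smul, smul_smul, smul_smul, ← pow_add, ← hN]
  congr 1
  ring

theorem proj_rel {u v : FreeAlgebra Kq D.Gen} (h : D.Rel u v) : D.proj u = D.proj v :=
  RingQuot.mkAlgHom_rel Kq h

/-- Algebra homomorphisms out of `U` from operators which satisfy the relations. -/
noncomputable def lift {R : Type*} [Ring R] [Algebra Kq R] (f : FreeAlgebra Kq D.Gen →ₐ[Kq] R)
    (h : ∀ ⦃u v⦄, D.Rel u v → f u = f v) : D.U →ₐ[Kq] R :=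
  RingQuot.liftAlgHom Kq ⟨f, h⟩

theorem lift_proj {R : Type*} [Ring R] [Algebra Kq R] (f : FreeAlgebra Kq D.Gen →ₐ[Kq] R)
    (h : ∀ ⦃u v⦄, D.Rel u v → f u = f v) (x) : D.lift f h (D.proj x) = f x :=
  RingQuot.liftAlgHom_mkAlgHom_apply Kq f h x

theorem hom_ext' {R : Type*} [Ring R] [Algebra Kq R] {f f' : D.U →ₐ[Kq] R}
    (h : ∀ z, f (D.g z) = f' (D.g z)) : f = f' := by
  apply RingQuot.ringQuot_ext'
  apply FreeAlgebra.hom_ext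
  funext z
  exact h z

theorem t_zero : D.t 0 = 1 := by
  have e := D.proj_rel (Rel.t_zero (D := D))
  rwa [map_one] at e

theorem t_mul_t (h h' : Module.Dual ℤ P) : D.t h * D.t h' = D.t (h + h') := by
  simpa [t, g] using D.proj_rel (Rel.t_add (D := D) h h')

theorem t_mul_a (h : Module.Dual ℤ P) (x : D.Iinf) :
    D.t h * D.a x = qv ^ ((x.mul : ℤ) * h (D.root x.idx)) • (D.a x * D.t h) := by
  have e := D.proj_rel (Rel.t_a (D := D) h x)
  rw [map_mul, map_mul, map_smul] at e
  change D.t h * D.a x * D.t (-h) = _ • D.a x at e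
  rw [← smul_mul_assoc, ← e, mul_assoc, t_mul_t, neg_add_cancel, t_zero, mul_one]

theorem t_mul_b (h : Module.Dual ℤ P) (x : D.Iinf) :
    D.t h * D.b x = qv ^ (-((x.mul : ℤ) * h (D.root x.idx))) • (D.b x * D.t h) := by
  have e := D.proj_rel (Rel.t_b (D := D) h x)
  rw [map_mul, map_mul, map_smul] at e
  change D.t h * D.b x * D.t (-h) = _ • D.b x at e
  rw [← smul_mul_assoc, ← e, mul_assoc, t_mul_t, neg_add_cancel, t_zero, mul_one]

theorem serre_a (i : I) (y : D.Iinf) (hi : D.A i i = 2) (hy : y ≠ D.simple i) :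
    D.serre i y (D.a (D.simple i)) (D.a y) = 0 := by
  have e := D.proj_rel (Rel.serre_a (D := D) i y hi hy)
  rwa [map_serre, map_zero] at e

theorem serre_b (i : I) (y : D.Iinf) (hi : D.A i i = 2) (hy : y ≠ D.simple i) :
    D.serre i y (D.b (D.simple i)) (D.b y) = 0 := by
  have e := D.proj_rel (Rel.serre_b (D := D) i y hi hy)
  rwa [map_serre, map_zero] at e

theorem comm_a (x y : D.Iinf) (h : D.A x.idx y.idx = 0) :
    D.a x * D.a y = (-1 : Kq) ^ (D.parity x * D.parity y) • (D.a y * D.a x) := by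
  have e := D.proj_rel (Rel.comm_a (D := D) x y h)
  rw [map_sub, map_smul, map_mul, map_mul, map_zero] at e
  exact sub_eq_zero.1 e

theorem comm_b (x y : D.Iinf) (h : D.A x.idx y.idx = 0) :
    D.b x * D.b y = (-1 : Kq) ^ (D.parity x * D.parity y) • (D.b y * D.b x) := by
  have e := D.proj_rel (Rel.comm_b (D := D) x y h)
  rw [map_sub, map_smul, map_mul, map_mul, map_zero] at e
  exact sub_eq_zero.1 e

theorem a_mul_b_ne (x y : D.Iinf) (h : x ≠ y) :
    D.a x * D.b y = (-1 : Kq) ^ (D.parity x * D.parity y) • (D.b y * D.a x) := by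
  have e := D.proj_rel (Rel.a_b_ne (D := D) x y h)
  rw [map_sub, map_smul, map_mul, map_mul, map_zero] at e
  exact sub_eq_zero.1 e

theorem a_mul_b_self (x : D.Iinf) :
    D.a x * D.b x - (-1 : Kq) ^ (D.parity x * D.parity x) • (D.b x * D.a x)
      = (D.cden x)⁻¹ • (D.K x - D.Kinv x) := by
  have e := D.proj_rel (Rel.a_b_self (D := D) x)
  rwa [map_sub, map_smul, map_mul, map_mul, map_smul, map_sub] at e

/-- The algebra endomorphism of `U` with `z ↦ (-1)^{n p(z)} z` for homogeneous `z`. -/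
noncomputable def tw (n : ℕ) : D.U →ₐ[Kq] D.U :=
  D.lift (FreeAlgebra.lift Kq fun z => (-1 : Kq) ^ (n * z.parity) • D.g z) (by
    intro u v h
    cases h with
    | t_zero => simpa [Gen.parity, t] using D.t_zero
    | t_add h h' => simpa [Gen.parity, t] using D.t_mul_t h h'
    | t_a h x =>
      have := D.proj_rel (Rel.t_a (D := D) h x)
      rw [map_mul, map_mul, map_smul] at this
      simp only [map_mul, map_smul, FreeAlgebra.lift_ι_apply, Gen.parity, mul_zero, pow_zero,
        one_smul, mul_smul_comm, smul_mul_assoc]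
      rw [smul_comm _ ((-1 : Kq) ^ _)]
      exact congrArg _ this
    | t_b h x =>
      have := D.proj_rel (Rel.t_b (D := D) h x)
      rw [map_mul, map_mul, map_smul] at this
      simp only [map_mul, map_smul, FreeAlgebra.lift_ι_apply, Gen.parity, mul_zero, pow_zero,
        one_smul, mul_smul_comm, smul_mul_assoc]
      rw [smul_comm _ ((-1 : Kq) ^ _)]
      exact congrArg _ this
    | serre_a i y hi hy =>
      rw [map_serre, FreeAlgebra.lift_ι_apply, FreeAlgebra.lift_ι_apply, serre_smul, map_zero]
      exact (congrArg _ (D.serre_a i y hi hy)).trans (smul_zero _)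
    | serre_b i y hi hy =>
      rw [map_serre, FreeAlgebra.lift_ι_apply, FreeAlgebra.lift_ι_apply, serre_smul, map_zero]
      exact (congrArg _ (D.serre_b i y hi hy)).trans (smul_zero _)
    | comm_a x y h =>
      have := D.comm_a x y h
      simp only [map_sub, map_mul, map_smul, FreeAlgebra.lift_ι_apply, mul_smul_comm,
        smul_mul_assoc, map_zero, Gen.parity]
      rw [show D.g (.a x) * D.g (.a y) = _ from this]
      simp only [smul_smul, sub_eq_zero]
      congr 1
      ring
    | comm_b x y h =>
      have := D.comm_b x y h
      simp only [map_sub, map_mul, map_smul, FreeAlgebra.lift_ι_apply, mul_smul_comm,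
        smul_mul_assoc, map_zero, Gen.parity]
      rw [show D.g (.b x) * D.g (.b y) = _ from this]
      simp only [smul_smul, sub_eq_zero]
      congr 1
      ring
    | a_b_ne x y h =>
      have := D.a_mul_b_ne x y h
      simp only [map_sub, map_mul, map_smul, FreeAlgebra.lift_ι_apply, mul_smul_comm,
        smul_mul_assoc, map_zero, Gen.parity]
      rw [show D.g (.a x) * D.g (.b y) = _ from this]
      simp only [smul_smul, sub_eq_zero]
      congr 1
      ring
    | a_b_self x =>
      have := D.a_mul_b_self x
      have hs : (-1 : Kq) ^ (n * D.parity x) * (-1 : Kq) ^ (n * D.parity x) = 1 := by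
        rw [← pow_add, Even.neg_one_pow ⟨_, rfl⟩]
      simp only [map_sub, map_mul, map_smul, FreeAlgebra.lift_ι_apply, mul_smul_comm,
        smul_mul_assoc, Gen.parity, mul_zero, pow_zero, one_smul]
      simp only [smul_smul, hs, one_smul]
      exact this)

theorem tw_g (n : ℕ) (z : D.Gen) : D.tw n (D.g z) = (-1 : Kq) ^ (n * z.parity) • D.g z := by
  rw [tw, show D.g z = D.proj (FreeAlgebra.ι Kq z) from rfl, lift_proj, FreeAlgebra.lift_ι_apply]; rfl

theorem tw_comm (m n : ℕ) (u : D.U) : D.tw m (D.tw n u) = D.tw n (D.tw m u) := by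
  have : (D.tw m).comp (D.tw n) = (D.tw n).comp (D.tw m) := by
    apply D.hom_ext'
    intro z
    change D.tw m (D.tw n (D.g z)) = D.tw n (D.tw m (D.g z))
    simp only [tw_g, map_smul, smul_smul, mul_comm]
  exact DFunLike.congr_fun this u

theorem tw_tw_self (n : ℕ) (u : D.U) : D.tw n (D.tw n u) = u := by
  have : (D.tw n).comp (D.tw n) = AlgHom.id Kq D.U := by
    apply D.hom_ext'
    intro z
    change D.tw n (D.tw n (D.g z)) = D.g z
    simp only [tw_g, map_smul, smul_smul, ← pow_add]
    rw [Even.neg_one_pow ⟨_, rfl⟩, one_smul]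
  exact DFunLike.congr_fun this u

theorem tw_zero (u : D.U) : D.tw 0 u = u := by
  have : D.tw 0 = AlgHom.id Kq D.U := by
    apply D.hom_ext'
    intro z
    change D.tw 0 (D.g z) = D.g z
    simp [tw_g]
  exact DFunLike.congr_fun this u

/-- The values of the antipode on the generators. -/
noncomputable def Sgen : D.Gen → D.U
  | .a x => -(D.Kinv x * D.a x)
  | .b x => -(D.b x * D.K x)
  | .t h => D.t (-h)

theorem tw_t (n : ℕ) (h) : D.tw n (D.t h) = D.t h := by
  simpa [Gen.parity, t] using D.tw_g n (.t h)

theorem tw_Sgen (n : ℕ) (z : D.Gen) :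
    D.tw n (D.Sgen z) = (-1 : Kq) ^ (n * z.parity) • D.Sgen z := by
  cases z with
  | a x =>
    have := D.tw_g n (.a x)
    simp only [Sgen, map_neg, map_mul, Kinv, tw_t]
    rw [show D.tw n (D.a x) = _ from this, mul_smul_comm, smul_neg]; rfl
  | b x =>
    have := D.tw_g n (.b x)
    simp only [Sgen, map_neg, map_mul, K, tw_t]
    rw [show D.tw n (D.b x) = _ from this, smul_mul_assoc, smul_neg]; rfl
  | t h => simp [Sgen, tw_t, Gen.parity]

/-- The operator `u ↦ (-1)^{p(z) p(u)} u S(z)` for a generator `z`. -/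
noncomputable def Sop (z : D.Gen) : Module.End Kq D.U :=
  (LinearMap.mulRight Kq (D.Sgen z)).comp (D.tw z.parity).toLinearMap

theorem Sop_apply (z : D.Gen) (u : D.U) : D.Sop z u = D.tw z.parity u * D.Sgen z := rfl

theorem Sop_pow_apply (z : D.Gen) (n : ℕ) (u : D.U) :
    (D.Sop z ^ n) u = (-1 : Kq) ^ (z.parity * z.parity * n.choose 2) •
      ((D.tw z.parity)^[n] u * D.Sgen z ^ n) := by
  induction n generalizing u with
  | zero => simp
  | succ n ih =>
    rw [pow_succ, Module.End.mul_apply, ih, Sop_apply, iterate_map_mul, Function.iterate_succ_apply]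
    have h : ∀ k, (D.tw z.parity)^[k] (D.Sgen z)
        = (-1 : Kq) ^ (z.parity * z.parity * k) • D.Sgen z := by
      intro k
      induction k with
      | zero => simp
      | succ k ihk =>
        rw [Function.iterate_succ_apply', ihk, map_smul, tw_Sgen, smul_smul, ← pow_add]; rfl
    rw [h, mul_smul_comm, smul_mul_assoc, smul_smul, ← pow_add,
      mul_assoc _ (D.Sgen z), ← pow_succ', Nat.choose_succ_succ' n 1, Nat.choose_one_right]
    congr 2
    ring

theorem tw_iter_smul (m n : ℕ) (u : D.U) (c : ℕ) (h : ∀ k, D.tw k u = (-1 : Kq) ^ (k * c) • u) :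
    (D.tw m)^[n] u = (-1 : Kq) ^ (n * (m * c)) • u := by
  induction n with
  | zero => simp
  | succ n ih =>
    rw [Function.iterate_succ_apply', ih, map_smul, h, smul_smul, ← pow_add]
    congr 2; ring

theorem Sop_word (z y : D.Gen) (m n : ℕ) (u : D.U) :
    (D.Sop z ^ m * D.Sop y * D.Sop z ^ n) u =
      (-1 : Kq) ^ (z.parity * z.parity * (m + n).choose 2 + z.parity * y.parity * (m + n)) •
        (D.tw y.parity ((D.tw z.parity)^[m + n] u) *
          (D.Sgen z ^ n * D.Sgen y * D.Sgen z ^ m)) := by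
  have hz : ∀ k, D.tw k (D.Sgen z ^ n) = (-1 : Kq) ^ (k * (n * z.parity)) • D.Sgen z ^ n := by
    intro k
    rw [map_pow, tw_Sgen, smul_pow, ← pow_mul]; congr 2; ring
  have hy : ∀ k, D.tw k (D.Sgen y) = (-1 : Kq) ^ (k * y.parity) • D.Sgen y := fun k => D.tw_Sgen k y
  have hc : ∀ (j : ℕ) v, (D.tw z.parity)^[j] (D.tw y.parity v)
      = D.tw y.parity ((D.tw z.parity)^[j] v) := by
    intro j
    induction j with
    | zero => intro v; rfl
    | succ j ih => intro v; rw [Function.iterate_succ_apply, tw_comm, ih]; rfl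
  have hch : (m + n).choose 2 = m.choose 2 + n.choose 2 + m * n := by
    have := Nat.add_choose_eq m n 2
    rw [this, Finset.Nat.sum_antidiagonal_eq_sum_range_succ_mk]
    simp [Finset.sum_range_succ]; ring
  have hz' : ∀ j k, (D.tw j)^[k] (D.Sgen z ^ n)
      = (-1 : Kq) ^ (k * (j * (n * z.parity))) • D.Sgen z ^ n := fun j k => D.tw_iter_smul _ _ _ _ hz
  rw [Module.End.mul_apply, Module.End.mul_apply, Sop_pow_apply, Sop_apply, Sop_pow_apply, map_smul,
    map_mul, hz, mul_smul_comm, smul_smul, smul_mul_assoc, ← pow_add]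
  have hs : ∀ (c : Kq) (v : D.U), (D.tw z.parity)^[m] (c • v) = c • (D.tw z.parity)^[m] v := by
    intro c
    generalize m = j
    induction j with
    | zero => intro v; rfl
    | succ j ih => intro v; rw [Function.iterate_succ_apply, map_smul, ih]; rfl
  rw [hs, iterate_map_mul, iterate_map_mul, hc, hz', D.tw_iter_smul _ _ _ _ hy,
    ← Function.iterate_add_apply]
  simp only [mul_smul_comm, smul_mul_assoc, smul_smul, ← pow_add, mul_assoc]
  congr 2
  rw [hch]
  ring

/-- In an algebra where `k_i u = s^{-1} u k_i` etc., the powers of the `k`'s are collected. -/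
theorem word_collect {R : Type*} [Ring R] [Algebra Kq R] (k l u v : R) (s r : Kq)
    (huk : u * k = s • (k * u)) (hul : u * l = r • (l * u)) (hvk : v * k = r • (k * v))
    (hkl : k * l = l * k) (m n : ℕ) :
    (k * u) ^ m * (l * v) * (k * u) ^ n
      = (s ^ (m + n).choose 2 * r ^ (m + n)) • (k ^ (m + n) * l * (u ^ m * v * u ^ n)) := by
  have h1 : ∀ (w : R) (c : Kq), w * k = c • (k * w) → ∀ j, w * k ^ j = c ^ j • (k ^ j * w) := by
    intro w c h j
    induction j with
    | zero => simp
    | succ j ih =>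
      rw [pow_succ, ← mul_assoc, ih, smul_mul_assoc, mul_assoc, h, mul_smul_comm, smul_smul,
        ← pow_succ, mul_assoc]
  have h2 : ∀ (w : R) (c : Kq), u * w = c • (w * u) → ∀ j, u ^ j * w = c ^ j • (w * u ^ j) := by
    intro w c h j
    induction j with
    | zero => simp
    | succ j ih =>
      rw [pow_succ, mul_assoc, h, mul_smul_comm, ← mul_assoc, ih, smul_mul_assoc, smul_smul,
        mul_assoc, ← pow_succ']
  have h3 : ∀ j, (k * u) ^ j = s ^ j.choose 2 • (k ^ j * u ^ j) := by
    intro j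
    induction j with
    | zero => simp
    | succ j ih =>
      rw [pow_succ, ih, smul_mul_assoc, mul_assoc (k ^ j), ← mul_assoc (u ^ j), h2 k s huk,
        smul_mul_assoc, mul_smul_comm, smul_smul, ← pow_add, Nat.choose_succ_succ' j 1,
        Nat.choose_one_right, add_comm j, mul_assoc k, ← pow_succ, ← mul_assoc, ← pow_succ]
  have h4 : ∀ i j, u ^ i * k ^ j = s ^ (i * j) • (k ^ j * u ^ i) := by
    intro i j
    rw [h1 (u ^ i) (s ^ i) (h2 k s huk i), pow_mul]
  have hch : (m + n).choose 2 = m.choose 2 + n.choose 2 + m * n := by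
    rw [Nat.add_choose_eq m n 2, Finset.Nat.sum_antidiagonal_eq_sum_range_succ_mk]
    simp [Finset.sum_range_succ]; ring
  have hl : l * k ^ n = k ^ n * l := ((Commute.pow_left (show Commute k l from hkl) n).eq).symm
  rw [h3, h3]
  simp only [smul_mul_assoc, mul_smul_comm, smul_smul]
  have key : k ^ m * u ^ m * (l * v) * (k ^ n * u ^ n)
      = (r ^ m * r ^ n * s ^ (m * n)) • (k ^ (m + n) * l * (u ^ m * v * u ^ n)) := by
    calc k ^ m * u ^ m * (l * v) * (k ^ n * u ^ n)
        = k ^ m * (u ^ m * l) * (v * k ^ n) * u ^ n := by simp only [mul_assoc]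
      _ = (r ^ m * r ^ n) • (k ^ m * (l * (u ^ m * k ^ n)) * (v * u ^ n)) := by
          rw [h2 l r hul, h1 v r hvk]
          simp only [smul_mul_assoc, mul_smul_comm, smul_smul, mul_assoc]
          rw [mul_comm]
      _ = (r ^ m * r ^ n * s ^ (m * n)) • (k ^ m * (l * k ^ n) * (u ^ m * (v * u ^ n))) := by
          rw [h4]
          simp only [smul_mul_assoc, mul_smul_comm, smul_smul, mul_assoc]
      _ = _ := by rw [hl]; simp only [pow_add, mul_assoc]
  rw [key, smul_smul, hch]
  congr 1
  ring

end SuperBorcherdsCartanDatum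

namespace SuperBorcherdsCartanDatum

variable {I P : Type*} [AddCommGroup P] (D : SuperBorcherdsCartanDatum I P)

theorem serreCoeff_flip (i : I) (y : D.Iinf) {N : ℕ}
    (hN : N = (1 - (y.mul : ℤ) * D.A i y.idx).toNat) (hle : D.A i y.idx ≤ 0) {t : ℕ} (ht : t ≤ N) :
    D.serreCoeff i (D.parity y) N (N - t)
      = (-1) ^ N * (-1) ^ (D.par i * (N * D.parity y + N.choose 2))
          * D.serreCoeff i (D.parity y) N t := by
  obtain ⟨s, rfl⟩ := Nat.exists_eq_add_of_le ht
  have hs : t + s - t = s := by omega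
  have hq : D.qbinom i (t + s) s = D.qbinom i (t + s) t := by
    rw [qbinom, qbinom, Nat.add_sub_cancel, hs, mul_comm (D.qfact i s)]
  rw [hs, serreCoeff, serreCoeff, hq, ← mul_assoc]
  congr 1
  simp only [← pow_add]
  have hch : (t + s).choose 2 = t.choose 2 + s.choose 2 + t * s := by
    rw [Nat.add_choose_eq t s 2, Finset.Nat.sum_antidiagonal_eq_sum_range_succ_mk]
    simp [Finset.sum_range_succ]; ring
  have hev : Even (D.par i * (t * s)) := by
    unfold par
    split_ifs with hi
    · obtain ⟨r, hr⟩ := D.even_of_odd i hi y.idx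
      have hodd : Odd (t + s) := by
        have h0 : (0 : ℤ) ≤ 1 - (y.mul : ℤ) * D.A i y.idx := by
          nlinarith [mul_nonneg (Int.natCast_nonneg y.mul) (neg_nonneg.2 hle)]
        have h1 : ((t + s : ℕ) : ℤ) = 1 - (y.mul : ℤ) * D.A i y.idx := by
          rw [hN, Int.toNat_of_nonneg h0]
        have : Odd ((t + s : ℕ) : ℤ) := by
          rw [h1, hr]; exact ⟨-(y.mul * r), by ring⟩
        exact_mod_cast this
      rw [one_mul, Nat.even_mul]
      rcases Nat.even_or_odd t with h | h
      · exact Or.inl h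
      · right
        rw [Nat.odd_add] at hodd
        exact hodd.1 h
    · simp
  apply neg_one_pow_congr
  obtain ⟨w, hw⟩ := hev
  have e : t + s + D.par i * ((t + s) * D.parity y + (t + s).choose 2)
      + (t + D.par i * (t * D.parity y + t.choose 2))
      = s + D.par i * (s * D.parity y + s.choose 2)
        + 2 * (t + D.par i * (t * D.parity y + t.choose 2) + w) := by
    have : D.par i * (t * s) = 2 * w := by omega
    rw [hch]
    linear_combination this
  rw [e, Nat.even_add (m := s + _)]
  simp only [even_two, Even.mul_right, iff_true]

end SuperBorcherdsCartanDatum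
namespace SuperBorcherdsCartanDatum

variable {I P : Type*} [AddCommGroup P] (D : SuperBorcherdsCartanDatum I P)

theorem serre_reverse {R : Type*} [Ring R] [Algebra Kq R] (i : I) (y : D.Iinf)
    (hle : D.A i y.idx ≤ 0) (k l u v X Y : R) (c e s r : Kq) (hX : X = c • (k * u))
    (hY : Y = e • (l * v))
    (huk : u * k = s • (k * u)) (hul : u * l = r • (l * u)) (hvk : v * k = r • (k * v))
    (hkl : k * l = l * k) {N : ℕ} (hN : N = (1 - (y.mul : ℤ) * D.A i y.idx).toNat)
    (h0 : D.serre i y u v = 0) :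
    ∑ t ∈ Finset.range (N + 1),
      D.serreCoeff i (D.parity y) N t • (X ^ t * Y * X ^ (N - t)) = 0 := by
  have h1 : ∀ t ∈ Finset.range (N + 1),
      D.serreCoeff i (D.parity y) N t • (X ^ t * Y * X ^ (N - t)) =
      (c ^ N * e * (s ^ N.choose 2 * r ^ N)) • (k ^ N * l *
        (D.serreCoeff i (D.parity y) N t • (u ^ t * v * u ^ (N - t)))) := by
    intro t ht
    have ht' : t + (N - t) = N := by have := Finset.mem_range.1 ht; omega
    have := word_collect k l u v s r huk hul hvk hkl t (N - t)
    rw [ht'] at this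
    rw [hX, hY, smul_pow, smul_pow, smul_mul_smul_comm, smul_mul_smul_comm, this, mul_smul_comm,
      smul_smul, smul_smul, smul_smul]
    congr 1
    conv_rhs => rw [show c ^ N = c ^ t * c ^ (N - t) by rw [← pow_add, ht']]
    ring
  rw [Finset.sum_congr rfl h1, ← Finset.smul_sum, ← Finset.mul_sum]
  have h2 : ∑ t ∈ Finset.range (N + 1),
      D.serreCoeff i (D.parity y) N t • (u ^ t * v * u ^ (N - t)) = 0 := by
    rw [← Finset.sum_range_reflect]
    have h3 : ∀ t ∈ Finset.range (N + 1),
        D.serreCoeff i (D.parity y) N (N + 1 - 1 - t) •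
          (u ^ (N + 1 - 1 - t) * v * u ^ (N - (N + 1 - 1 - t)))
        = ((-1 : Kq) ^ N * (-1) ^ (D.par i * (N * D.parity y + N.choose 2))) •
          (D.serreCoeff i (D.parity y) N t • (u ^ (N - t) * v * u ^ t)) := by
      intro t ht
      have ht' : t ≤ N := by have := Finset.mem_range.1 ht; omega
      rw [show N + 1 - 1 - t = N - t by omega, show N - (N - t) = t by omega,
        D.serreCoeff_flip i y hN hle ht', smul_smul]
    rw [Finset.sum_congr rfl h3, ← Finset.smul_sum]
    subst hN
    exact (congrArg _ h0).trans (smul_zero _)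
  rw [h2, mul_zero, smul_zero]

theorem serre_Sop (i : I) (y : D.Iinf) (z w : D.Gen) 
    (h : ∑ t ∈ Finset.range ((1 - (y.mul : ℤ) * D.A i y.idx).toNat + 1),
      D.serreCoeff i (D.parity y) (1 - (y.mul : ℤ) * D.A i y.idx).toNat t •
        (D.Sgen z ^ t * D.Sgen w * D.Sgen z ^ ((1 - (y.mul : ℤ) * D.A i y.idx).toNat - t)) = 0) :
    D.serre i y (D.Sop z) (D.Sop w) = 0 := by
  unfold serre
  generalize (1 - (y.mul : ℤ) * D.A i y.idx).toNat = N at *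
  ext u
  rw [LinearMap.sum_apply, LinearMap.zero_apply]
  have h1 : ∀ t ∈ Finset.range (N + 1),
      (D.serreCoeff i (D.parity y) N t • (D.Sop z ^ (N - t) * D.Sop w * D.Sop z ^ t)) u
      = (-1 : Kq) ^ (z.parity * z.parity * N.choose 2 + z.parity * w.parity * N) •
        (D.tw w.parity ((D.tw z.parity)^[N] u) * (D.serreCoeff i (D.parity y) N t •
          (D.Sgen z ^ t * D.Sgen w * D.Sgen z ^ (N - t)))) := by
    intro t ht
    have ht' : N - t + t = N := by have := Finset.mem_range.1 ht; omega
    rw [LinearMap.smul_apply, Sop_word, ht', smul_comm, mul_smul_comm]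
  rw [Finset.sum_congr rfl h1, ← Finset.smul_sum, ← Finset.mul_sum, h, mul_zero, smul_zero]

theorem a_mul_t (h : Module.Dual ℤ P) (x : D.Iinf) :
    D.a x * D.t h = qv ^ (-((x.mul : ℤ) * h (D.root x.idx))) • (D.t h * D.a x) := by
  rw [t_mul_a, smul_smul, ← zpow_add₀ RatFunc.X_ne_zero]; simp

theorem b_mul_t (h : Module.Dual ℤ P) (x : D.Iinf) :
    D.b x * D.t h = qv ^ ((x.mul : ℤ) * h (D.root x.idx)) • (D.t h * D.b x) := by
  rw [t_mul_b, smul_smul, ← zpow_add₀ RatFunc.X_ne_zero]; simp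

theorem kap_apply (x y : D.Iinf) : (y.mul : ℤ) * D.kap x (D.root y.idx) = D.form₀ x y := by
  simp [kap, form₀, D.pairing]; ring

theorem form₀_comm (x y : D.Iinf) : D.form₀ x y = D.form₀ y x := by
  rw [form₀, form₀, D.symm]; ring

theorem a_mul_Kinv (x y : D.Iinf) :
    D.a y * D.Kinv x = qv ^ (D.form₀ x y) • (D.Kinv x * D.a y) := by
  rw [Kinv, a_mul_t, LinearMap.neg_apply, mul_neg, neg_neg, kap_apply]

theorem b_mul_K (x y : D.Iinf) :
    D.b y * D.K x = qv ^ (D.form₀ x y) • (D.K x * D.b y) := by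
  rw [K, b_mul_t, kap_apply]

theorem a_mul_K (x y : D.Iinf) :
    D.a y * D.K x = qv ^ (-D.form₀ x y) • (D.K x * D.a y) := by
  rw [K, a_mul_t, kap_apply]

theorem b_mul_Kinv (x y : D.Iinf) :
    D.b y * D.Kinv x = qv ^ (-D.form₀ x y) • (D.Kinv x * D.b y) := by
  rw [Kinv, b_mul_t, LinearMap.neg_apply, mul_neg, kap_apply]

theorem t_comm (h h' : Module.Dual ℤ P) : D.t h * D.t h' = D.t h' * D.t h := by
  rw [t_mul_t, t_mul_t, add_comm]

theorem sign_mul_self (n : ℕ) : (-1 : Kq) ^ n * (-1 : Kq) ^ n = 1 := by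
  rw [← pow_add, Even.neg_one_pow ⟨_, rfl⟩]

theorem Sgen_comm_a (x y : D.Iinf) (h : D.A x.idx y.idx = 0) :
    D.Sgen (.a y) * D.Sgen (.a x)
      = (-1 : Kq) ^ (D.parity x * D.parity y) • (D.Sgen (.a x) * D.Sgen (.a y)) := by
  have hz : D.form₀ x y = 0 := by simp [form₀, h]
  have hz' : D.form₀ y x = 0 := by rw [form₀_comm, hz]
  have e : ∀ p q : D.Iinf, D.form₀ q p = 0 → D.Sgen (.a p) * D.Sgen (.a q)
      = (D.Kinv p * D.Kinv q) * (D.a p * D.a q) := by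
    intro p q hpq
    have := D.a_mul_Kinv q p
    rw [hpq, zpow_zero, one_smul] at this
    simp only [Sgen, neg_mul_neg]
    rw [mul_assoc, ← mul_assoc (D.a p), this]
    simp only [mul_assoc]
  rw [e _ _ hz, e _ _ hz', D.comm_a x y h, mul_smul_comm, smul_smul, sign_mul_self, one_smul]
  simp only [Kinv, D.t_comm]

theorem Sgen_comm_b (x y : D.Iinf) (h : D.A x.idx y.idx = 0) :
    D.Sgen (.b y) * D.Sgen (.b x)
      = (-1 : Kq) ^ (D.parity x * D.parity y) • (D.Sgen (.b x) * D.Sgen (.b y)) := by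
  have hz : D.form₀ x y = 0 := by simp [form₀, h]
  have hz' : D.form₀ y x = 0 := by rw [form₀_comm, hz]
  have e : ∀ p q : D.Iinf, D.form₀ p q = 0 → D.Sgen (.b p) * D.Sgen (.b q)
      = (D.b p * D.b q) * (D.K p * D.K q) := by
    intro p q hpq
    have := D.b_mul_K p q
    rw [hpq, zpow_zero, one_smul] at this
    simp only [Sgen, neg_mul_neg]
    rw [mul_assoc, ← mul_assoc (D.K p), ← this]
    simp only [mul_assoc]
  rw [e _ _ hz', e _ _ hz, D.comm_b x y h, smul_mul_assoc, smul_smul, sign_mul_self, one_smul]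
  simp only [K, D.t_comm]

theorem Sgen_b_mul_a (x y : D.Iinf) :
    D.Sgen (.b y) * D.Sgen (.a x) = (qv ^ (D.form₀ y y) * qv ^ (-D.form₀ x y)) •
      (D.K y * D.Kinv x * (D.b y * D.a x)) := by
  simp only [Sgen, neg_mul_neg]
  rw [b_mul_K, smul_mul_assoc, mul_assoc (D.K y), ← mul_assoc (D.b y), b_mul_Kinv, smul_mul_assoc,
    mul_smul_comm, smul_smul]
  simp only [mul_assoc]

theorem Sgen_a_mul_b (x y : D.Iinf) :
    D.Sgen (.a x) * D.Sgen (.b y) = (qv ^ (D.form₀ y y) * qv ^ (-D.form₀ x y)) •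
      (D.K y * D.Kinv x * (D.a x * D.b y)) := by
  simp only [Sgen, neg_mul_neg]
  rw [b_mul_K, mul_smul_comm, mul_assoc (D.Kinv x), ← mul_assoc (D.a x), a_mul_K, smul_mul_assoc,
    mul_smul_comm, smul_smul, form₀_comm D y x, K, Kinv, D.t_comm (D.kap y)]
  simp only [mul_assoc]

theorem nonpos_of_ne_simple (i : I) (y : D.Iinf) (hi : D.A i i = 2) (hy : y ≠ D.simple i) :
    D.A i y.idx ≤ 0 := by
  apply D.offdiag
  rintro rfl
  apply hy
  apply Subtype.ext
  exact Prod.ext rfl (y.2 hi)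

theorem Sop_rel ⦃u v : FreeAlgebra Kq D.Gen⦄ (h : D.Rel u v) :
    FreeAlgebra.lift Kq D.Sop u = FreeAlgebra.lift Kq D.Sop v := by
  have hmul : ∀ (z w : D.Gen) (u : D.U), (D.Sop z * D.Sop w) u
      = (-1 : Kq) ^ (z.parity * w.parity) •
        (D.tw z.parity (D.tw w.parity u) * (D.Sgen w * D.Sgen z)) := by
    intro z w u
    rw [Module.End.mul_apply, Sop_apply, Sop_apply, map_mul, tw_Sgen, mul_smul_comm,
      smul_mul_assoc, mul_assoc]
  cases h with
  | t_zero =>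
    ext u
    simp [Sop_apply, Sgen, Gen.parity, tw_zero, t_zero]
  | t_add h h' =>
    ext u
    rw [map_mul, FreeAlgebra.lift_ι_apply, FreeAlgebra.lift_ι_apply, FreeAlgebra.lift_ι_apply, hmul]
    simp only [Gen.parity, Sop_apply, Sgen, tw_zero, t_mul_t]
    simp [add_comm]
  | t_a h x =>
    ext u
    rw [map_mul, map_mul, map_smul, FreeAlgebra.lift_ι_apply, FreeAlgebra.lift_ι_apply,
      FreeAlgebra.lift_ι_apply, Module.End.mul_apply, hmul]
    simp only [Gen.parity, Sop_apply, Sgen, tw_zero, LinearMap.smul_apply, neg_neg, zero_mul,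
      pow_zero, one_smul, map_mul, tw_t]
    have e : D.t h * (-(D.Kinv x * D.a x) * D.t (-h))
        = qv ^ ((x.mul : ℤ) * h (D.root x.idx)) • -(D.Kinv x * D.a x) := by
      rw [neg_mul, mul_assoc (D.Kinv x), a_mul_t, LinearMap.neg_apply, mul_neg (x.mul : ℤ), neg_neg,
        mul_smul_comm, ← smul_neg, mul_smul_comm, mul_neg, ← mul_assoc, ← mul_assoc, Kinv,
        D.t_comm h, mul_assoc (D.t _) (D.t h), t_mul_t, add_neg_cancel, t_zero, mul_one]
    rw [mul_assoc, e, mul_smul_comm]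
  | t_b h x =>
    ext u
    rw [map_mul, map_mul, map_smul, FreeAlgebra.lift_ι_apply, FreeAlgebra.lift_ι_apply,
      FreeAlgebra.lift_ι_apply, Module.End.mul_apply, hmul]
    simp only [Gen.parity, Sop_apply, Sgen, tw_zero, LinearMap.smul_apply, neg_neg, zero_mul,
      pow_zero, one_smul, map_mul, tw_t]
    have e : D.t h * (-(D.b x * D.K x) * D.t (-h))
        = qv ^ (-((x.mul : ℤ) * h (D.root x.idx))) • -(D.b x * D.K x) := by
      rw [neg_mul, mul_neg, ← mul_assoc, ← mul_assoc, t_mul_b, smul_mul_assoc, smul_mul_assoc,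
        smul_neg, mul_assoc (D.b x), K, D.t_comm h, mul_assoc, mul_assoc (D.t _) (D.t h), t_mul_t,
        add_neg_cancel, t_zero, mul_one]
    rw [mul_assoc, e, mul_smul_comm]
  | serre_a i y hi hy =>
    rw [map_serre, FreeAlgebra.lift_ι_apply, FreeAlgebra.lift_ι_apply, map_zero]
    apply D.serre_Sop i y
    have hle := D.nonpos_of_ne_simple i y hi hy
    refine D.serre_reverse i y hle (D.Kinv (D.simple i)) (D.Kinv y) (D.a (D.simple i)) (D.a y) _ _
      (-1) (-1) _ _ (by simp [Sgen]) (by simp [Sgen]) (D.a_mul_Kinv _ _) (D.a_mul_Kinv _ _)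
      (by rw [form₀_comm]; exact D.a_mul_Kinv _ _) (D.t_comm _ _) rfl (D.serre_a i y hi hy)
  | serre_b i y hi hy =>
    rw [map_serre, FreeAlgebra.lift_ι_apply, FreeAlgebra.lift_ι_apply, map_zero]
    apply D.serre_Sop i y
    have hle := D.nonpos_of_ne_simple i y hi hy
    refine D.serre_reverse i y hle (D.K (D.simple i)) (D.K y) (D.b (D.simple i)) (D.b y) _ _
      (-qv ^ (D.form₀ (D.simple i) (D.simple i))) (-qv ^ (D.form₀ y y)) _ _
      (by simp [Sgen, b_mul_K]) (by simp [Sgen, b_mul_K]) (D.b_mul_K _ _) (D.b_mul_K _ _)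
      (by rw [form₀_comm]; exact D.b_mul_K _ _) (D.t_comm _ _) rfl (D.serre_b i y hi hy)
  | comm_a x y h =>
    ext u
    rw [map_sub, map_smul, map_mul, map_mul, FreeAlgebra.lift_ι_apply, FreeAlgebra.lift_ι_apply,
      map_zero, LinearMap.sub_apply, LinearMap.smul_apply, hmul, hmul, tw_comm, D.Sgen_comm_a x y h,
      LinearMap.zero_apply]
    simp only [Gen.parity, mul_smul_comm, smul_smul]
    rw [mul_comm (D.parity y), sub_self]
  | comm_b x y h =>
    ext u
    rw [map_sub, map_smul, map_mul, map_mul, FreeAlgebra.lift_ι_apply, FreeAlgebra.lift_ι_apply,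
      map_zero, LinearMap.sub_apply, LinearMap.smul_apply, hmul, hmul, tw_comm, D.Sgen_comm_b x y h,
      LinearMap.zero_apply]
    simp only [Gen.parity, mul_smul_comm, smul_smul]
    rw [mul_comm (D.parity y), sub_self]
  | a_b_ne x y h =>
    ext u
    rw [map_sub, map_smul, map_mul, map_mul, FreeAlgebra.lift_ι_apply, FreeAlgebra.lift_ι_apply,
      map_zero, LinearMap.sub_apply, LinearMap.smul_apply, hmul, hmul, tw_comm, Sgen_b_mul_a,
      Sgen_a_mul_b, D.a_mul_b_ne x y h, LinearMap.zero_apply]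
    simp only [Gen.parity, mul_smul_comm, smul_smul]
    rw [mul_comm (D.parity y), sub_eq_zero]
    congr 1
    linear_combination (-(-1 : Kq) ^ (D.parity x * D.parity y) * qv ^ D.form₀ y y
      * qv ^ (-D.form₀ x y)) * sign_mul_self (D.parity x * D.parity y)
  | a_b_self x =>
    ext u
    have hK : D.K x * D.Kinv x = 1 := by rw [K, Kinv, t_mul_t, add_neg_cancel, t_zero]
    have hq : (qv ^ (D.form₀ x x) * qv ^ (-D.form₀ x x) : Kq) = 1 := by
      rw [← zpow_add₀ RatFunc.X_ne_zero]; simp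
    rw [map_sub, map_smul, map_mul, map_mul, map_smul, map_sub, FreeAlgebra.lift_ι_apply,
      FreeAlgebra.lift_ι_apply, FreeAlgebra.lift_ι_apply, FreeAlgebra.lift_ι_apply,
      LinearMap.sub_apply, LinearMap.smul_apply, hmul, hmul, Sgen_b_mul_a,
      Sgen_a_mul_b, hK, hq]
    simp only [Gen.parity, one_smul, one_mul, tw_tw_self, smul_smul, sign_mul_self,
      LinearMap.smul_apply, LinearMap.sub_apply, Sop_apply, tw_zero, Sgen, neg_neg]
    have e := D.a_mul_b_self x
    have e' : D.a x * D.b x = (-1 : Kq) ^ (D.parity x * D.parity x) • (D.b x * D.a x)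
      + (D.cden x)⁻¹ • (D.K x - D.Kinv x) := by rw [← e]; abel
    rw [e', mul_add, mul_smul_comm, mul_smul_comm, mul_sub, K, Kinv, ← mul_sub, ← mul_sub,
      ← neg_sub (D.t (D.kap x)), mul_neg, smul_neg]
    abel

/-- The representation `u ↦ (v ↦ (-1)^{p(u) p(v)} v S(u))`. -/
noncomputable def Srep : D.U →ₐ[Kq] Module.End Kq D.U :=
  D.lift (FreeAlgebra.lift Kq D.Sop) D.Sop_rel

/-- The antipode `S : U → U`: the linear map with `S(a_il) = -K_i^{-l} a_il`,
`S(b_il) = -b_il K_i^l`, `S(q^h) = q^{-h}` and `S(xy) = (-1)^{p(x) p(y)} S(y) S(x)`; see the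
three facts below. -/
noncomputable def S : D.U →ₗ[Kq] D.U := (LinearMap.applyₗ (1 : D.U)).comp D.Srep.toLinearMap

theorem Srep_g (z : D.Gen) : D.Srep (D.g z) = D.Sop z := by
  rw [Srep, g, lift_proj, FreeAlgebra.lift_ι_apply]

theorem S_one : D.S 1 = 1 := by simp [S]

theorem S_g (z : D.Gen) : D.S (D.g z) = D.Sgen z := by simp [S, Srep_g, Sop_apply]

theorem S_g_mul (z : D.Gen) (u : D.U) : D.S (D.g z * u) = D.tw z.parity (D.S u) * D.Sgen z := by
  change D.Srep (D.g z * u) 1 = _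
  rw [map_mul, Srep_g, Module.End.mul_apply, Sop_apply]; rfl

theorem induction_U {p : D.U → Prop} (h1 : p 1) (hadd : ∀ u v, p u → p v → p (u + v))
    (hsmul : ∀ (c : Kq) u, p u → p (c • u)) (hg : ∀ z u, p u → p (D.g z * u)) (u : D.U) : p u := by
  obtain ⟨w, rfl⟩ := RingQuot.mkAlgHom_surjective Kq D.Rel u
  suffices h : ∀ w v, p v → p (D.proj w * v) by
    have := h w 1 h1
    rwa [mul_one] at this
  intro w
  induction w using FreeAlgebra.induction with
  | grade0 r =>
    intro v hv
    rw [AlgHom.commutes, ← Algebra.smul_def]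
    exact hsmul r v hv
  | grade1 z => exact fun v hv => hg z v hv
  | mul x y hx hy => intro v hv; rw [map_mul, mul_assoc]; exact hx _ (hy v hv)
  | add x y hx hy => intro v hv; rw [map_add, add_mul]; exact hadd _ _ (hx v hv) (hy v hv)

/-- Homogeneous elements of `U` of parity `p`. -/
def IsHomog (p : ℕ) (u : D.U) : Prop := ∀ n, D.tw n u = (-1 : Kq) ^ (n * p) • u

theorem S_tw (n : ℕ) (u : D.U) : D.S (D.tw n u) = D.tw n (D.S u) := by
  refine D.induction_U (p := fun u => D.S (D.tw n u) = D.tw n (D.S u)) ?_ ?_ ?_ ?_ u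
  · simp [S_one]
  · intro u v hu hv; simp only [map_add, hu, hv]
  · intro c u hu; simp only [map_smul, hu]
  · intro z u hu
    rw [map_mul, tw_g, smul_mul_assoc, map_smul, S_g_mul, hu, S_g_mul, map_mul, tw_Sgen, tw_comm,
      mul_smul_comm]

theorem S_mul {p r : ℕ} {u v : D.U} (hu : D.IsHomog p u) (hv : D.IsHomog r v) :
    D.S (u * v) = (-1 : Kq) ^ (p * r) • (D.S v * D.S u) := by
  have hSv : ∀ n, D.tw n (D.S v) = (-1 : Kq) ^ (n * r) • D.S v := fun n => by
    rw [← S_tw, hv n, map_smul]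
  have key : ∀ u, D.S (u * v) = D.S v * D.S (D.tw r u) := by
    intro u
    refine D.induction_U (p := fun u => D.S (u * v) = D.S v * D.S (D.tw r u)) ?_ ?_ ?_ ?_ u
    · simp [S_one]
    · intro u v hu hv; simp only [map_add, hu, hv, add_mul, mul_add]
    · intro c u hu; simp only [map_smul, hu, smul_mul_assoc, mul_smul_comm]
    · intro z u hu
      rw [mul_assoc, S_g_mul, hu, map_mul, hSv, map_mul (D.tw r), tw_g,
        smul_mul_assoc _ (D.g z), map_smul, S_g_mul,
        smul_mul_assoc, smul_mul_assoc, mul_smul_comm, mul_assoc, mul_comm r]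
  rw [key, hu, map_smul, mul_smul_comm, mul_comm r]

end SuperBorcherdsCartanDatum

namespace SuperBorcherdsCartanDatum

variable {I P : Type*} [AddCommGroup P] (D : SuperBorcherdsCartanDatum I P)

/-! ### Modules and the category `O_int` -/

/-- `Q_+`, the set of all sums of simple roots -/
def Qplus : AddSubmonoid P := AddSubmonoid.closure (Set.range D.root)

section modules

variable (M : Type*) [AddCommGroup M] [Module Kq M] [Module D.U M] [IsScalarTower Kq D.U M]

/-- The weight space `M_μ`. -/
noncomputable def weightSpace (μ : P) : Submodule Kq M where
  carrier := {m | ∀ h : Module.Dual ℤ P, D.t h • m = qv ^ (h μ) • m}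
  add_mem' hx hy h := by rw [smul_add, smul_add, hx h, hy h]
  zero_mem' h := by simp
  smul_mem' c x hx h := by
    rw [← algebraMap_smul D.U c x, ← mul_smul, ← Algebra.commutes, mul_smul, hx h,
      algebraMap_smul, algebraMap_smul, smul_comm]

/-- `M` is a super module `M = M_0̄ ⊕ M_1̄` with `M_μ = M_{μ,0̄} ⊕ M_{μ,1̄}` for all `μ`. -/
def HasParity : Prop :=
  ∃ N : ZMod 2 → Submodule Kq M, IsCompl (N 0) (N 1) ∧
    (∀ (z : D.Gen) (j : ZMod 2), ∀ m ∈ N j, D.g z • m ∈ N (j + z.parity)) ∧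
    ∀ μ : P, D.weightSpace M μ = (D.weightSpace M μ ⊓ N 0) ⊔ (D.weightSpace M μ ⊓ N 1)

/-- The objects of the category `O_int`. -/
structure IsOint : Prop where
  hasParity : D.HasParity M
  iSupIndep_weightSpace : iSupIndep fun μ : P => D.weightSpace M μ
  iSup_weightSpace : ⨆ μ : P, D.weightSpace M μ = ⊤
  finite_weightSpace : ∀ μ : P, Module.Finite Kq (D.weightSpace M μ)
  bounded : ∃ s : Finset P, ∀ μ : P, D.weightSpace M μ ≠ ⊥ → ∃ lam ∈ s, lam - μ ∈ D.Qplus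
  locallyNilpotent : ∀ i, D.A i i = 2 → ∀ m : M, ∃ n : ℕ, D.b (D.simple i) ^ n • m = 0
  nonneg : ∀ i, D.A i i ≤ 0 → ∀ μ : P, D.weightSpace M μ ≠ ⊥ → 0 ≤ D.coroot i μ
  b_smul : ∀ x : D.Iinf, D.A x.idx x.idx ≤ 0 → ∀ μ : P, D.coroot x.idx μ = 0 →
    ∀ m ∈ D.weightSpace M μ, D.b x • m = 0
  a_smul : ∀ x : D.Iinf, D.A x.idx x.idx ≤ 0 → ∀ μ : P,
    D.coroot x.idx μ ≤ -((x.mul : ℤ) * D.A x.idx x.idx) →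
    ∀ m ∈ D.weightSpace M μ, D.a x • m = 0

end modules

/-! ### The operator `Ω` -/

/-- The height of `ν ∈ ℕ I^∞`, the number of its parts. -/
def ht (ν : D.Iinf →₀ ℕ) : ℕ := ν.sum fun _ n => n

/-- `e(ν) = ∑_{p < q} p(l_p α_p) p(l_q α_q)` for `ν = ∑_p (i_p, l_p)`: the number of pairs of odd
parts of `ν`. -/
noncomputable def e (ν : D.Iinf →₀ ℕ) : ℕ := (ν.sum fun x n => n * D.parity x).choose 2

/-- A basis `B_ν` of `U^+_ν` and the dual basis `B_ν^*` for the bilinear form.  All elements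
of `U^+ = F / radical` are given by representatives in `F`. -/
structure DualBases (ν : D.Iinf →₀ ℕ) where
  /-- the number of elements of the basis -/
  n : ℕ
  /-- the elements of the basis -/
  b : Fin n → D.F
  /-- the elements of the dual basis -/
  bstar : Fin n → D.F
  b_mem : ∀ s, b s ∈ D.Fdeg ν
  bstar_mem : ∀ s, bstar s ∈ D.Fdeg ν
  linearIndependent : LinearIndependent Kq fun s => D.radical.mkQ (b s)
  span_eq : Submodule.span Kq (Set.range fun s => D.radical.mkQ (b s)) = D.UplusDeg ν
  form_eq : ∀ s s', D.form (b s) (bstar s') = if s = s' then 1 else 0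

variable {D} in
/-- `∑_{b ∈ B_ν} (-1)^{ht ν + e(ν)} S(b^-) b^{*+} m` -/
noncomputable def omegaTerm (B : ∀ ν, D.DualBases ν) {M : Type*} [AddCommGroup M] [Module Kq M]
    [Module D.U M] (ν : D.Iinf →₀ ℕ) (m : M) : M :=
  ∑ s, (-1 : Kq) ^ (D.ht ν + D.e ν) •
    (D.S (D.minus ((B ν).b s)) • (D.plus ((B ν).bstar s) • m))

variable {D} in
/-- The partial sum `Ω_{≤ n} m = ∑_{ht ν ≤ n} ∑_{b ∈ B_ν} (-1)^{ht ν + e(ν)} S(b^-) b^{*+} m`. -/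
noncomputable def omegaLE (B : ∀ ν, D.DualBases ν) {M : Type*} [AddCommGroup M] [Module Kq M]
    [Module D.U M] (n : ℕ) (m : M) : M :=
  ∑ᶠ (ν : D.Iinf →₀ ℕ) (_ : D.ht ν ≤ n), omegaTerm B ν m

end SuperBorcherdsCartanDatum

namespace SuperBorcherdsCartanDatum

variable {I P : Type*} [AddCommGroup P] (D : SuperBorcherdsCartanDatum I P)

/-! ### Dual bases exist -/

theorem rho_word_cons (x : D.Iinf) (z : D.F) :
    D.rho (D.gen x * z) = D.leftMulRho x (D.rho z) := by
  simp [rho]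

theorem phi_gen_mul (x : D.Iinf) (y : D.F) :
    D.phi (D.gen x * y) = D.convol (D.xi x) (D.phi y) := by
  simp [phi]

theorem form_one_one : D.form 1 1 = 1 := by simp [form, phi]

theorem twist_word (x : D.Iinf) (w : List D.Iinf) : ∃ c : Kq, D.twist x (D.word w) = c • D.word w := by
  induction w with
  | nil => exact ⟨1, by simp [word]⟩
  | cons y w ih =>
    obtain ⟨c, hc⟩ := ih
    refine ⟨(-1 : Kq) ^ (D.parity x * D.parity y) * qv ^ D.form₀ x y * c, ?_⟩
    have : D.word (y :: w) = D.gen y * D.word w := by simp [word]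
    rw [this, map_mul, hc, twist, FreeAlgebra.lift_ι_apply, smul_mul_smul_comm]

theorem rho_word_mem (w : List D.Iinf) : D.rho (D.word w) ∈ Submodule.span Kq
    {z | ∃ u v : List D.Iinf, D.content u + D.content v = D.content w ∧
      z = D.word u ⊗ₜ[Kq] D.word v} := by
  induction w with
  | nil =>
    refine Submodule.subset_span ⟨[], [], by simp [content], ?_⟩
    simp [word, rho]
  | cons y w ih =>
    have hw : ∀ w, D.word (y :: w) = D.gen y * D.word w := fun w => by simp [word]
    have hc : ∀ w, D.content (y :: w) = Finsupp.single y 1 + D.content w :=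
      fun w => by simp [content]
    rw [hw, rho_word_cons]
    refine (Submodule.map_span_le (D.leftMulRho y) _ _).2 ?_ (Submodule.mem_map_of_mem ih)
    rintro _ ⟨u, v, huv, rfl⟩
    rw [leftMulRho, LinearMap.add_apply, TensorProduct.map_tmul, TensorProduct.map_tmul]
    obtain ⟨c, hcc⟩ := D.twist_word y u
    refine add_mem (Submodule.subset_span ⟨y :: u, v, ?_, ?_⟩) ?_
    · rw [hc, hc, ← huv, add_assoc]
    · simp [hw]
    · rw [AlgHom.toLinearMap_apply, hcc, ← TensorProduct.smul_tmul']
      refine Submodule.smul_mem _ _ (Submodule.subset_span ⟨u, y :: v, ?_, ?_⟩)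
      · rw [hc, hc, ← huv, add_left_comm]
      · simp [hw]

theorem xi_word (x : D.Iinf) (w : List D.Iinf) (hw : D.content w ≠ Finsupp.single x 1) :
    D.xi x (D.word w) = 0 := by
  have h : D.word w = FreeAlgebra.basisFreeMonoid Kq D.Iinf (FreeMonoid.ofList w) := by
    simp [word, FreeAlgebra.basisFreeMonoid, FreeAlgebra.equivMonoidAlgebraFreeMonoid]
  classical
  rw [xi, LinearMap.smul_apply, h, Module.Basis.coord_apply, Module.Basis.repr_self,
    Finsupp.single_apply, if_neg, smul_zero]
  rintro hh
  apply hw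
  have : w = [x] := hh
  simp [this, content]

theorem form_word (w w' : List D.Iinf) (h : D.content w ≠ D.content w') :
    D.form (D.word w) (D.word w') = 0 := by
  induction w' generalizing w with
  | nil =>
    cases w with
    | nil => exact absurd rfl h
    | cons y w =>
      simp [form, phi, word, show FreeAlgebra.algebraMapInv (D.gen y) = (0 : Kq) by
        simp [FreeAlgebra.algebraMapInv]]
  | cons y w' ih =>
    have hw : ∀ w, D.word (y :: w) = D.gen y * D.word w := fun w => by simp [word]
    have hc : ∀ w, D.content (y :: w) = Finsupp.single y 1 + D.content w :=
      fun w => by simp [content]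
    rw [form, hw, phi_gen_mul]
    change (TensorProduct.lid Kq Kq) (TensorProduct.map (D.xi y) (D.phi (D.word w'))
      (D.rho (D.word w))) = 0
    have hm := D.rho_word_mem w
    generalize D.rho (D.word w) = z at hm
    induction hm using Submodule.span_induction with
    | zero => simp
    | add a b _ _ ha hb => rw [map_add, map_add, ha, hb, add_zero]
    | smul c a _ ha => rw [map_smul, map_smul, ha, smul_zero]
    | mem z hz =>
      obtain ⟨u, v, huv, rfl⟩ := hz
      rw [TensorProduct.map_tmul, TensorProduct.lid_tmul]
      by_cases hu : D.content u = Finsupp.single y 1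
      · have : D.content v ≠ D.content w' := by
          rintro hv; apply h; rw [hc, ← huv, hu, hv]
        rw [show D.phi (D.word w') (D.word v) = 0 from ih v this, smul_zero]
      · rw [xi_word D y u hu, zero_smul]

theorem span_word : Submodule.span Kq (Set.range D.word) = ⊤ := by
  rw [eq_top_iff]
  rintro x -
  induction x using FreeAlgebra.induction with
  | grade0 r =>
    rw [Algebra.algebraMap_eq_smul_one]
    exact Submodule.smul_mem _ _ (Submodule.subset_span ⟨[], by simp [word]⟩)
  | grade1 z => exact Submodule.subset_span ⟨[z], by simp [word]⟩
  | mul x y hx hy =>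
    have := Submodule.mul_mem_mul hx hy
    rw [Submodule.span_mul_span] at this
    refine Submodule.span_mono ?_ this
    rintro _ ⟨_, ⟨u, rfl⟩, _, ⟨v, rfl⟩, rfl⟩
    exact ⟨u ++ v, by simp [word]⟩
  | add x y hx hy => exact add_mem hx hy

theorem form_eq_zero_of_mem {ν ν' : D.Iinf →₀ ℕ} (h : ν ≠ ν') {x y : D.F} (hx : x ∈ D.Fdeg ν)
    (hy : y ∈ D.Fdeg ν') : D.form x y = 0 := by
  induction hx using Submodule.span_induction with
  | zero => simp [form]
  | add a b _ _ ha hb => rw [form, map_add]; exact (congrArg₂ _ ha hb).trans (add_zero _)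
  | smul c a _ ha => rw [form, map_smul]; exact (congrArg _ ha).trans (smul_zero _)
  | mem z hz =>
    obtain ⟨w, hw, rfl⟩ := hz
    induction hy using Submodule.span_induction with
    | zero => simp [form]
    | add a b _ _ ha hb =>
      rw [form, map_add, LinearMap.add_apply]; exact (congrArg₂ _ ha hb).trans (add_zero _)
    | smul c a _ ha =>
      rw [form, map_smul, LinearMap.smul_apply]; exact (congrArg _ ha).trans (smul_zero _)
    | mem z hz =>
      obtain ⟨w', hw', rfl⟩ := hz
      exact D.form_word _ _ (by rw [hw, hw']; exact h)

theorem mem_radical_of_mem {ν : D.Iinf →₀ ℕ} {x : D.F} (hx : x ∈ D.Fdeg ν)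
    (h : ∀ y ∈ D.Fdeg ν, D.form x y = 0) : x ∈ D.radical := by
  intro y
  have hy : y ∈ Submodule.span Kq (Set.range D.word) := by rw [span_word]; trivial
  induction hy using Submodule.span_induction with
  | zero => simp [form]
  | add a b _ _ ha hb =>
    rw [form, map_add, LinearMap.add_apply]; exact (congrArg₂ _ ha hb).trans (add_zero _)
  | smul c a _ ha =>
    rw [form, map_smul, LinearMap.smul_apply]; exact (congrArg _ ha).trans (smul_zero _)
  | mem z hz =>
    obtain ⟨w, rfl⟩ := hz
    have hw : D.word w ∈ D.Fdeg (D.content w) := Submodule.subset_span ⟨w, rfl, rfl⟩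
    by_cases hν : ν = D.content w
    · exact h _ (hν ▸ hw)
    · exact D.form_eq_zero_of_mem hν hx hw

theorem finite_Fdeg (ν : D.Iinf →₀ ℕ) : Module.Finite Kq (D.Fdeg ν) := by
  classical
  apply Module.Finite.span_of_finite
  have hf : Set.Finite {w : List D.Iinf | D.content w = ν} := by
    have hc : ∀ w : List D.Iinf, D.content w = Multiset.toFinsupp (w : Multiset D.Iinf) := by
      intro w
      induction w with
      | nil => simp [content]
      | cons y w ih =>
        rw [← Multiset.cons_coe, ← Multiset.singleton_add, map_add, Multiset.toFinsupp_singleton,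
          ← ih]
        simp [content]
    let m := Multiset.toFinsupp.symm ν
    refine Set.Finite.subset (List.finite_toSet (m.toList.permutations)) ?_
    intro w hw
    have : (w : Multiset D.Iinf) = m := by
      apply Multiset.toFinsupp.injective
      rw [← hc, show D.content w = ν from hw]; simp [m]
    simp only [Set.mem_ofPred_eq, List.mem_permutations]
    rw [← Multiset.coe_eq_coe, this, Multiset.coe_toList]
  refine (hf.image D.word).subset ?_
  rintro _ ⟨w, hw, rfl⟩
  exact ⟨w, hw, rfl⟩

/-- Every `U^+_ν` has a basis which has a dual basis. -/
theorem nonempty_dualBases (ν : D.Iinf →₀ ℕ) : Nonempty (D.DualBases ν) := by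
  have := D.finite_Fdeg ν
  have hfin : Module.Finite Kq (D.UplusDeg ν) := inferInstanceAs (Module.Finite Kq ((D.Fdeg ν).map _))
  let B := Module.finBasis Kq (D.UplusDeg ν)
  have hl : ∀ s, ∃ x ∈ D.Fdeg ν, D.radical.mkQ x = B s := fun s => (B s).2
  choose b hb hbB using hl
  have hli : LinearIndependent Kq fun s => D.radical.mkQ (b s) := by
    have := B.linearIndependent.map' (D.UplusDeg ν).subtype (Submodule.ker_subtype _)
    rw [funext hbB]
    exact this
  let T : D.Fdeg ν →ₗ[Kq] (Fin (Module.finrank Kq (D.UplusDeg ν)) → Kq) :=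
    LinearMap.pi fun s => (LinearMap.applyₗ (b s)).comp (D.phi.comp (D.Fdeg ν).subtype)
  have hT : LinearMap.range T = ⊤ := by
    by_contra hne
    obtain ⟨f, hf0, hf⟩ := Submodule.exists_le_ker_of_lt_top _ (lt_top_iff_ne_top.2 hne)
    apply hf0
    have hx : (∑ s, f (Pi.single s 1) • b s) ∈ D.radical := by
      refine D.mem_radical_of_mem (Submodule.sum_mem _ fun s _ => Submodule.smul_mem _ _ (hb s)) ?_
      intro y hy
      have h1 : f (T ⟨y, hy⟩) = 0 := hf ⟨_, rfl⟩
      rw [form, map_sum, ← h1]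
      conv_rhs => rw [← LinearMap.sum_single_apply (φ := fun _ => Kq) (T ⟨y, hy⟩), map_sum]
      refine Finset.sum_congr rfl fun s _ => ?_
      have : (Pi.single s (T ⟨y, hy⟩ s) : Fin _ → Kq)
          = (T ⟨y, hy⟩ s) • (Pi.single s 1 : Fin _ → Kq) := by
        rw [← Pi.single_smul, smul_eq_mul, mul_one]
      rw [this, map_smul, map_smul, smul_eq_mul, smul_eq_mul, mul_comm]
      rfl
    have h0 : ∑ s, f (Pi.single s 1) • D.radical.mkQ (b s) = 0 := by
      have := (Submodule.Quotient.mk_eq_zero _).2 hx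
      rw [← Submodule.mkQ_apply, map_sum] at this
      simpa only [map_smul] using this
    have hz := Fintype.linearIndependent_iff.1 hli _ h0
    apply LinearMap.pi_ext'
    intro s
    ext
    simpa using hz s
  have hd : ∀ s', ∃ y : D.Fdeg ν, T y = Pi.single s' 1 := fun s' =>
    LinearMap.mem_range.1 (by rw [hT]; trivial)
  choose c hc using hd
  refine ⟨⟨_, b, fun s => c s, hb, fun s => (c s).2, hli, ?_, ?_⟩⟩
  · simp only [hbB]
    rw [show (Set.range fun s => (B s : D.Uplus)) = (D.UplusDeg ν).subtype '' Set.range B by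
      rw [← Set.range_comp]; rfl, ← Submodule.map_span, B.span_eq, Submodule.map_top,
      Submodule.range_subtype]
  · intro s s'
    have := congrFun (hc s') s
    rw [Pi.single_apply] at this
    exact this

end SuperBorcherdsCartanDatum

namespace SuperBorcherdsCartanDatum

variable {I P : Type*} [AddCommGroup P] (D : SuperBorcherdsCartanDatum I P)

/-! ### Skew derivations of the free algebra -/

/-! Up to exactly the sign that Ω carries, S(b^-) is the image of b under the anti-homomorphism a_x
↦ b_x K_x (`sign_smul_S_minus`). Hence the component of Ω in degree ν is the image of the canonical
tensor of the form on U^+_ν.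

The skew derivations ∂_x and ∂'_x (`lder`, `rder`), read off from ϱ, are adjoint to left and right
multiplication by a_x, up to the factor 1 - (-1)^{p(li)} q_i^{2l}. The same derivations appear when
b_x is moved past y^+ (`plus_mul_b`) and when a_x is moved past S(y^-) (`a_mul_anti`). Moving an
operator to the other side of a canonical tensor as its adjoint (`transfer`) therefore shifts the
derivative terms from degree ν + x to degree ν. One family of them cancels against the twisted
commuted terms, the other is the right-hand side (`omega_a`, `omega_b`). Commutation with K_x holds
because b and b^* have the same degree.

Two facts about M are needed. The sum must be locally finite, which follows from the bound on the
weights and the independence of the simple roots (`IsOint.locallyFinite`). And the radical must act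
by zero (`IsOint.radicalFree`), since dual bases exist only modulo the radical. This second fact is
the hard one. It is proved in the manner of Gabber and Kac, for homogeneous r of degree ν in the
radical, by induction on the height of ν, in three cases.

If ∑_{p<s} (ν_p, ν_s) ≠ 0, the operator Ω itself is used on Verma modules realized on F, where no
Serre relations are imposed. Computed termwise on r, it is the identity modulo the ideal J of
radical elements already known to act by zero. Computed on r = ∑ a_x f_x, through the embeddings of
Verma modules given by left multiplication by a_x, it is the scalar q^{-2 ∑_{p<s} (ν_p, ν_s)} modulo
J. The scalar is not 1, so r ∈ J (`mem_of_pairSum_ne_zero`).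

If the sum vanishes and ⟨h_i, ν⟩ > 0 for some real i, the derivatives of r act by zero by induction.
So r^+ commutes with b_i, and S(r^-) with a_i, up to nonzero scalars. On an integrable module of
rank one, an operator which shifts the weights strictly in one direction and commutes in this sense
with the operator of the opposite direction is zero (`RankOne.eq_zero_of_commute`).

In the remaining case, nonpositivity forces all parts of ν to be imaginary and pairwise orthogonal
(`pairwise_of_pairSum`). There the radical is generated by supercommutators
(`SupercommIdeal.mem_of_pairwise`), which vanish in U by definition. -/

open Classical in
/-- The Kronecker delta. -/
noncomputable def delta (x y : D.Iinf) : Kq := if x = y then 1 else 0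

theorem delta_self (x : D.Iinf) : D.delta x x = 1 := if_pos rfl

theorem delta_ne {x y : D.Iinf} (h : x ≠ y) : D.delta x y = 0 := if_neg h

theorem delta_comm (x y : D.Iinf) : D.delta x y = D.delta y x := by
  by_cases h : x = y
  · rw [h]
  · rw [delta_ne D h, delta_ne D (Ne.symm h)]

/-- Lets indices be exchanged under a Kronecker delta without splitting into cases; the scalars
attached to x and to y then match in all Leibniz rules below. -/
theorem delta_smul_eq {W : Type*} [AddCommGroup W] [Module Kq W] (x y : D.Iinf) (f : D.Iinf → W) :
    D.delta x y • f x = D.delta x y • f y := by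
  by_cases h : x = y
  · rw [h]
  · rw [delta_ne D h, zero_smul, zero_smul]

/-- The sign `(-1)^{p(x) p(y)}`. -/
noncomputable def sgn (x y : D.Iinf) : Kq := (-1) ^ (D.parity x * D.parity y)

/-- `q^{(x, y)}`. -/
noncomputable def qf (x y : D.Iinf) : Kq := qv ^ D.form₀ x y

theorem sgn_comm (x y : D.Iinf) : D.sgn x y = D.sgn y x := by simp only [sgn, mul_comm]

theorem qf_comm (x y : D.Iinf) : D.qf x y = D.qf y x := by simp only [qf, form₀_comm D x y]

theorem sgn_mul_sgn (x y : D.Iinf) : D.sgn x y * D.sgn x y = 1 := sign_mul_self _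

theorem qf_ne_zero (x y : D.Iinf) : D.qf x y ≠ 0 := zpow_ne_zero _ RatFunc.X_ne_zero

theorem word_cons (y : D.Iinf) (w) : D.word (y :: w) = D.gen y * D.word w := by simp [word]

theorem word_append (u w) : D.word (u ++ w) = D.word u * D.word w := by simp [word]

theorem word_nil : D.word [] = 1 := by simp [word]

theorem content_cons (y : D.Iinf) (w) :
    D.content (y :: w) = Finsupp.single y 1 + D.content w := by simp [content]

theorem content_nil : D.content [] = 0 := by simp [content]

theorem content_append (u w) : D.content (u ++ w) = D.content u + D.content w := by simp [content]

variable {D} in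
theorem word_induction {p : D.F → Prop} (hw : ∀ w, p (D.word w))
    (hadd : ∀ u v, p u → p v → p (u + v)) (hsmul : ∀ (c : Kq) u, p u → p (c • u)) (z : D.F) :
    p z := by
  have hz : z ∈ Submodule.span Kq (Set.range D.word) := by rw [span_word]; trivial
  induction hz using Submodule.span_induction with
  | zero => simpa using hsmul 0 _ (hw [])
  | add a b _ _ ha hb => exact hadd _ _ ha hb
  | smul c a _ ha => exact hsmul _ _ ha
  | mem z hz => obtain ⟨w, rfl⟩ := hz; exact hw w

variable {D} in
theorem gen_mul_induction {p : D.F → Prop} (h1 : p 1)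
    (hadd : ∀ u v, p u → p v → p (u + v)) (hsmul : ∀ (c : Kq) u, p u → p (c • u))
    (hg : ∀ y z, p z → p (D.gen y * z)) (z : D.F) : p z := by
  refine word_induction (fun w => ?_) hadd hsmul z
  induction w with
  | nil => rwa [word_nil]
  | cons y w ih => rw [word_cons]; exact hg _ _ ih

variable {D} in
theorem mul_gen_induction {p : D.F → Prop} (h1 : p 1)
    (hadd : ∀ u v, p u → p v → p (u + v)) (hsmul : ∀ (c : Kq) u, p u → p (c • u))
    (hg : ∀ y z, p z → p (z * D.gen y)) (z : D.F) : p z := by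
  refine word_induction (fun w => ?_) hadd hsmul z
  induction w using List.reverseRecOn with
  | nil => rwa [word_nil]
  | append_singleton w y ih => rw [word_append, word_cons, word_nil, mul_one]; exact hg _ _ ih

/-- The algebra endomorphism of `F` which multiplies `a_y` by `χ y`. -/
noncomputable def dg (χ : D.Iinf → Kq) : D.F →ₐ[Kq] D.F :=
  FreeAlgebra.lift Kq fun y => χ y • D.gen y

theorem dg_gen (χ : D.Iinf → Kq) (y) : D.dg χ (D.gen y) = χ y • D.gen y := by
  rw [dg, FreeAlgebra.lift_ι_apply]

theorem twist_eq (x : D.Iinf) : D.twist x = D.dg fun y => D.sgn x y * D.qf x y := rfl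

theorem dg_dg (χ ψ : D.Iinf → Kq) (z) : D.dg χ (D.dg ψ z) = D.dg (fun y => χ y * ψ y) z := by
  induction z using gen_mul_induction with
  | h1 => simp
  | hadd u v hu hv => simp only [map_add, hu, hv]
  | hsmul c u hu => simp only [map_smul, hu]
  | hg y z hz =>
    simp only [map_mul, dg_gen, map_smul, hz, smul_smul, smul_mul_assoc]
    rw [mul_comm]

theorem dg_one (z) : D.dg (fun _ => 1) z = z := by
  induction z using gen_mul_induction with
  | h1 => simp
  | hadd u v hu hv => simp only [map_add, hu, hv]
  | hsmul c u hu => simp only [map_smul, hu]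
  | hg y z hz => simp only [map_mul, dg_gen, hz, one_smul]

/-- The counit of `F`. -/
noncomputable def counit : D.F →ₐ[Kq] Kq := FreeAlgebra.algebraMapInv

theorem counit_gen_mul (y : D.Iinf) (z) : D.counit (D.gen y * z) = 0 := by
  rw [map_mul, counit, FreeAlgebra.algebraMapInv, FreeAlgebra.lift_ι_apply]; simp

theorem counit_dg (χ : D.Iinf → Kq) (z) : D.counit (D.dg χ z) = D.counit z := by
  induction z using gen_mul_induction with
  | h1 => simp
  | hadd u v hu hv => simp only [map_add, hu, hv]
  | hsmul c u hu => simp only [map_smul, hu]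
  | hg y z hz => rw [map_mul, dg_gen, smul_mul_assoc, map_smul, counit_gen_mul, counit_gen_mul,
      smul_zero]

/-- The coefficient of the monomial `a_x`. -/
noncomputable def coef (x : D.Iinf) : D.F →ₗ[Kq] Kq :=
  (FreeAlgebra.basisFreeMonoid Kq D.Iinf).coord (FreeMonoid.of x)

theorem xi_eq (x : D.Iinf) : D.xi x = (D.cden x)⁻¹ • D.coef x := rfl

open Classical in
theorem coef_word (x : D.Iinf) (w) : D.coef x (D.word w) = if w = [x] then 1 else 0 := by
  have h : D.word w = FreeAlgebra.basisFreeMonoid Kq D.Iinf (FreeMonoid.ofList w) := by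
    simp [word, FreeAlgebra.basisFreeMonoid, FreeAlgebra.equivMonoidAlgebraFreeMonoid]
  rw [coef, h, Module.Basis.coord_apply, Module.Basis.repr_self, Finsupp.single_apply]
  exact if_congr Iff.rfl rfl rfl

theorem coef_gen_mul (x y : D.Iinf) (z) :
    D.coef x (D.gen y * z) = D.delta x y * D.counit z := by
  induction z using word_induction with
  | hw w =>
    rw [← word_cons, coef_word]
    cases w with
    | nil =>
      rw [word_nil, map_one, mul_one]
      by_cases h : x = y
      · subst h; rw [delta_self, if_pos rfl]
      · rw [delta_ne D h, if_neg (by simpa using Ne.symm h)]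
    | cons y' w => rw [word_cons, counit_gen_mul]; simp
  | hadd u v hu hv => simp only [mul_add, map_add, hu, hv]
  | hsmul c u hu => simp only [mul_smul_comm, map_smul, hu, smul_eq_mul]; ring

theorem coef_one (x : D.Iinf) : D.coef x 1 = 0 := by
  rw [← word_nil, coef_word]; simp

theorem coef_dg (χ : D.Iinf → Kq) (x z) : D.coef x (D.dg χ z) = χ x * D.coef x z := by
  induction z using gen_mul_induction with
  | h1 => simp [coef_one]
  | hadd u v hu hv => simp only [map_add, hu, hv, mul_add]
  | hsmul c u hu => simp only [map_smul, hu, smul_eq_mul]; ring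
  | hg y z hz =>
    rw [map_mul, dg_gen, smul_mul_assoc, map_smul, coef_gen_mul, coef_gen_mul, counit_dg,
      smul_eq_mul, ← mul_assoc, ← mul_assoc]
    have := D.delta_smul_eq x y χ
    simp only [smul_eq_mul] at this
    rw [mul_comm (χ x), this, mul_comm (χ y)]

/-- The left skew derivation: `ϱ(z) = ∑ a_x ⊗ ∂_x z + ⋯`. -/
noncomputable def lder (x : D.Iinf) : D.F →ₗ[Kq] D.F :=
  ((TensorProduct.lid Kq D.F).toLinearMap.comp
    (TensorProduct.map (D.coef x) LinearMap.id)).comp D.rho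

/-- The right skew derivation: `ϱ(z) = ∑ ∂'_x z ⊗ a_x + ⋯`. -/
noncomputable def rder (x : D.Iinf) : D.F →ₗ[Kq] D.F :=
  ((TensorProduct.rid Kq D.F).toLinearMap.comp
    (TensorProduct.map LinearMap.id (D.coef x))).comp D.rho

theorem rho_one : D.rho 1 = 1 ⊗ₜ[Kq] 1 := by simp [rho]

/-- The counit axiom for ϱ. It is what makes the δ-term of `lder_gen_mul` equal to z itself. -/
theorem counit_rho (z) : TensorProduct.lid Kq D.F
    (TensorProduct.map D.counit.toLinearMap LinearMap.id (D.rho z)) = z := by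
  induction z using gen_mul_induction with
  | h1 => simp [rho_one]
  | hadd u v hu hv => simp only [map_add, hu, hv]
  | hsmul c u hu => simp only [map_smul, hu]
  | hg y z hz =>
    rw [rho_word_cons]
    conv_rhs => rw [← hz]
    generalize D.rho z = t
    induction t using TensorProduct.induction_on with
    | zero => simp
    | add u v hu hv => simp only [map_add, hu, hv, mul_add]
    | tmul u v =>
      simp only [leftMulRho, LinearMap.add_apply, TensorProduct.map_tmul, map_add,
        TensorProduct.lid_tmul, LinearMap.mulLeft_apply, AlgHom.toLinearMap_apply, counit_gen_mul,
        LinearMap.id_apply, zero_smul, zero_add, twist_eq, counit_dg, mul_smul_comm]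

theorem rho_counit (z) : TensorProduct.rid Kq D.F
    (TensorProduct.map LinearMap.id D.counit.toLinearMap (D.rho z)) = z := by
  induction z using gen_mul_induction with
  | h1 => simp [rho_one]
  | hadd u v hu hv => simp only [map_add, hu, hv]
  | hsmul c u hu => simp only [map_smul, hu]
  | hg y z hz =>
    rw [rho_word_cons]
    conv_rhs => rw [← hz]
    generalize D.rho z = t
    induction t using TensorProduct.induction_on with
    | zero => simp
    | add u v hu hv => simp only [map_add, hu, hv, mul_add]
    | tmul u v =>
      simp only [leftMulRho, LinearMap.add_apply, TensorProduct.map_tmul, map_add,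
        TensorProduct.rid_tmul, LinearMap.mulLeft_apply, AlgHom.toLinearMap_apply, counit_gen_mul,
        LinearMap.id_apply, zero_smul, add_zero, mul_smul_comm]

theorem lder_one (x : D.Iinf) : D.lder x 1 = 0 := by simp [lder, rho_one, coef_one]

theorem rder_one (x : D.Iinf) : D.rder x 1 = 0 := by simp [rder, rho_one, coef_one]

/-- Read off the a_x ⊗ (·) component of (a_y ⊗ 1 + 1 ⊗ a_y) ϱ(z). The first summand contributes only
through the constant term of the left factor, the second through the commutation of a_y past a_x. -/
theorem lder_gen_mul (x y : D.Iinf) (z) : D.lder x (D.gen y * z)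
    = D.delta x y • z + (D.sgn x y * D.qf x y) • (D.gen y * D.lder x z) := by
  rw [show D.delta x y • z = D.delta x y • TensorProduct.lid Kq D.F
    (TensorProduct.map D.counit.toLinearMap LinearMap.id (D.rho z)) by rw [D.counit_rho]]
  simp only [lder, LinearMap.comp_apply, rho_word_cons, LinearEquiv.coe_coe]
  generalize D.rho z = t
  induction t using TensorProduct.induction_on with
  | zero => simp
  | add u v hu hv => simp only [map_add, hu, hv, mul_add, smul_add]; abel
  | tmul u v =>
    simp only [leftMulRho, LinearMap.add_apply, TensorProduct.map_tmul, map_add,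
        TensorProduct.lid_tmul, LinearMap.mulLeft_apply, AlgHom.toLinearMap_apply, coef_gen_mul,
        LinearMap.id_apply, twist_eq, coef_dg, mul_smul_comm, smul_smul]
    rw [D.sgn_comm x, D.qf_comm x]

theorem rder_gen_mul (x y : D.Iinf) (z) : D.rder x (D.gen y * z)
    = D.gen y * D.rder x z + D.delta x y • D.twist x z := by
  have : D.delta x y • D.twist x z = D.delta x y • D.twist y z :=
    D.delta_smul_eq x y fun x => D.twist x z
  rw [this]
  rw [show D.delta x y • D.twist y z = D.delta x y • D.twist y (TensorProduct.rid Kq D.F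
    (TensorProduct.map LinearMap.id D.counit.toLinearMap (D.rho z))) by rw [D.rho_counit]]
  simp only [rder, LinearMap.comp_apply, rho_word_cons, LinearEquiv.coe_coe]
  generalize D.rho z = t
  induction t using TensorProduct.induction_on with
  | zero => simp
  | add u v hu hv => simp only [map_add, hu, hv, mul_add, smul_add]; abel
  | tmul u v =>
    simp only [leftMulRho, LinearMap.add_apply, TensorProduct.map_tmul, map_add, map_smul,
        TensorProduct.rid_tmul, LinearMap.mulLeft_apply, AlgHom.toLinearMap_apply, coef_gen_mul,
        LinearMap.id_apply, mul_smul_comm, smul_smul]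

theorem lder_gen (x y : D.Iinf) : D.lder x (D.gen y) = D.delta x y • 1 := by
  have := D.lder_gen_mul x y 1
  rwa [mul_one, lder_one, mul_zero, smul_zero, add_zero] at this

theorem rder_gen (x y : D.Iinf) : D.rder x (D.gen y) = D.delta x y • 1 := by
  have := D.rder_gen_mul x y 1
  rwa [mul_one, rder_one, mul_zero, map_one, zero_add] at this

theorem twist_gen_mul (x y : D.Iinf) (z) :
    D.twist x (D.gen y * z) = (D.sgn x y * D.qf x y) • (D.gen y * D.twist x z) := by
  rw [map_mul, twist_eq, dg_gen, smul_mul_assoc]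

/-- The same derivation obeys a Leibniz rule from the right, with the twist now on the δ-term. Both
rules are needed since S(y^-) reverses the order of products. -/
theorem lder_mul_gen (x y : D.Iinf) (z) : D.lder x (z * D.gen y)
    = D.lder x z * D.gen y + D.delta x y • D.twist x z := by
  induction z using gen_mul_induction with
  | h1 => simp [lder_one, lder_gen]
  | hadd u v hu hv => simp only [add_mul, map_add, hu, hv, smul_add]; abel
  | hsmul c u hu =>
    simp only [smul_mul_assoc, map_smul, hu, smul_add]
    rw [smul_comm c]
  | hg w z hz =>
    rw [mul_assoc, lder_gen_mul, hz, lder_gen_mul, twist_gen_mul, mul_add, smul_add, add_mul,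
      smul_mul_assoc, smul_mul_assoc, mul_assoc, mul_smul_comm,
      smul_comm (D.delta x y)]
    abel

theorem rder_mul_gen (x y : D.Iinf) (z) : D.rder x (z * D.gen y)
    = D.delta x y • z + (D.sgn x y * D.qf x y) • (D.rder x z * D.gen y) := by
  induction z using gen_mul_induction with
  | h1 => simp [rder_one, rder_gen]
  | hadd u v hu hv => simp only [add_mul, map_add, hu, hv, smul_add]; abel
  | hsmul c u hu =>
    simp only [smul_mul_assoc, map_smul, hu, smul_add]
    rw [smul_comm c, smul_comm c]
  | hg w z hz =>
    rw [mul_assoc, rder_gen_mul, hz, rder_gen_mul, map_mul, twist_eq, dg_gen, mul_add, add_mul,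
      smul_add, mul_smul_comm, mul_smul_comm, mul_assoc, smul_mul_assoc, mul_smul_comm,
      smul_comm (D.delta x w)]
    abel

theorem lder_dg (χ : D.Iinf → Kq) (x z) : D.lder x (D.dg χ z) = χ x • D.dg χ (D.lder x z) := by
  induction z using gen_mul_induction with
  | h1 => simp [lder_one]
  | hadd u v hu hv => simp only [map_add, hu, hv, smul_add]
  | hsmul c u hu => simp only [map_smul, hu]; rw [smul_comm]
  | hg y z hz =>
    simp only [map_mul, dg_gen, map_add, map_smul, lder_gen_mul, smul_mul_assoc, hz, smul_add,
      mul_smul_comm, smul_smul]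
    congr 1
    · have := D.delta_smul_eq x y χ
      simp only [smul_eq_mul] at this
      rw [mul_comm (χ x), this, mul_comm (χ y)]
    · congr 1; ring

theorem rder_dg (χ : D.Iinf → Kq) (x z) : D.rder x (D.dg χ z) = χ x • D.dg χ (D.rder x z) := by
  induction z using mul_gen_induction with
  | h1 => simp [rder_one]
  | hadd u v hu hv => simp only [map_add, hu, hv, smul_add]
  | hsmul c u hu => simp only [map_smul, hu]; rw [smul_comm]
  | hg y z hz =>
    simp only [map_mul, dg_gen, map_add, map_smul, rder_mul_gen, smul_mul_assoc, hz, smul_add,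
      mul_smul_comm, smul_smul]
    congr 1
    · have := D.delta_smul_eq x y χ
      simp only [smul_eq_mul] at this
      rw [mul_comm (χ x), this, mul_comm (χ y)]
    · congr 1; ring

/-- Plays the role of coassociativity of ϱ: it transports the adjointness from left to right
multiplication. -/
theorem lder_rder (x y : D.Iinf) (z) : D.lder x (D.rder y z) = D.rder y (D.lder x z) := by
  induction z using gen_mul_induction with
  | h1 => simp [rder_one, lder_one]
  | hadd u v hu hv => simp only [map_add, hu, hv]
  | hsmul c u hu => simp only [map_smul, hu]
  | hg w z hz =>
    rw [rder_gen_mul, map_add, lder_gen_mul, lder_gen_mul, map_add, map_smul, map_smul, map_smul,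
      rder_gen_mul, hz, twist_eq, lder_dg, add_assoc, smul_add]
    congr 2
    rw [smul_comm (D.sgn x w * _), D.sgn_comm y x, D.qf_comm y x]
    exact D.delta_smul_eq y w fun t => (D.sgn x t * D.qf x t) •
      D.dg (fun u => D.sgn y u * D.qf y u) (D.lder x z)

/-! ### Adjointness -/

theorem form_add_left (x y z : D.F) : D.form (x + y) z = D.form x z + D.form y z := map_add _ _ _

theorem form_smul_left (c : Kq) (x z : D.F) : D.form (c • x) z = c * D.form x z := map_smul _ _ _

theorem form_add_right (x y z : D.F) : D.form x (y + z) = D.form x y + D.form x z := by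
  simp [form]

theorem form_smul_right (c : Kq) (x z : D.F) : D.form x (c • z) = c * D.form x z := by
  simp [form]

theorem form_one_right (x : D.F) : D.form x 1 = D.counit x := by
  simp [form, phi, counit]

/-- `phi` turns left multiplication by a_x into convolution with `xi`, which is a multiple of the
coefficient functional defining `lder`. -/
theorem form_gen_mul_right (x : D.Iinf) (y z : D.F) :
    D.form y (D.gen x * z) = (D.cden x)⁻¹ * D.form (D.lder x y) z := by
  rw [form, phi_gen_mul]
  change TensorProduct.lid Kq Kq (TensorProduct.map (D.xi x) (D.phi z) (D.rho y)) = _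
  rw [form, lder, LinearMap.comp_apply, LinearMap.comp_apply]
  generalize D.rho y = t
  induction t using TensorProduct.induction_on with
  | zero => simp
  | add u v hu hv => simp only [map_add, hu, hv, mul_add]
  | tmul u v => simp [xi_eq, mul_assoc]

/-- Induction on the second argument by the previous adjointness. The Leibniz rules on both sides
agree because the twisting scalars are symmetric in the two letters. -/
theorem form_gen_mul_left (x : D.Iinf) (z y : D.F) :
    D.form (D.gen x * z) y = (D.cden x)⁻¹ * D.form z (D.lder x y) := by
  induction y using gen_mul_induction generalizing z with
  | h1 => rw [form_one_right, counit_gen_mul, lder_one]; simp [form]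
  | hadd u v hu hv => simp only [map_add, form_add_right, hu, hv, mul_add]
  | hsmul c u hu => simp only [map_smul, form_smul_right, hu]; ring
  | hg w y ih =>
    rw [form_gen_mul_right, lder_gen_mul, lder_gen_mul, form_add_left, form_smul_left,
      form_smul_left, ih, form_add_right, form_smul_right, form_smul_right, form_gen_mul_right,
      D.sgn_comm w, D.qf_comm w, D.delta_comm w]
    have := D.delta_smul_eq x w fun t => (D.cden t)⁻¹
    simp only [smul_eq_mul] at this
    linear_combination -D.form z y * this

theorem form_comm (x y : D.F) : D.form x y = D.form y x := by
  induction x using gen_mul_induction generalizing y with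
  | h1 =>
    rw [form_one_right]
    induction y using gen_mul_induction with
    | h1 => rw [form_one_right]
    | hadd u v hu hv => simp only [map_add, form_add_right, hu, hv]
    | hsmul c u hu => simp only [map_smul, form_smul_right, hu, smul_eq_mul]
    | hg w y ih => rw [form_gen_mul_right, lder_one, counit_gen_mul]; simp [form]
  | hadd u v hu hv => simp only [form_add_left, form_add_right, hu, hv]
  | hsmul c u hu => simp only [form_smul_left, form_smul_right, hu]
  | hg w x ih => rw [form_gen_mul_left, form_gen_mul_right, ih]

theorem form_one_left (x : D.F) : D.form 1 x = D.counit x := by rw [form_comm, form_one_right]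

theorem counit_lder (x : D.Iinf) (z) : D.counit (D.lder x z) = D.counit (D.rder x z) := by
  induction z using gen_mul_induction with
  | h1 => rw [lder_one, rder_one]
  | hadd u v hu hv => simp only [map_add, hu, hv]
  | hsmul c u hu => simp only [map_smul, hu]
  | hg w z ih =>
    rw [lder_gen_mul, rder_gen_mul, map_add, map_add, map_smul, map_smul, map_smul, counit_gen_mul,
      counit_gen_mul, twist_eq, counit_dg]
    simp

/-- Induction on z from the left: each letter comes off as a left derivation, which commutes with
the right one. -/
theorem form_mul_gen_left (x : D.Iinf) (z y : D.F) :
    D.form (z * D.gen x) y = (D.cden x)⁻¹ * D.form z (D.rder x y) := by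
  induction z using gen_mul_induction generalizing y with
  | h1 =>
    rw [one_mul, form_one_left, ← counit_lder, ← form_one_left]
    simpa using D.form_gen_mul_left x 1 y
  | hadd u v hu hv => simp only [add_mul, form_add_left, hu, hv, mul_add]
  | hsmul c u hu => simp only [smul_mul_assoc, form_smul_left, hu]; ring
  | hg w z ih =>
    rw [mul_assoc, form_gen_mul_left, ih, form_gen_mul_left, lder_rder]; ring

theorem form_mul_gen_right (x : D.Iinf) (z y : D.F) :
    D.form z (y * D.gen x) = (D.cden x)⁻¹ * D.form (D.rder x z) y := by
  rw [form_comm, form_mul_gen_left, form_comm]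

theorem form_dg (χ : D.Iinf → Kq) (z y : D.F) : D.form (D.dg χ z) y = D.form z (D.dg χ y) := by
  induction z using gen_mul_induction generalizing y with
  | h1 => rw [map_one, form_one_left, form_one_left, counit_dg]
  | hadd u v hu hv => simp only [map_add, form_add_left, hu, hv]
  | hsmul c u hu => simp only [map_smul, form_smul_left, hu]
  | hg w z ih =>
    rw [map_mul, dg_gen, smul_mul_assoc, form_smul_left, form_gen_mul_left, ih, form_gen_mul_left,
      lder_dg, form_smul_right]
    ring

/-- q is not a root of unity, by degree. The square is there so that signs can be ignored wherever
this is applied. -/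
theorem qv_zpow_eq {n : ℤ} (h : (qv ^ n) ^ 2 = 1) : n = 0 := by
  have h0 : ∀ n : ℕ, (qv ^ n : Kq) ≠ 0 := fun n => pow_ne_zero _ RatFunc.X_ne_zero
  have h1 : ∀ n : ℕ, RatFunc.intDegree (qv ^ n : Kq) = n := by
    intro n
    induction n with
    | zero => simp
    | succ n ih =>
      rw [pow_succ, RatFunc.intDegree_mul (h0 n) RatFunc.X_ne_zero, ih, RatFunc.intDegree_X]; simp
  rw [← zpow_natCast, ← zpow_mul] at h
  have h2 : ∀ k : ℕ, (qv ^ k : Kq) = 1 → k = 0 := by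
    intro k hk
    have := h1 k
    rw [hk, RatFunc.intDegree_one] at this
    exact_mod_cast this.symm
  rcases Int.eq_nat_or_neg (n * (2 : ℕ)) with ⟨k, hk | hk⟩
  · rw [hk, zpow_natCast] at h
    have := h2 k h
    omega
  · rw [hk, zpow_neg, zpow_natCast, inv_eq_one] at h
    have := h2 k h
    omega

theorem cden_ne_zero (x : D.Iinf) : D.cden x ≠ 0 := by
  intro h
  rw [cden, sub_eq_zero, qi, ← pow_mul] at h
  have h2 : ((qv : Kq) ^ ((D.d x.idx * (2 * x.mul) : ℕ) : ℤ)) ^ 2 = 1 := by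
    rw [zpow_natCast]
    have := congrArg (fun t => t ^ 2) h
    simp only [mul_pow, one_pow] at this
    rwa [← pow_mul (-1 : Kq), mul_comm _ 2, pow_mul (-1 : Kq), neg_one_sq, one_pow, one_mul,
      eq_comm] at this
  have h3 := qv_zpow_eq h2
  have h4 := D.d_pos x.idx
  have h5 : 0 < x.mul := x.1.2.pos
  have : 0 < D.d x.idx * (2 * x.mul) := by positivity
  omega

/-! ### The radical -/

/-- The adjoint of a multiplication preserves the radical; `cden_ne_zero` allows the factor to be
cancelled. -/
theorem lder_mem_radical (x : D.Iinf) {z : D.F} (hz : z ∈ D.radical) : D.lder x z ∈ D.radical := by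
  intro y
  have := hz (D.gen x * y)
  rw [form_gen_mul_right] at this
  exact (mul_eq_zero.1 this).resolve_left (inv_ne_zero (D.cden_ne_zero x))

theorem rder_mem_radical (x : D.Iinf) {z : D.F} (hz : z ∈ D.radical) : D.rder x z ∈ D.radical := by
  intro y
  have := hz (y * D.gen x)
  rw [form_mul_gen_right] at this
  exact (mul_eq_zero.1 this).resolve_left (inv_ne_zero (D.cden_ne_zero x))

theorem gen_mul_mem_radical (x : D.Iinf) {z : D.F} (hz : z ∈ D.radical) :
    D.gen x * z ∈ D.radical := by
  intro y
  rw [form_gen_mul_left, hz, mul_zero]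

theorem mul_gen_mem_radical (x : D.Iinf) {z : D.F} (hz : z ∈ D.radical) :
    z * D.gen x ∈ D.radical := by
  intro y
  rw [form_mul_gen_left, hz, mul_zero]

theorem dg_mem_radical (χ : D.Iinf → Kq) {z : D.F} (hz : z ∈ D.radical) :
    D.dg χ z ∈ D.radical := by
  intro y
  rw [form_dg, hz]

theorem counit_eq_zero_of_mem_radical {z : D.F} (hz : z ∈ D.radical) : D.counit z = 0 := by
  rw [← form_one_right]; exact hz 1

/-- An element without constant term all of whose left derivatives are in the radical. -/
theorem mem_radical_of_lder {z : D.F} (h0 : D.counit z = 0)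
    (h : ∀ x, D.lder x z ∈ D.radical) : z ∈ D.radical := by
  intro y
  induction y using gen_mul_induction with
  | h1 => rw [form_one_right, h0]
  | hadd u v hu hv => rw [form_add_right, hu, hv, add_zero]
  | hsmul c u hu => rw [form_smul_right, hu, mul_zero]
  | hg w y ih => rw [form_gen_mul_right, h, mul_zero]

/-! ### Homogeneous components -/

theorem word_mem_Fdeg (w) : D.word w ∈ D.Fdeg (D.content w) :=
  Submodule.subset_span ⟨w, rfl, rfl⟩

variable {D} in
theorem Fdeg_induction {ν : D.Iinf →₀ ℕ} {p : ∀ z, z ∈ D.Fdeg ν → Prop} (h0 : p 0 (zero_mem _))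
    (hadd : ∀ u v {hu hv}, p u hu → p v hv → p (u + v) (add_mem hu hv))
    (hsmul : ∀ (c : Kq) u {hu}, p u hu → p (c • u) (Submodule.smul_mem _ c hu))
    (hw : ∀ w (h : D.content w = ν), p (D.word w) (Submodule.subset_span ⟨w, h, rfl⟩)) {z : D.F}
    (hz : z ∈ D.Fdeg ν) : p z hz := by
  induction hz using Submodule.span_induction with
  | zero => exact h0
  | add a b h h' ha hb => exact hadd _ _ ha hb
  | smul c a h ha => exact hsmul _ _ ha
  | mem z hz => obtain ⟨w, h, rfl⟩ := hz; exact hw w h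

theorem gen_mul_mem_Fdeg (x : D.Iinf) {ν} {z : D.F} (hz : z ∈ D.Fdeg ν) :
    D.gen x * z ∈ D.Fdeg (ν + Finsupp.single x 1) := by
  induction hz using Fdeg_induction with
  | h0 => rw [mul_zero]; exact zero_mem _
  | hadd u v hu hv => rw [mul_add]; exact add_mem hu hv
  | hsmul c u hu => rw [mul_smul_comm]; exact Submodule.smul_mem _ _ hu
  | hw w hw =>
    rw [← word_cons, ← hw, add_comm, ← content_cons]; exact D.word_mem_Fdeg _

theorem mul_gen_mem_Fdeg (x : D.Iinf) {ν} {z : D.F} (hz : z ∈ D.Fdeg ν) :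
    z * D.gen x ∈ D.Fdeg (ν + Finsupp.single x 1) := by
  induction hz using Fdeg_induction with
  | h0 => rw [zero_mul]; exact zero_mem _
  | hadd u v hu hv => rw [add_mul]; exact add_mem hu hv
  | hsmul c u hu => rw [smul_mul_assoc]; exact Submodule.smul_mem _ _ hu
  | hw w hw =>
    have : D.word w * D.gen x = D.word (w ++ [x]) := by
      rw [word_append, word_cons, word_nil, mul_one]
    rw [this, ← hw]
    convert D.word_mem_Fdeg (w ++ [x]) using 2
    rw [content_append, content_cons, content_nil, add_zero]

theorem dg_Fdeg (χ : D.Iinf → Kq) {ν} {z : D.F} (hz : z ∈ D.Fdeg ν) :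
    D.dg χ z = (ν.prod fun y n => χ y ^ n) • z := by
  induction hz using Fdeg_induction with
  | h0 => simp
  | hadd u v hu hv => rw [map_add, hu, hv, smul_add]
  | hsmul c u hu => rw [map_smul, hu, smul_comm]
  | hw w hw =>
    subst hw
    induction w with
    | nil => simp [word_nil, content_nil]
    | cons y w ih =>
      rw [word_cons, map_mul, ih, dg_gen, smul_mul_smul_comm, content_cons,
        Finsupp.prod_add_index' (by simp) (by intros; rw [pow_add]),
        Finsupp.prod_single_index (by simp), pow_one]

theorem dg_mem_Fdeg (χ : D.Iinf → Kq) {ν} {z : D.F} (hz : z ∈ D.Fdeg ν) :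
    D.dg χ z ∈ D.Fdeg ν := by
  rw [D.dg_Fdeg χ hz]; exact Submodule.smul_mem _ _ hz

/-- Degrees lie in ℕ and cannot be subtracted freely, so words without the letter x are treated
separately from words of degree ν + x. -/
theorem der_mem_Fdeg_aux (x : D.Iinf) (w) :
    (D.content w x = 0 → D.lder x (D.word w) = 0 ∧ D.rder x (D.word w) = 0) ∧
    ∀ ν, D.content w = ν + Finsupp.single x 1 →
      D.lder x (D.word w) ∈ D.Fdeg ν ∧ D.rder x (D.word w) ∈ D.Fdeg ν := by
  classical
  induction w with
  | nil =>
    refine ⟨fun _ => by rw [word_nil, lder_one, rder_one]; exact ⟨rfl, rfl⟩, fun ν hν => ?_⟩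
    have := DFunLike.congr_fun hν x
    simp [content_nil] at this
  | cons y w ih =>
    rw [word_cons, lder_gen_mul, rder_gen_mul, content_cons]
    constructor
    · intro h
      rw [Finsupp.add_apply] at h
      have hne : x ≠ y := by rintro rfl; simp at h
      obtain ⟨h1, h2⟩ := ih.1 (by omega)
      simp [h1, h2, D.delta_ne hne]
    · intro ν hν
      have h1 : ∀ z, D.delta x y • z ∈ D.Fdeg ν ∨ x = y := fun z => by
        by_cases h : x = y
        · exact Or.inr h
        · left; rw [D.delta_ne h, zero_smul]; exact zero_mem _
      have h2 : D.gen y * D.lder x (D.word w) ∈ D.Fdeg ν ∧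
          D.gen y * D.rder x (D.word w) ∈ D.Fdeg ν := by
        by_cases h0 : D.content w x = 0
        · rw [(ih.1 h0).1, (ih.1 h0).2, mul_zero]; exact ⟨zero_mem _, zero_mem _⟩
        · have hle : Finsupp.single x 1 ≤ D.content w := by
            rw [Finsupp.single_le_iff]; omega
          obtain ⟨μ, hμ⟩ := exists_add_of_le hle
          rw [add_comm] at hμ
          have hνμ : ν = μ + Finsupp.single y 1 := by
            apply add_right_cancel (b := Finsupp.single x 1)
            rw [← hν, hμ]; abel
          rw [hνμ]
          exact ⟨D.gen_mul_mem_Fdeg y (ih.2 μ hμ).1, D.gen_mul_mem_Fdeg y (ih.2 μ hμ).2⟩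
      by_cases h : x = y
      · subst h
        have hw : D.content w = ν := by
          apply add_right_cancel (b := Finsupp.single x 1)
          rw [← hν]; abel
        have hm : D.word w ∈ D.Fdeg ν := hw ▸ D.word_mem_Fdeg w
        exact ⟨add_mem (Submodule.smul_mem _ _ hm) (Submodule.smul_mem _ _ h2.1),
          add_mem h2.2 (Submodule.smul_mem _ _ (D.dg_mem_Fdeg _ hm))⟩
      · rw [D.delta_ne h, zero_smul, zero_smul, zero_add, add_zero]
        exact ⟨Submodule.smul_mem _ _ h2.1, h2.2⟩

theorem lder_mem_Fdeg (x : D.Iinf) {ν} {z : D.F} (hz : z ∈ D.Fdeg (ν + Finsupp.single x 1)) :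
    D.lder x z ∈ D.Fdeg ν := by
  induction hz using Fdeg_induction with
  | h0 => rw [map_zero]; exact zero_mem _
  | hadd u v hu hv => rw [map_add]; exact add_mem hu hv
  | hsmul c u hu => rw [map_smul]; exact Submodule.smul_mem _ _ hu
  | hw w hw => exact ((D.der_mem_Fdeg_aux x w).2 ν hw).1

theorem rder_mem_Fdeg (x : D.Iinf) {ν} {z : D.F} (hz : z ∈ D.Fdeg (ν + Finsupp.single x 1)) :
    D.rder x z ∈ D.Fdeg ν := by
  induction hz using Fdeg_induction with
  | h0 => rw [map_zero]; exact zero_mem _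
  | hadd u v hu hv => rw [map_add]; exact add_mem hu hv
  | hsmul c u hu => rw [map_smul]; exact Submodule.smul_mem _ _ hu
  | hw w hw => exact ((D.der_mem_Fdeg_aux x w).2 ν hw).2

theorem lder_eq_zero (x : D.Iinf) {ν} (hν : ν x = 0) {z : D.F} (hz : z ∈ D.Fdeg ν) :
    D.lder x z = 0 := by
  induction hz using Fdeg_induction with
  | h0 => rw [map_zero]
  | hadd u v hu hv => rw [map_add, hu, hv, add_zero]
  | hsmul c u hu => rw [map_smul, hu, smul_zero]
  | hw w hw => exact ((D.der_mem_Fdeg_aux x w).1 (hw ▸ hν)).1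

theorem rder_eq_zero (x : D.Iinf) {ν} (hν : ν x = 0) {z : D.F} (hz : z ∈ D.Fdeg ν) :
    D.rder x z = 0 := by
  induction hz using Fdeg_induction with
  | h0 => rw [map_zero]
  | hadd u v hu hv => rw [map_add, hu, hv, add_zero]
  | hsmul c u hu => rw [map_smul, hu, smul_zero]
  | hw w hw => exact ((D.der_mem_Fdeg_aux x w).1 (hw ▸ hν)).2

theorem exists_add_single {ν : D.Iinf →₀ ℕ} {x : D.Iinf} (h : ν x ≠ 0) :
    ∃ μ, ν = μ + Finsupp.single x 1 := by
  classical
  have hle : Finsupp.single x 1 ≤ ν := by rw [Finsupp.single_le_iff]; omega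
  obtain ⟨μ, hμ⟩ := exists_add_of_le hle
  exact ⟨μ, by rw [hμ, add_comm]⟩

end SuperBorcherdsCartanDatum

namespace SuperBorcherdsCartanDatum

variable {I P : Type*} [AddCommGroup P] (D : SuperBorcherdsCartanDatum I P)

/-! ### Expansions in dual bases -/

theorem form_sum_left {ι : Type*} (s : Finset ι) (f : ι → D.F) (z : D.F) :
    D.form (∑ j ∈ s, f j) z = ∑ j ∈ s, D.form (f j) z := map_sum _ _ _

theorem form_sum_right {ι : Type*} (s : Finset ι) (f : ι → D.F) (z : D.F) :
    D.form z (∑ j ∈ s, f j) = ∑ j ∈ s, D.form z (f j) := by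
  rw [form_comm, form_sum_left]
  exact Finset.sum_congr rfl fun j _ => D.form_comm _ _

theorem form_of_sub_mem {y z w : D.F} (h : y - z ∈ D.radical) : D.form y w = D.form z w := by
  rw [← sub_add_cancel y z, form_add_left, h w, zero_add]

variable {D} in
theorem DualBases.expand_b {ν} (B : D.DualBases ν) {y : D.F} (hy : y ∈ D.Fdeg ν) :
    y - ∑ s, D.form y (B.bstar s) • B.b s ∈ D.radical := by
  have h : D.radical.mkQ y ∈ Submodule.span Kq (Set.range fun s => D.radical.mkQ (B.b s)) := by
    rw [B.span_eq]; exact Submodule.mem_map_of_mem hy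
  obtain ⟨c, hc⟩ := (Submodule.mem_span_range_iff_exists_fun Kq).1 h
  have h1 : y - ∑ s, c s • B.b s ∈ D.radical := by
    rw [← Submodule.Quotient.mk_eq_zero, ← Submodule.mkQ_apply, map_sub, map_sum, ← hc]
    simp
  convert h1 using 4 with s
  rw [D.form_of_sub_mem h1, form_sum_left, Finset.sum_eq_single s]
  · rw [form_smul_left, B.form_eq, if_pos rfl, mul_one]
  · intro t _ ht; rw [form_smul_left, B.form_eq, if_neg ht, mul_zero]
  · simp

variable {D} in
-- By orthogonality of distinct degrees it suffices to pair with elements of the same degree, which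
-- are expanded in the basis by `DualBases.expand_b`.
theorem DualBases.expand_bstar {ν} (B : D.DualBases ν) {z : D.F} (hz : z ∈ D.Fdeg ν) :
    z - ∑ s, D.form (B.b s) z • B.bstar s ∈ D.radical := by
  have hm : ∑ s, D.form (B.b s) z • B.bstar s ∈ D.Fdeg ν :=
    Submodule.sum_mem _ fun s _ => Submodule.smul_mem _ _ (B.bstar_mem s)
  refine D.mem_radical_of_mem (sub_mem hz hm) fun y hy => ?_
  have h1 := B.expand_b hy
  rw [form_comm, sub_eq_add_neg, ← neg_one_smul Kq, form_add_right, form_smul_right,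
    D.form_of_sub_mem h1, form_sum_left, form_sum_right, neg_one_mul, add_neg_eq_zero]
  refine Finset.sum_congr rfl fun s _ => ?_
  rw [form_smul_left, form_smul_right, mul_comm]

section transfer

variable {W : Type*} [AddCommGroup W] [Module Kq W]

/-- A linear map on `F` which vanishes on the homogeneous elements of the radical. -/
def KillsRadical (A : D.F →ₗ[Kq] W) : Prop :=
  ∀ ν z, z ∈ D.Fdeg ν → z ∈ D.radical → A z = 0

variable {D}

/-- Expansions in U^+_ν hold in F only up to the radical; a map killing the homogeneous radical does
not see the difference. -/
theorem KillsRadical.expand_b {A : D.F →ₗ[Kq] W} (hA : D.KillsRadical A) {ν} (B : D.DualBases ν)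
    {y : D.F} (hy : y ∈ D.Fdeg ν) : A y = ∑ s, D.form y (B.bstar s) • A (B.b s) := by
  have hm : ∑ s, D.form y (B.bstar s) • B.b s ∈ D.Fdeg ν :=
    Submodule.sum_mem _ fun s _ => Submodule.smul_mem _ _ (B.b_mem s)
  have := hA ν _ (sub_mem hy hm) (B.expand_b hy)
  rw [map_sub, sub_eq_zero, map_sum] at this
  simpa only [map_smul] using this

theorem KillsRadical.expand_bstar {A : D.F →ₗ[Kq] W} (hA : D.KillsRadical A) {ν}
    (B : D.DualBases ν) {z : D.F} (hz : z ∈ D.Fdeg ν) :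
    A z = ∑ s, D.form (B.b s) z • A (B.bstar s) := by
  have hm : ∑ s, D.form (B.b s) z • B.bstar s ∈ D.Fdeg ν :=
    Submodule.sum_mem _ fun s _ => Submodule.smul_mem _ _ (B.bstar_mem s)
  have := hA ν _ (sub_mem hz hm) (B.expand_bstar hz)
  rw [map_sub, sub_eq_zero, map_sum] at this
  simpa only [map_smul] using this

theorem KillsRadical.comp_dg {A : D.F →ₗ[Kq] W} (hA : D.KillsRadical A) (χ : D.Iinf → Kq) :
    D.KillsRadical (A.comp (D.dg χ).toLinearMap) := fun ν _ hz hr =>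
  hA ν _ (D.dg_mem_Fdeg χ hz) (D.dg_mem_radical χ hr)

/-- Adjoint operators can be moved from one side of the canonical tensor to the other. -/
theorem transfer {R : Type*} [Ring R] [Algebra Kq R] {A C : D.F →ₗ[Kq] R}
    (hA : D.KillsRadical A) (hC : D.KillsRadical C) {ν ν'} (B : D.DualBases ν) (B' : D.DualBases ν')
    (f g : D.F →ₗ[Kq] D.F) (hf : ∀ y ∈ D.Fdeg ν, f y ∈ D.Fdeg ν')
    (hg : ∀ y ∈ D.Fdeg ν', g y ∈ D.Fdeg ν) (hfg : ∀ y z, D.form (f y) z = D.form y (g z)) :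
    ∑ s, A (f (B.b s)) * C (B.bstar s) = ∑ s, A (B'.b s) * C (g (B'.bstar s)) := by
  -- Both sides are expanded into the same double sum, with the matrix coefficients of f in the two
  -- pairs of dual bases.
  have h1 : ∀ s, A (f (B.b s)) * C (B.bstar s)
      = ∑ t, D.form (f (B.b s)) (B'.bstar t) • (A (B'.b t) * C (B.bstar s)) := fun s => by
    rw [hA.expand_b B' (hf _ (B.b_mem s)), Finset.sum_mul]
    simp only [smul_mul_assoc]
  have h2 : ∀ t, A (B'.b t) * C (g (B'.bstar t))
      = ∑ s, D.form (f (B.b s)) (B'.bstar t) • (A (B'.b t) * C (B.bstar s)) := fun t => by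
    rw [hC.expand_bstar B (hg _ (B'.bstar_mem t)), Finset.mul_sum]
    simp only [mul_smul_comm, hfg]
  simp only [h1, h2]
  exact Finset.sum_comm

end transfer

/-! ### Anti-homomorphisms -/

section anti

variable {R : Type*} [Ring R] [Algebra Kq R]

/-- The algebra anti-homomorphism on `F` with prescribed values on the generators. -/
noncomputable def antiLift (β : D.Iinf → R) : D.F →ₗ[Kq] R :=
  (MulOpposite.opLinearEquiv Kq).symm.toLinearMap.comp
    (FreeAlgebra.lift Kq fun x => MulOpposite.op (β x)).toLinearMap

theorem antiLift_one (β : D.Iinf → R) : D.antiLift β 1 = 1 := by simp [antiLift]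

theorem antiLift_gen_mul (β : D.Iinf → R) (x z) :
    D.antiLift β (D.gen x * z) = D.antiLift β z * β x := by simp [antiLift]

theorem antiLift_mul_gen (β : D.Iinf → R) (x z) :
    D.antiLift β (z * D.gen x) = β x * D.antiLift β z := by simp [antiLift]

theorem map_antiLift {R' : Type*} [Ring R'] [Algebra Kq R'] (f : R →ₐ[Kq] R') (β : D.Iinf → R) (z) :
    f (D.antiLift β z) = D.antiLift (fun x => f (β x)) z := by
  induction z using gen_mul_induction with
  | h1 => simp [antiLift_one]
  | hadd u v hu hv => simp only [map_add, hu, hv]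
  | hsmul c u hu => simp only [map_smul, hu]
  | hg y z hz => simp only [antiLift_gen_mul, map_mul, hz]

end anti

/-! ### Representations without Serre relations -/

/-- Operators `a_x`, `b_x`, `K_x`, `K_x⁻¹` on a vector space which satisfy all defining relations
between these elements of `U`, except for the Serre relations. -/
structure Rep (V : Type*) [AddCommGroup V] [Module Kq V] where
  /-- the operators `a_x` -/
  a : D.Iinf → Module.End Kq V
  /-- the operators `b_x` -/
  b : D.Iinf → Module.End Kq V
  /-- the operators `K_x` -/
  K : D.Iinf → Module.End Kq V
  /-- the operators `K_x⁻¹` -/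
  Kinv : D.Iinf → Module.End Kq V
  K_mul_Kinv : ∀ x, K x * Kinv x = 1
  Kinv_mul_K : ∀ x, Kinv x * K x = 1
  K_comm : ∀ x y, K x * K y = K y * K x
  K_mul_a : ∀ x y, K x * a y = D.qf x y • (a y * K x)
  K_mul_b : ∀ x y, K x * b y = (D.qf x y)⁻¹ • (b y * K x)
  a_mul_b : ∀ y x, a y * b x
    = D.sgn x y • (b x * a y) + D.delta x y • (D.cden x)⁻¹ • (K x - Kinv x)

namespace Rep

variable {D} {V : Type*} [AddCommGroup V] [Module Kq V] (R : D.Rep V)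

/-- `x ↦ x^+` -/
noncomputable def plus : D.F →ₐ[Kq] Module.End Kq V := FreeAlgebra.lift Kq R.a

/-- The anti-homomorphism with `a_x ↦ b_x K_x`; up to a sign it is `x ↦ S(x^-)`. -/
noncomputable def anti : D.F →ₗ[Kq] Module.End Kq V := D.antiLift fun x => R.b x * R.K x

theorem plus_gen_mul (x z) : R.plus (D.gen x * z) = R.a x * R.plus z := by
  rw [map_mul, plus, FreeAlgebra.lift_ι_apply]

theorem plus_mul_gen (x z) : R.plus (z * D.gen x) = R.plus z * R.a x := by
  rw [map_mul, plus, FreeAlgebra.lift_ι_apply]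

theorem anti_gen_mul (x z) : R.anti (D.gen x * z) = R.anti z * (R.b x * R.K x) :=
  D.antiLift_gen_mul _ _ _

theorem anti_mul_gen (x z) : R.anti (z * D.gen x) = R.b x * R.K x * R.anti z :=
  D.antiLift_mul_gen _ _ _

theorem anti_one : R.anti 1 = 1 := D.antiLift_one _

theorem a_mul_Kinv (x y) : R.a y * R.Kinv x = D.qf x y • (R.Kinv x * R.a y) := by
  calc R.a y * R.Kinv x = R.Kinv x * (R.K x * R.a y) * R.Kinv x := by
        rw [← mul_assoc, R.Kinv_mul_K, one_mul]
    _ = D.qf x y • (R.Kinv x * R.a y * (R.K x * R.Kinv x)) := by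
        rw [R.K_mul_a]; simp only [mul_smul_comm, smul_mul_assoc, mul_assoc]
    _ = _ := by rw [R.K_mul_Kinv, mul_one]

theorem a_mul_K (x y) : R.a y * R.K x = (D.qf x y)⁻¹ • (R.K x * R.a y) := by
  rw [R.K_mul_a, smul_smul, inv_mul_cancel₀ (D.qf_ne_zero x y), one_smul]

theorem b_mul_K (x y) : R.b y * R.K x = D.qf x y • (R.K x * R.b y) := by
  rw [R.K_mul_b, smul_smul, mul_inv_cancel₀ (D.qf_ne_zero x y), one_smul]

theorem K_mul_plus (x : D.Iinf) (z) : R.K x * R.plus z = R.plus (D.dg (D.qf x) z) * R.K x := by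
  induction z using gen_mul_induction with
  | h1 => simp
  | hadd u v hu hv => simp only [map_add, mul_add, add_mul, hu, hv]
  | hsmul c u hu => simp only [map_smul, mul_smul_comm, smul_mul_assoc, hu]
  | hg y z hz =>
    rw [plus_gen_mul, ← mul_assoc, R.K_mul_a, smul_mul_assoc, mul_assoc, hz, map_mul (D.dg _),
      dg_gen, smul_mul_assoc, map_smul, plus_gen_mul, smul_mul_assoc, mul_assoc]

theorem bK_mul_K (x w) : R.b w * R.K w * R.K x = D.qf x w • (R.K x * (R.b w * R.K w)) := by
  rw [mul_assoc, R.K_comm w x, ← mul_assoc, R.b_mul_K, smul_mul_assoc, mul_assoc]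

theorem a_mul_bK (x w) : R.a x * (R.b w * R.K w)
    = (D.sgn x w * (D.qf x w)⁻¹) • (R.b w * R.K w * R.a x)
      + D.delta x w • (D.cden x)⁻¹ • (R.K x * R.K x - 1) := by
  have h : D.delta w x • (D.cden w)⁻¹ • (R.K w - R.Kinv w) * R.K w
      = D.delta x w • (D.cden x)⁻¹ • (R.K x * R.K x - 1) := by
    rw [D.delta_comm w x, smul_mul_assoc, smul_mul_assoc, sub_mul, R.Kinv_mul_K]
    exact (D.delta_smul_eq x w fun x => (D.cden x)⁻¹ • (R.K x * R.K x - 1)).symm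
  rw [← mul_assoc, R.a_mul_b, add_mul, h, smul_mul_assoc, mul_assoc, R.a_mul_K, mul_smul_comm,
    smul_smul, mul_assoc, D.sgn_comm w x, D.qf_comm w x]

/-- The final bookkeeping of the commutator formula, with the operators replaced by arbitrary
vectors. The only input beyond linear algebra is that the sign squares to 1. -/
theorem collect_plus {k W : Type*} [CommRing k] [AddCommGroup W] [Module k W] (s q c d : k)
    (hs : s * s = 1) (X₁ X₂ X₃ X₄ X₅ : W) :
    s • X₁ + d • c • (X₂ - X₃) + c • (X₄ - q • X₅)
      = s • X₁ + c • (X₄ + d • X₂ - (d • X₃ + (s * q) • s • X₅)) := by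
  match_scalars <;> try ring1
  linear_combination c * q * hs

theorem collect_anti {k W : Type*} [CommRing k] [AddCommGroup W] [Module k W] (s q q' c d : k)
    (hq : q' * q = 1) (X₁ X₂ X₃ X₄ X₅ : W) :
    (s * q') • (X₁ + c • ((q * q) • X₂ - X₃)) + d • c • (X₄ - X₅)
      = (s * q') • X₁ + c • (d • X₄ + (s * q) • X₂ - ((s * q') • X₃ + d • X₅)) := by
  match_scalars <;> try ring1
  linear_combination s * q * c * hq

/-- Induction on the monomial: b_x either passes a letter with a sign or meets a_x and leaves K_x -
K_x⁻¹. Collecting K_x on the right and K_x⁻¹ on the left produces the right and the left derivation.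
-/
theorem plus_mul_b (x : D.Iinf) (z) : R.plus z * R.b x = R.b x * R.plus (D.dg (D.sgn x) z)
    + (D.cden x)⁻¹ • (R.plus (D.rder x z) * R.K x
      - R.Kinv x * R.plus (D.dg (D.sgn x) (D.lder x z))) := by
  induction z using gen_mul_induction with
  | h1 => simp [rder_one, lder_one]
  | hadd u v hu hv => simp only [map_add, mul_add, add_mul, hu, hv, smul_sub, smul_add]; abel
  | hsmul c u hu =>
    simp only [map_smul, mul_smul_comm, smul_mul_assoc, hu, smul_sub, smul_add,
      smul_comm c (D.cden x)⁻¹]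
  | hg w z hz =>
    -- Moving K_x to the left removes the powers of q from the twist, so only the sign is left.
    have hK : R.plus (D.twist x z) * R.K x = R.K x * R.plus (D.dg (D.sgn x) z) := by
      rw [K_mul_plus, dg_dg, twist_eq]; simp only [mul_comm]
    rw [plus_gen_mul, mul_assoc, hz, mul_add, ← mul_assoc, R.a_mul_b, mul_smul_comm, mul_sub,
      ← mul_assoc (R.a w) (R.Kinv x), R.a_mul_Kinv, rder_gen_mul, lder_gen_mul]
    simp only [map_add, map_smul, map_mul (D.dg _), dg_gen, smul_mul_assoc, plus_gen_mul,
      add_mul, mul_add, hK, sub_mul, mul_smul_comm, mul_assoc]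
    exact collect_plus _ _ _ _ (D.sgn_mul_sgn x w) _ _ _ _ _

/-- The mirror image of `plus_mul_b`. Since the letters act by b_x K_x, the middle term of the
commutator is K_x² - 1, and the diagonal operator on the right is inverse to the twist. -/
theorem a_mul_anti (x : D.Iinf) (z) : R.a x * R.anti z
    = R.anti (D.dg (fun w => D.sgn x w * (D.qf x w)⁻¹) z) * R.a x
    + (D.cden x)⁻¹ • (R.K x * R.K x * R.anti (D.rder x z)
      - R.anti (D.dg (fun w => D.sgn x w * (D.qf x w)⁻¹) (D.lder x z))) := by
  induction z using mul_gen_induction with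
  | h1 => simp [rder_one, lder_one, anti_one]
  | hadd u v hu hv => simp only [map_add, mul_add, add_mul, hu, hv, smul_sub, smul_add]; abel
  | hsmul c u hu =>
    simp only [map_smul, mul_smul_comm, smul_mul_assoc, hu, smul_sub, smul_add,
      smul_comm c (D.cden x)⁻¹]
  | hg w z hz =>
    -- This cancellation is why the δ-term of the left derivation comes out untwisted.
    have hT : D.dg (fun w => D.sgn x w * (D.qf x w)⁻¹) (D.twist x z) = z := by
      rw [twist_eq, dg_dg]
      conv_rhs => rw [← D.dg_one z]
      congr 2
      funext w
      calc _ = (D.sgn x w * D.sgn x w) * ((D.qf x w)⁻¹ * D.qf x w) := by ring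
        _ = 1 := by rw [sgn_mul_sgn, inv_mul_cancel₀ (D.qf_ne_zero x w), one_mul]
    have hb : R.b w * R.K w * (R.K x * R.K x * R.anti (D.rder x z))
        = (D.qf x w * D.qf x w) • (R.K x * (R.K x * (R.b w * R.K w * R.anti (D.rder x z)))) := by
      rw [← mul_assoc, ← mul_assoc, bK_mul_K, smul_mul_assoc, mul_assoc (R.K x), bK_mul_K]
      simp only [mul_smul_comm, smul_mul_assoc, smul_smul, mul_assoc]
    rw [anti_mul_gen, ← mul_assoc, a_mul_bK, add_mul, smul_mul_assoc, mul_assoc _ (R.a x), hz,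
      mul_add, mul_smul_comm, mul_sub, hb, rder_mul_gen, lder_mul_gen]
    simp only [map_add, map_smul, map_mul (D.dg _), dg_gen, smul_mul_assoc, anti_mul_gen,
      mul_add, hT, sub_mul, mul_smul_comm, mul_assoc, one_mul]
    exact collect_anti _ _ _ _ _ (inv_mul_cancel₀ (D.qf_ne_zero x w)) _ _ _ _ _

end Rep

end SuperBorcherdsCartanDatum

namespace SuperBorcherdsCartanDatum

variable {I P : Type*} [AddCommGroup P] (D : SuperBorcherdsCartanDatum I P)

namespace Rep

variable {D} {V : Type*} [AddCommGroup V] [Module Kq V] (R : D.Rep V)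

/-! ### The operator `Ω` -/

/-- The radical acts by zero, on both sides. -/
def RadicalFree : Prop := D.KillsRadical R.plus.toLinearMap ∧ D.KillsRadical R.anti

/-- On every vector only finitely many components of `F` act nontrivially through `x ↦ x^+`. -/
def LocallyFinite : Prop :=
  ∀ m : V, {ν : D.Iinf →₀ ℕ | ∃ y ∈ D.Fdeg ν, R.plus y m ≠ 0}.Finite

/-- The component of degree `ν` of `Ω`. -/
noncomputable def term (B : ∀ ν : D.Iinf →₀ ℕ, D.DualBases ν) (ν : D.Iinf →₀ ℕ) :
    Module.End Kq V := ∑ s, R.anti ((B ν).b s) * R.plus ((B ν).bstar s)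

variable {R} (B : ∀ ν : D.Iinf →₀ ℕ, D.DualBases ν)

/-- Summability of all the families met below: the right factor is always a degree-preserving
modification of the dual basis elements, and the left factor is irrelevant. -/
theorem LocallyFinite.sum (hR : R.LocallyFinite) (f : ∀ ν, Fin (B ν).n → Module.End Kq V)
    (g : D.F →ₗ[Kq] D.F) (hg : ∀ ν, ∀ y ∈ D.Fdeg ν, g y ∈ D.Fdeg ν) (m : V) :
    (Function.support fun ν => (∑ s, f ν s * R.plus (g ((B ν).bstar s))) m).Finite := by
  refine (hR m).subset fun ν hν => ?_
  by_contra h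
  apply hν
  change (∑ s, f ν s * R.plus (g ((B ν).bstar s))) m = 0
  rw [LinearMap.sum_apply]
  refine Finset.sum_eq_zero fun s _ => ?_
  rw [Module.End.mul_apply]
  have : R.plus (g ((B ν).bstar s)) m = 0 := by
    by_contra h'
    exact h ⟨_, hg ν _ ((B ν).bstar_mem s), h'⟩
  rw [this, map_zero]

theorem LocallyFinite.term (hR : R.LocallyFinite) (m : V) :
    (Function.support fun ν => R.term B ν m).Finite :=
  hR.sum B (fun ν s => R.anti ((B ν).b s)) LinearMap.id (fun _ _ h => h) m

/-- The operator `Ω`. -/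
noncomputable def omega (hR : R.LocallyFinite) : Module.End Kq V where
  toFun m := ∑ᶠ ν, R.term B ν m
  map_add' m m' := by
    simp only [map_add]
    exact finsum_add_distrib (hR.term B m) (hR.term B m')
  map_smul' c m := by
    simp only [map_smul]
    exact (smul_finsum' c (hR.term B m)).symm

theorem omega_apply (hR : R.LocallyFinite) (m : V) : omega B hR m = ∑ᶠ ν, R.term B ν m := rfl

/-- Derivative terms vanish in degrees without x, so they may be reindexed by ν + x. This replaces
telescoping of the partial sums. -/
theorem finsum_shift {W : Type*} [AddCommMonoid W] (x : D.Iinf) (G : (D.Iinf →₀ ℕ) → W)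
    (hG : ∀ ν, ν x = 0 → G ν = 0) : ∑ᶠ ν, G ν = ∑ᶠ ν, G (ν + Finsupp.single x 1) := by
  have hinj : Function.Injective fun ν : D.Iinf →₀ ℕ => ν + Finsupp.single x 1 :=
    add_left_injective _
  rw [← finsum_mem_range (f := G) hinj, finsum_mem_def]
  refine finsum_congr fun ν => ?_
  by_cases h : ν x = 0
  · rw [hG ν h]; symm
    by_cases h' : ν ∈ Set.range fun ν : D.Iinf →₀ ℕ => ν + Finsupp.single x 1
    · rw [Set.indicator_of_mem h', hG ν h]
    · rw [Set.indicator_of_notMem h']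
  · obtain ⟨μ, rfl⟩ := D.exists_add_single h
    rw [Set.indicator_of_mem (Set.mem_range_self μ)]

theorem finite_support_shift {W : Type*} [AddCommMonoid W] (x : D.Iinf) (G : (D.Iinf →₀ ℕ) → W)
    (hG : ∀ ν, ν x = 0 → G ν = 0)
    (h : (Function.support fun ν => G (ν + Finsupp.single x 1)).Finite) :
    (Function.support G).Finite := by
  refine (h.image fun ν => ν + Finsupp.single x 1).subset fun ν hν => ?_
  have h0 : ν x ≠ 0 := fun h0 => hν (hG ν h0)
  obtain ⟨μ, rfl⟩ := D.exists_add_single h0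
  exact ⟨μ, hν, rfl⟩

theorem form_lder_adj (x : D.Iinf) (y z : D.F) : D.form (D.gen x * y) z
    = D.form y (((D.cden x)⁻¹ • D.lder x) z) := by
  rw [form_gen_mul_left, LinearMap.smul_apply, form_smul_right]

theorem form_rder_adj (x : D.Iinf) (y z : D.F) : D.form (y * D.gen x) z
    = D.form y (((D.cden x)⁻¹ • D.rder x) z) := by
  rw [form_mul_gen_left, LinearMap.smul_apply, form_smul_right]

/-- `Ω b_x = b_x K_x Ω K_x` -/
theorem omega_b (hR : R.LocallyFinite) (h0 : R.RadicalFree) (x : D.Iinf) (m : V) :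
    omega B hR (R.b x m) = R.b x (R.K x (omega B hR (R.K x m))) := by
  let A : (D.Iinf →₀ ℕ) → Module.End Kq V := fun ν =>
    ∑ s, R.anti ((B ν).b s) * R.b x * R.plus (D.dg (D.sgn x) ((B ν).bstar s))
  let C : (D.Iinf →₀ ℕ) → Module.End Kq V := fun ν =>
    ∑ s, R.anti ((B ν).b s) * R.plus (((D.cden x)⁻¹ • D.rder x) ((B ν).bstar s))
  let E : (D.Iinf →₀ ℕ) → Module.End Kq V := fun ν =>
    ∑ s, R.anti ((B ν).b s) * R.Kinv x *
      R.plus (D.dg (D.sgn x) (((D.cden x)⁻¹ • D.lder x) ((B ν).bstar s)))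
  -- The commutator formula splits the term in three: A is the twisted commuted part, C comes from
  -- the right and E from the left derivation.
  have hterm : ∀ ν, R.term B ν * R.b x = A ν + C ν * R.K x - E ν := by
    intro ν
    simp only [term, A, C, E, Finset.sum_mul]
    rw [← Finset.sum_add_distrib, ← Finset.sum_sub_distrib]
    refine Finset.sum_congr rfl fun s _ => ?_
    rw [mul_assoc, R.plus_mul_b]
    simp only [LinearMap.smul_apply, map_smul, mul_add, mul_sub, mul_smul_comm, smul_mul_assoc,
      smul_sub, mul_assoc]
    abel
  have hC0 : ∀ ν : D.Iinf →₀ ℕ, ν x = 0 → C ν = 0 := fun ν hν =>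
    Finset.sum_eq_zero fun s _ => by
      rw [LinearMap.smul_apply, D.rder_eq_zero x hν ((B ν).bstar_mem s)]; simp
  have hE0 : ∀ ν : D.Iinf →₀ ℕ, ν x = 0 → E ν = 0 := fun ν hν =>
    Finset.sum_eq_zero fun s _ => by
      rw [LinearMap.smul_apply, D.lder_eq_zero x hν ((B ν).bstar_mem s)]; simp
  -- The right derivation is adjoint to right multiplication by a_x, which the anti-homomorphism
  -- turns into b_x K_x in front.
  have hC : ∀ ν, C (ν + Finsupp.single x 1) = R.b x * R.K x * R.term B ν := by
    intro ν
    have := transfer h0.2 h0.1 (B ν) (B (ν + Finsupp.single x 1))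
      (LinearMap.mulRight Kq (D.gen x)) ((D.cden x)⁻¹ • D.rder x)
      (fun y hy => D.mul_gen_mem_Fdeg x hy)
      (fun y hy => Submodule.smul_mem _ _ (D.rder_mem_Fdeg x hy)) (form_rder_adj x)
    refine this.symm.trans ?_
    simp only [LinearMap.mulRight_apply, anti_mul_gen, term, Finset.mul_sum]
    exact Finset.sum_congr rfl fun s _ => mul_assoc _ _ _
  -- The left derivation is adjoint to left multiplication, which puts b_x K_x behind S(b^-). There
  -- K_x cancels K_x⁻¹ and exactly the commuted part of lower degree remains.
  have hE : ∀ ν, E (ν + Finsupp.single x 1) = A ν := by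
    intro ν
    have hA' : D.KillsRadical ((LinearMap.mulRight Kq (R.Kinv x)).comp R.anti) :=
      fun ν z hz hr => by rw [LinearMap.comp_apply, h0.2 ν z hz hr, map_zero]
    have := transfer hA' (h0.1.comp_dg (D.sgn x)) (B ν) (B (ν + Finsupp.single x 1))
      (LinearMap.mulLeft Kq (D.gen x)) ((D.cden x)⁻¹ • D.lder x)
      (fun y hy => D.gen_mul_mem_Fdeg x hy)
      (fun y hy => Submodule.smul_mem _ _ (D.lder_mem_Fdeg x hy)) (form_lder_adj x)
    refine this.symm.trans ?_
    refine Finset.sum_congr rfl fun s _ => ?_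
    simp only [LinearMap.comp_apply, LinearMap.mulLeft_apply, LinearMap.mulRight_apply,
      anti_gen_mul, AlgHom.toLinearMap_apply]
    rw [mul_assoc (R.anti _), mul_assoc (R.b x), R.K_mul_Kinv, mul_one]
  have fA : (Function.support fun ν => A ν m).Finite :=
    hR.sum B (fun ν s => R.anti ((B ν).b s) * R.b x) (D.dg (D.sgn x)).toLinearMap
      (fun _ _ h => D.dg_mem_Fdeg _ h) m
  -- Here the derivation has changed the degree of the right factor, so finiteness is obtained
  -- through the shift.
  have fE : (Function.support fun ν => E ν m).Finite :=
    finite_support_shift x _ (fun ν hν => by rw [hE0 ν hν]; rfl) (by simpa only [hE] using fA)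
  have hC' : ∀ ν, C (ν + Finsupp.single x 1) (R.K x m)
      = (R.b x * R.K x) (R.term B ν (R.K x m)) := fun ν => by rw [hC]; rfl
  have fC : (Function.support fun ν => C ν (R.K x m)).Finite := by
    refine finite_support_shift x _ (fun ν hν => by rw [hC0 ν hν]; rfl) ?_
    simp only [hC']
    exact (hR.term B (R.K x m)).subset fun ν hν h => hν (by
      change (R.b x * R.K x) _ = 0
      rw [show R.term B ν (R.K x m) = 0 from h, map_zero])
  have e1 : omega B hR (R.b x m) = ∑ᶠ ν, A ν m + ∑ᶠ ν, C ν (R.K x m) - ∑ᶠ ν, E ν m := by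
    rw [← finsum_add_distrib fA fC, ← finsum_sub_distrib _ fE]
    · exact finsum_congr fun ν => congrArg (fun T => T m) (hterm ν)
    · exact (fA.union fC).subset (Function.support_add _ _)
  rw [e1, finsum_shift x (fun ν => E ν m) (fun ν hν => by rw [hE0 ν hν]; rfl),
    finsum_shift x (fun ν => C ν (R.K x m)) (fun ν hν => by rw [hC0 ν hν]; rfl)]
  simp only [hE, hC']
  rw [add_sub_cancel_left, omega_apply, ← Module.End.mul_apply (R.b x),
    map_finsum (R.b x * R.K x) (hR.term B _)]

/-- `a_x Ω = K_x² Ω a_x` -/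
theorem omega_a (hR : R.LocallyFinite) (h0 : R.RadicalFree) (x : D.Iinf) (m : V) :
    R.a x (omega B hR m) = R.K x (R.K x (omega B hR (R.a x m))) := by
  let χ : D.Iinf → Kq := fun w => D.sgn x w * (D.qf x w)⁻¹
  let A : (D.Iinf →₀ ℕ) → Module.End Kq V := fun ν =>
    ∑ s, R.anti (D.dg χ ((B ν).b s)) * R.a x * R.plus ((B ν).bstar s)
  let C : (D.Iinf →₀ ℕ) → Module.End Kq V := fun ν =>
    ∑ s, R.anti (((D.cden x)⁻¹ • D.rder x) ((B ν).b s)) * R.plus ((B ν).bstar s)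
  let E : (D.Iinf →₀ ℕ) → Module.End Kq V := fun ν =>
    ∑ s, R.anti (D.dg χ (((D.cden x)⁻¹ • D.lder x) ((B ν).b s))) * R.plus ((B ν).bstar s)
  -- The three parts are as for b_x, but now the derivations fall on the basis elements and are
  -- transferred to multiplications of the dual ones.
  have hterm : ∀ ν, R.a x * R.term B ν = A ν + R.K x * R.K x * C ν - E ν := by
    intro ν
    simp only [term, A, C, E, Finset.mul_sum]
    rw [← Finset.sum_add_distrib, ← Finset.sum_sub_distrib]
    refine Finset.sum_congr rfl fun s _ => ?_
    rw [← mul_assoc, R.a_mul_anti]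
    simp only [LinearMap.smul_apply, map_smul, add_mul, sub_mul, mul_smul_comm, smul_mul_assoc,
      smul_sub, mul_assoc]
    abel
  have hC0 : ∀ ν : D.Iinf →₀ ℕ, ν x = 0 → C ν = 0 := fun ν hν =>
    Finset.sum_eq_zero fun s _ => by
      rw [LinearMap.smul_apply, D.rder_eq_zero x hν ((B ν).b_mem s)]; simp
  have hE0 : ∀ ν : D.Iinf →₀ ℕ, ν x = 0 → E ν = 0 := fun ν hν =>
    Finset.sum_eq_zero fun s _ => by
      rw [LinearMap.smul_apply, D.lder_eq_zero x hν ((B ν).b_mem s)]; simp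
  have hC : ∀ ν, C (ν + Finsupp.single x 1) = R.term B ν * R.a x := by
    intro ν
    have := transfer h0.2 h0.1 (B (ν + Finsupp.single x 1)) (B ν)
      ((D.cden x)⁻¹ • D.rder x) (LinearMap.mulRight Kq (D.gen x))
      (fun y hy => Submodule.smul_mem _ _ (D.rder_mem_Fdeg x hy))
      (fun y hy => D.mul_gen_mem_Fdeg x hy)
      (fun y z => by rw [form_comm, ← form_rder_adj, form_comm]; rfl)
    refine this.trans ?_
    simp only [LinearMap.mulRight_apply, AlgHom.toLinearMap_apply, plus_mul_gen, term,
      Finset.sum_mul, mul_assoc]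
  have hE : ∀ ν, E (ν + Finsupp.single x 1) = A ν := by
    intro ν
    have := transfer (h0.2.comp_dg χ) h0.1 (B (ν + Finsupp.single x 1)) (B ν)
      ((D.cden x)⁻¹ • D.lder x) (LinearMap.mulLeft Kq (D.gen x))
      (fun y hy => Submodule.smul_mem _ _ (D.lder_mem_Fdeg x hy))
      (fun y hy => D.gen_mul_mem_Fdeg x hy)
      (fun y z => by rw [form_comm, ← form_lder_adj, form_comm]; rfl)
    refine this.trans ?_
    simp only [LinearMap.mulLeft_apply, AlgHom.toLinearMap_apply, plus_gen_mul, A,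
      LinearMap.comp_apply, mul_assoc]
  have fA : (Function.support fun ν => A ν m).Finite :=
    hR.sum B (fun ν s => R.anti (D.dg χ ((B ν).b s)) * R.a x) LinearMap.id (fun _ _ h => h) m
  have fE : (Function.support fun ν => E ν m).Finite :=
    hR.sum B (fun ν s => R.anti (D.dg χ (((D.cden x)⁻¹ • D.lder x) ((B ν).b s))))
      LinearMap.id (fun _ _ h => h) m
  have fC : (Function.support fun ν => C ν m).Finite :=
    hR.sum B (fun ν s => R.anti (((D.cden x)⁻¹ • D.rder x) ((B ν).b s)))
      LinearMap.id (fun _ _ h => h) m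
  have fC' : (Function.support fun ν => (R.K x * R.K x) (C ν m)).Finite :=
    fC.subset fun ν hν h => hν (by
      change (R.K x * R.K x) _ = 0
      rw [show C ν m = 0 from h, map_zero])
  have e1 : R.a x (omega B hR m)
      = ∑ᶠ ν, A ν m + ∑ᶠ ν, (R.K x * R.K x) (C ν m) - ∑ᶠ ν, E ν m := by
    rw [omega_apply, map_finsum (R.a x) (hR.term B m), ← finsum_add_distrib fA fC',
      ← finsum_sub_distrib _ fE]
    · exact finsum_congr fun ν => congrArg (fun T => T m) (hterm ν)
    · exact (fA.union fC').subset (Function.support_add _ _)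
  rw [e1, finsum_shift x (fun ν => E ν m) (fun ν hν => by rw [hE0 ν hν]; rfl),
    ← map_finsum (R.K x * R.K x) fC,
    finsum_shift x (fun ν => C ν m) (fun ν hν => by rw [hC0 ν hν]; rfl)]
  simp only [hE, hC]
  rw [add_sub_cancel_left]
  rfl

/-! ### Commutation of Ω with K_x -/

theorem K_mul_anti (x : D.Iinf) (z) :
    R.K x * R.anti z = R.anti (D.dg (fun y => (D.qf x y)⁻¹) z) * R.K x := by
  induction z using gen_mul_induction with
  | h1 => simp [anti_one]
  | hadd u v hu hv => simp only [map_add, mul_add, add_mul, hu, hv]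
  | hsmul c u hu => simp only [map_smul, mul_smul_comm, smul_mul_assoc, hu]
  | hg y z hz =>
    have h : R.K x * (R.b y * R.K y) = (D.qf x y)⁻¹ • (R.b y * R.K y * R.K x) := by
      rw [bK_mul_K, smul_smul, inv_mul_cancel₀ (D.qf_ne_zero x y), one_smul]
    rw [anti_gen_mul, ← mul_assoc, hz, mul_assoc, h, map_mul (D.dg _), dg_gen, smul_mul_assoc,
      map_smul, anti_gen_mul, smul_mul_assoc, mul_smul_comm]
    simp only [mul_assoc]

/-- The basis element lowers and the dual basis element raises the weight by the same ν, so the two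
scalars are inverse to each other. -/
theorem K_mul_term (x : D.Iinf) (ν) : R.K x * R.term B ν = R.term B ν * R.K x := by
  rw [term, Finset.mul_sum, Finset.sum_mul]
  refine Finset.sum_congr rfl fun s _ => ?_
  rw [← mul_assoc, K_mul_anti, mul_assoc, K_mul_plus, dg_Fdeg _ _ ((B ν).b_mem s),
    dg_Fdeg _ _ ((B ν).bstar_mem s), map_smul, map_smul, smul_mul_assoc, smul_mul_assoc,
    mul_smul_comm, smul_smul, ← Finsupp.prod_mul]
  have : (ν.prod fun y n => (D.qf x y)⁻¹ ^ n * D.qf x y ^ n) = 1 := by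
    refine Finset.prod_eq_one fun y _ => ?_
    change (D.qf x y)⁻¹ ^ ν y * D.qf x y ^ ν y = 1
    rw [← mul_pow, inv_mul_cancel₀ (D.qf_ne_zero x y), one_pow]
  rw [this, one_smul, mul_assoc]

theorem omega_K (hR : R.LocallyFinite) (x : D.Iinf) (m : V) :
    omega B hR (R.K x m) = R.K x (omega B hR m) := by
  rw [omega_apply, omega_apply, map_finsum (R.K x) (hR.term B m)]
  exact finsum_congr fun ν => (congrArg (fun T => T m) (K_mul_term (R := R) B x ν)).symm

end Rep

end SuperBorcherdsCartanDatum

namespace SuperBorcherdsCartanDatum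

variable {I P : Type*} [AddCommGroup P] (D : SuperBorcherdsCartanDatum I P)

/-! ### Homomorphisms and quotients -/

namespace Rep

variable {D} {V W : Type*} [AddCommGroup V] [Module Kq V] [AddCommGroup W] [Module Kq W]

/-- Linear maps which commute with the operators. -/
structure IsHom (R : D.Rep V) (R' : D.Rep W) (f : V →ₗ[Kq] W) : Prop where
  a : ∀ x v, f (R.a x v) = R'.a x (f v)
  b : ∀ x v, f (R.b x v) = R'.b x (f v)
  K : ∀ x v, f (R.K x v) = R'.K x (f v)

variable {R : D.Rep V} {R' : D.Rep W} {f : V →ₗ[Kq] W}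

theorem IsHom.plus (h : IsHom R R' f) (y v) : f (R.plus y v) = R'.plus y (f v) := by
  induction y using gen_mul_induction with
  | h1 => simp
  | hadd u v hu hv => simp only [map_add, LinearMap.add_apply, hu, hv]
  | hsmul c u hu => simp only [map_smul, LinearMap.smul_apply, hu]
  | hg y z hz => rw [plus_gen_mul, Module.End.mul_apply, h.a, hz, plus_gen_mul]; rfl

theorem IsHom.anti (h : IsHom R R' f) (y v) : f (R.anti y v) = R'.anti y (f v) := by
  induction y using mul_gen_induction with
  | h1 => simp [anti_one]
  | hadd u v hu hv => simp only [map_add, LinearMap.add_apply, hu, hv]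
  | hsmul c u hu => simp only [map_smul, LinearMap.smul_apply, hu]
  | hg y z hz =>
    rw [anti_mul_gen, Module.End.mul_apply, Module.End.mul_apply, h.b, h.K, hz, anti_mul_gen]; rfl

/-- Naturality of Ω. It lets Ω be computed on the quotient U^+ and through embeddings between Verma
modules. -/
theorem IsHom.omega (h : IsHom R R' f) (B : ∀ ν : D.Iinf →₀ ℕ, D.DualBases ν)
    (hR : R.LocallyFinite) (hR' : R'.LocallyFinite) (v) :
    f (omega B hR v) = omega B hR' (f v) := by
  rw [omega_apply, omega_apply, map_finsum f (hR.term B v)]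
  refine finsum_congr fun ν => ?_
  rw [term, term, LinearMap.sum_apply, LinearMap.sum_apply, map_sum]
  refine Finset.sum_congr rfl fun s _ => ?_
  rw [Module.End.mul_apply, h.anti, h.plus]; rfl

theorem IsHom.locallyFinite (h : IsHom R R' f) (hf : Function.Surjective f)
    (hR : R.LocallyFinite) : R'.LocallyFinite := by
  intro m
  obtain ⟨v, rfl⟩ := hf m
  refine (hR v).subset fun ν hν => ?_
  obtain ⟨y, hy, hne⟩ := hν
  exact ⟨y, hy, fun h0 => hne (by rw [← h.plus, h0, map_zero])⟩

/-- The quotient by a stable subspace. -/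
noncomputable def quotient (R : D.Rep V) (N : Submodule Kq V) (ha : ∀ x, N ≤ N.comap (R.a x))
    (hb : ∀ x, N ≤ N.comap (R.b x)) (hK : ∀ x, N ≤ N.comap (R.K x))
    (hKinv : ∀ x, N ≤ N.comap (R.Kinv x)) : D.Rep (V ⧸ N) where
  a x := N.mapQ N (R.a x) (ha x)
  b x := N.mapQ N (R.b x) (hb x)
  K x := N.mapQ N (R.K x) (hK x)
  Kinv x := N.mapQ N (R.Kinv x) (hKinv x)
  K_mul_Kinv x := Submodule.linearMap_qext _ (LinearMap.ext fun v =>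
    congrArg (fun T => N.mkQ (T v)) (R.K_mul_Kinv x))
  Kinv_mul_K x := Submodule.linearMap_qext _ (LinearMap.ext fun v =>
    congrArg (fun T => N.mkQ (T v)) (R.Kinv_mul_K x))
  K_comm x y := Submodule.linearMap_qext _ (LinearMap.ext fun v =>
    congrArg (fun T => N.mkQ (T v)) (R.K_comm x y))
  K_mul_a x y := Submodule.linearMap_qext _ (LinearMap.ext fun v =>
    congrArg (fun T => N.mkQ (T v)) (R.K_mul_a x y))
  K_mul_b x y := Submodule.linearMap_qext _ (LinearMap.ext fun v =>
    congrArg (fun T => N.mkQ (T v)) (R.K_mul_b x y))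
  a_mul_b x y := Submodule.linearMap_qext _ (LinearMap.ext fun v =>
    congrArg (fun T => N.mkQ (T v)) (R.a_mul_b x y))

theorem quotient_isHom (R : D.Rep V) (N : Submodule Kq V) (ha hb hK hKinv) :
    IsHom R (R.quotient N ha hb hK hKinv) N.mkQ :=
  ⟨fun _ _ => rfl, fun _ _ => rfl, fun _ _ => rfl⟩

end Rep

/-! ### Verma modules -/

theorem dg_mul_gen (χ : D.Iinf → Kq) (z y) :
    D.dg χ (z * D.gen y) = χ y • (D.dg χ z * D.gen y) := by
  rw [map_mul, dg_gen, mul_smul_comm]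

theorem dg_comm (χ ψ : D.Iinf → Kq) (z) : D.dg χ (D.dg ψ z) = D.dg ψ (D.dg χ z) := by
  rw [dg_dg, dg_dg]; simp only [mul_comm]

theorem dg_qf_inv_dg_qf (x : D.Iinf) (z) : D.dg (fun y => (D.qf x y)⁻¹) (D.dg (D.qf x) z) = z := by
  rw [dg_dg]
  conv_rhs => rw [← D.dg_one z]
  congr 2
  funext y
  exact inv_mul_cancel₀ (D.qf_ne_zero x y)

theorem dg_qf_inv_twist (x : D.Iinf) (z) :
    D.dg (fun y => (D.qf x y)⁻¹) (D.twist x z) = D.dg (D.sgn x) z := by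
  rw [twist_eq, dg_dg]
  congr 2
  funext y
  rw [mul_comm, mul_assoc, mul_inv_cancel₀ (D.qf_ne_zero x y), mul_one]

theorem collect_verma {k W : Type*} [CommRing k] [AddCommGroup W] [Module k W]
    (s q q' c d l l' : k) (hq : q * q' = 1) (X₁ X₂ X₃ X₄ : W) :
    c • (l • (d • X₁ + (s * q) • q' • X₂) - l' • (s • X₃ + d • X₄))
      = s • c • (l • X₂ - l' • X₃) + d • c • (l • X₁ - l' • X₄) := by
  match_scalars <;> try ring1
  linear_combination c * l * s * hq

/-- The Verma module whose highest weight vector is multiplied by `Λ x` by `K_x`, realized on `F`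
with `b_x` acting as the multiplication by `a_x` from the right. -/
noncomputable def verma (Λ : D.Iinf → Kq) (hΛ : ∀ x, Λ x ≠ 0) : D.Rep D.F where
  a x := (D.cden x)⁻¹ • (Λ x • (D.dg fun y => (D.qf x y)⁻¹).toLinearMap.comp (D.rder x)
    - (Λ x)⁻¹ • (D.dg (D.sgn x)).toLinearMap.comp (D.lder x))
  b x := LinearMap.mulRight Kq (D.gen x)
  K x := Λ x • (D.dg fun y => (D.qf x y)⁻¹).toLinearMap
  Kinv x := (Λ x)⁻¹ • (D.dg (D.qf x)).toLinearMap
  K_mul_Kinv x := LinearMap.ext fun z => by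
    simp only [Module.End.mul_apply, LinearMap.smul_apply, AlgHom.toLinearMap_apply, map_smul,
      dg_qf_inv_dg_qf, smul_smul, inv_mul_cancel₀ (hΛ x), one_smul, Module.End.one_apply]
  Kinv_mul_K x := LinearMap.ext fun z => by
    simp only [Module.End.mul_apply, LinearMap.smul_apply, AlgHom.toLinearMap_apply, map_smul,
      dg_comm D (D.qf x), dg_qf_inv_dg_qf, smul_smul, mul_inv_cancel₀ (hΛ x), one_smul,
      Module.End.one_apply]
  K_comm x y := LinearMap.ext fun z => by
    simp only [Module.End.mul_apply, LinearMap.smul_apply, AlgHom.toLinearMap_apply, map_smul]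
    rw [smul_comm, dg_comm]
  K_mul_a x y := LinearMap.ext fun z => by
    have hq := D.qf_ne_zero x y
    simp only [Module.End.mul_apply, LinearMap.smul_apply, AlgHom.toLinearMap_apply, map_smul,
      LinearMap.sub_apply, LinearMap.comp_apply, map_sub, rder_dg, lder_dg, smul_sub, smul_smul,
      dg_comm D (fun w => (D.qf y w)⁻¹), dg_comm D (D.sgn y)]
    congr 2 <;> field_simp
  K_mul_b x y := LinearMap.ext fun z => by
    simp only [Module.End.mul_apply, LinearMap.smul_apply, AlgHom.toLinearMap_apply,
      LinearMap.mulRight_apply, dg_mul_gen, smul_mul_assoc]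
    rw [smul_comm]
  a_mul_b y x := LinearMap.ext fun z => by
    have h1 : D.delta x y • ((D.cden y)⁻¹ • (Λ y • D.dg (fun w => (D.qf y w)⁻¹) z
          - (Λ y)⁻¹ • D.dg (D.qf y) z))
        = D.delta x y • ((D.cden x)⁻¹ • (Λ x • D.dg (fun w => (D.qf x w)⁻¹) z
          - (Λ x)⁻¹ • D.dg (D.qf x) z)) :=
      (D.delta_smul_eq x y fun y => (D.cden y)⁻¹ • (Λ y • D.dg (fun w => (D.qf y w)⁻¹) z
          - (Λ y)⁻¹ • D.dg (D.qf y) z)).symm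
    have h2 : D.dg (D.sgn y) (D.twist y z) = D.dg (D.qf y) z := by
      rw [twist_eq, dg_dg]
      congr 2
      funext w
      rw [← mul_assoc, sgn_mul_sgn, one_mul]
    simp only [Module.End.mul_apply, LinearMap.smul_apply, AlgHom.toLinearMap_apply,
      LinearMap.add_apply, LinearMap.sub_apply, LinearMap.comp_apply, LinearMap.mulRight_apply,
      rder_mul_gen, lder_mul_gen, map_add, map_smul, dg_mul_gen, h2, ← h1, smul_mul_assoc, sub_mul,
      D.delta_comm y x, D.sgn_comm y x, D.qf_comm y x]
    exact collect_verma _ _ _ _ _ _ _ (mul_inv_cancel₀ (D.qf_ne_zero x y)) _ _ _ _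

end SuperBorcherdsCartanDatum

namespace SuperBorcherdsCartanDatum

variable {I P : Type*} [AddCommGroup P] (D : SuperBorcherdsCartanDatum I P)

theorem mul_mem_radical_left (y : D.F) {z : D.F} (hz : z ∈ D.radical) : y * z ∈ D.radical := by
  induction y using gen_mul_induction with
  | h1 => rwa [one_mul]
  | hadd u v hu hv => rw [add_mul]; exact add_mem hu hv
  | hsmul c u hu => rw [smul_mul_assoc]; exact Submodule.smul_mem _ _ hu
  | hg w y ih => rw [mul_assoc]; exact D.gen_mul_mem_radical w ih

/-! ### Degrees of words -/

theorem perm_of_content_eq {w w' : List D.Iinf} (h : D.content w = D.content w') : w.Perm w' := by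
  classical
  have hc : ∀ w : List D.Iinf, D.content w = Multiset.toFinsupp (w : Multiset D.Iinf) := by
    intro w
    induction w with
    | nil => simp [content]
    | cons y w ih =>
      rw [← Multiset.cons_coe, ← Multiset.singleton_add, map_add, Multiset.toFinsupp_singleton,
        ← ih, content_cons]
  rw [← Multiset.coe_eq_coe]
  apply Multiset.toFinsupp.injective
  rw [← hc, ← hc, h]

theorem exists_content_eq (ν : D.Iinf →₀ ℕ) : ∃ w, D.content w = ν := by
  induction ν using Finsupp.induction_linear with
  | zero => exact ⟨[], D.content_nil⟩
  | add f g hf hg =>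
    obtain ⟨u, rfl⟩ := hf
    obtain ⟨v, rfl⟩ := hg
    exact ⟨u ++ v, D.content_append u v⟩
  | single x n =>
    refine ⟨List.replicate n x, ?_⟩
    induction n with
    | zero => simp [content_nil]
    | succ n ih => rw [List.replicate_succ, content_cons, ih, ← Finsupp.single_add, add_comm]

/-- `∑_p (x, w_p)` -/
def lin (x : D.Iinf) (w : List D.Iinf) : ℤ := (w.map (D.form₀ x)).sum

/-- `∑_{p < r} (w_p, w_r)` -/
def pairSum : List D.Iinf → ℤ
  | [] => 0
  | x :: w => D.lin x w + pairSum w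

theorem lin_cons (x y : D.Iinf) (w) : D.lin x (y :: w) = D.form₀ x y + D.lin x w := by simp [lin]

theorem lin_append (x : D.Iinf) (u w) : D.lin x (u ++ w) = D.lin x u + D.lin x w := by simp [lin]

theorem pairSum_append_singleton (w : List D.Iinf) (x) :
    D.pairSum (w ++ [x]) = D.pairSum w + D.lin x w := by
  induction w with
  | nil => simp [pairSum, lin]
  | cons y w ih =>
    rw [List.cons_append, pairSum, ih, pairSum, lin_append, D.lin_cons x y w, form₀_comm D x y]
    simp [lin]; ring

/-- The form is symmetric, so the sum over pairs depends only on the degree of the word. -/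
theorem pairSum_perm {w w' : List D.Iinf} (h : w.Perm w') : D.pairSum w = D.pairSum w' := by
  induction h with
  | nil => rfl
  | cons x h ih => rw [pairSum, pairSum, ih, lin, lin, (h.map _).sum_eq]
  | swap x y l => simp only [pairSum, lin_cons, form₀_comm D x y]; ring
  | trans _ _ h1 h2 => exact h1.trans h2

theorem ht_add (μ ν : D.Iinf →₀ ℕ) : D.ht (μ + ν) = D.ht μ + D.ht ν :=
  Finsupp.sum_add_index' (fun _ => rfl) (fun _ _ _ => rfl)

theorem ht_single (x : D.Iinf) (n : ℕ) : D.ht (Finsupp.single x n) = n :=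
  Finsupp.sum_single_index rfl

theorem ht_pos {ν : D.Iinf →₀ ℕ} (h : ν ≠ 0) : 0 < D.ht ν := by
  obtain ⟨x, hx⟩ := Finsupp.ne_iff.1 h
  obtain ⟨μ, rfl⟩ := D.exists_add_single hx
  rw [ht_add, ht_single]; omega

theorem eq_counit_of_mem_Fdeg_zero {z : D.F} (hz : z ∈ D.Fdeg 0) : z = D.counit z • 1 := by
  induction hz using Fdeg_induction with
  | h0 => simp
  | hadd u v hu hv => rw [map_add, add_smul, ← hu, ← hv]
  | hsmul c u hu => rw [map_smul, smul_assoc, ← hu]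
  | hw w hw =>
    cases w with
    | nil => simp [word_nil]
    | cons y w =>
      exfalso
      rw [content_cons] at hw
      have := DFunLike.congr_fun hw y
      simp at this

theorem counit_eq_zero_of_mem_Fdeg {ν} (hν : ν ≠ 0) {z : D.F} (hz : z ∈ D.Fdeg ν) :
    D.counit z = 0 := by
  induction hz using Fdeg_induction with
  | h0 => simp
  | hadd u v hu hv => rw [map_add, hu, hv, add_zero]
  | hsmul c u hu => rw [map_smul, hu, smul_zero]
  | hw w hw =>
    cases w with
    | nil => exact absurd (hw.symm.trans D.content_nil) hν
    | cons y w => rw [word_cons, counit_gen_mul]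

/-- Homogeneous elements of positive degree are in the right ideal generated by the generators. -/
theorem exists_eq_sum_gen_mul {ν : D.Iinf →₀ ℕ} (hν : ν ≠ 0) {z : D.F} (hz : z ∈ D.Fdeg ν) :
    ∃ f : D.Iinf → D.F, (∀ x μ, ν = μ + Finsupp.single x 1 → f x ∈ D.Fdeg μ) ∧
      z = ∑ x ∈ ν.support, D.gen x * f x := by
  classical
  induction hz using Fdeg_induction with
  | h0 => exact ⟨0, fun _ _ _ => zero_mem _, by simp⟩
  | hadd u v hu hv =>
    obtain ⟨f, hf, rfl⟩ := hu
    obtain ⟨g, hg, rfl⟩ := hv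
    refine ⟨f + g, fun x μ h => add_mem (hf x μ h) (hg x μ h), ?_⟩
    simp only [Pi.add_apply, mul_add, Finset.sum_add_distrib]
  | hsmul c u hu =>
    obtain ⟨f, hf, rfl⟩ := hu
    refine ⟨c • f, fun x μ h => Submodule.smul_mem _ _ (hf x μ h), ?_⟩
    simp only [Pi.smul_apply, mul_smul_comm, Finset.smul_sum]
  | hw w hw =>
    cases w with
    | nil => exact absurd (hw.symm.trans D.content_nil) hν
    | cons y w =>
      rw [content_cons] at hw
      refine ⟨Pi.single y (D.word w), fun x μ h => ?_, ?_⟩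
      · by_cases hxy : x = y
        · subst hxy
          rw [Pi.single_eq_same]
          have : D.content w = μ := by
            apply add_right_cancel (b := Finsupp.single x 1)
            rw [← h, ← hw, add_comm]
          exact this ▸ D.word_mem_Fdeg w
        · rw [Pi.single_eq_of_ne hxy]; exact zero_mem _
      · rw [Finset.sum_eq_single y]
        · rw [Pi.single_eq_same, word_cons]
        · intro x _ hxy; rw [Pi.single_eq_of_ne hxy, mul_zero]
        · intro hy
          exfalso; apply hy
          rw [Finsupp.mem_support_iff, ← hw]; simp

/-! ### The radical acts by zero on the quotients of the Verma modules -/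

section verma

variable (Λ : D.Iinf → Kq) (hΛ : ∀ x, Λ x ≠ 0)

theorem verma_a (x z) : (D.verma Λ hΛ).a x z = (D.cden x)⁻¹ •
    (Λ x • D.dg (fun y => (D.qf x y)⁻¹) (D.rder x z)
      - (Λ x)⁻¹ • D.dg (D.sgn x) (D.lder x z)) := rfl

theorem verma_b (x z) : (D.verma Λ hΛ).b x z = z * D.gen x := rfl

theorem verma_K (x z) : (D.verma Λ hΛ).K x z = Λ x • D.dg (fun y => (D.qf x y)⁻¹) z := rfl

theorem verma_a_mem_radical (x) {z} (hz : z ∈ D.radical) : (D.verma Λ hΛ).a x z ∈ D.radical :=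
  Submodule.smul_mem _ _ (sub_mem
    (Submodule.smul_mem _ _ (D.dg_mem_radical _ (D.rder_mem_radical x hz)))
    (Submodule.smul_mem _ _ (D.dg_mem_radical _ (D.lder_mem_radical x hz))))

theorem verma_plus_mem_radical (y) {z} (hz : z ∈ D.radical) :
    (D.verma Λ hΛ).plus y z ∈ D.radical := by
  induction y using gen_mul_induction with
  | h1 => rwa [map_one]
  | hadd u v hu hv => rw [map_add]; exact add_mem hu hv
  | hsmul c u hu => rw [map_smul]; exact Submodule.smul_mem _ _ hu
  | hg x y ih => rw [Rep.plus_gen_mul]; exact D.verma_a_mem_radical Λ hΛ x ih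

/-- The image of the Verma module with underlying vector space `U^+`. -/
noncomputable def vermaQ : D.Rep D.Uplus :=
  (D.verma Λ hΛ).quotient D.radical (fun x _ hz => D.verma_a_mem_radical Λ hΛ x hz)
    (fun x _ hz => D.mul_gen_mem_radical x hz)
    (fun _ _ hz => Submodule.smul_mem _ _ (D.dg_mem_radical _ hz))
    (fun _ _ hz => Submodule.smul_mem _ _ (D.dg_mem_radical _ hz))

theorem vermaQ_isHom : Rep.IsHom (D.verma Λ hΛ) (D.vermaQ Λ hΛ) D.radical.mkQ :=
  Rep.quotient_isHom _ _ _ _ _ _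

theorem verma_plus_one (y) : (D.verma Λ hΛ).plus y 1 = D.counit y • 1 := by
  induction y using gen_mul_induction with
  | h1 => simp
  | hadd u v hu hv => simp only [map_add, LinearMap.add_apply, hu, hv, add_smul]
  | hsmul c u hu => rw [map_smul, LinearMap.smul_apply, hu, map_smul, smul_assoc]
  | hg x y ih =>
    rw [Rep.plus_gen_mul, Module.End.mul_apply, ih, map_smul, verma_a, rder_one, lder_one,
      counit_gen_mul]
    simp

/-- Here the radical vanishes already on F. Build z by right multiplications, that is, by the b_x;
the commutator formula leads to radical elements acting on the shorter vector, and at the highest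
weight vector only the constant term of r matters. -/
theorem verma_plus_eq_zero {r} (hr : r ∈ D.radical) (z) : (D.verma Λ hΛ).plus r z = 0 := by
  induction z using mul_gen_induction generalizing r with
  | h1 => rw [verma_plus_one, D.counit_eq_zero_of_mem_radical hr, zero_smul]
  | hadd u v hu hv => rw [map_add, hu hr, hv hr, add_zero]
  | hsmul c u hu => rw [map_smul, hu hr, smul_zero]
  | hg x z ih =>
    have h1 := congrArg (fun T => T z) ((D.verma Λ hΛ).plus_mul_b x r)
    -- K_x is moved to the left so that the induction hypothesis applies to z and not to K_x z; the
    -- element is pretwisted so that the derivative itself appears.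
    have h2 := congrArg (fun T => T z)
      ((D.verma Λ hΛ).K_mul_plus x (D.dg (fun y => (D.qf x y)⁻¹) (D.rder x r)))
    rw [dg_comm, dg_qf_inv_dg_qf] at h2
    simp only [Module.End.mul_apply, LinearMap.add_apply, LinearMap.smul_apply,
      LinearMap.sub_apply] at h1 h2
    rw [← h2, ih (D.dg_mem_radical _ hr), ih (D.dg_mem_radical _ (D.rder_mem_radical x hr)),
      ih (D.dg_mem_radical _ (D.lder_mem_radical x hr))] at h1
    simp only [map_zero, zero_add, smul_zero, sub_zero] at h1
    exact h1

theorem dg_qf_inv_word (x : D.Iinf) (u) :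
    D.dg (fun y => (D.qf x y)⁻¹) (D.word u) = qv ^ (-D.lin x u) • D.word u := by
  induction u with
  | nil => simp [word_nil, lin]
  | cons y u ih =>
    rw [word_cons, map_mul, dg_gen, ih, smul_mul_smul_comm, lin_cons, qf, ← zpow_neg,
      ← zpow_add₀ RatFunc.X_ne_zero, neg_add]

/-- Each letter first acts by K_x, then by right multiplication. The scalars record the highest
weight and the pairings of the appended letter with all letters before it. -/
theorem verma_anti_word (w u) : (D.verma Λ hΛ).anti (D.word w) (D.word u)
    = ((w.map Λ).prod * qv ^ (D.pairSum u - D.pairSum (u ++ w))) • D.word (u ++ w) := by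
  induction w using List.reverseRecOn with
  | nil => simp [word_nil, Rep.anti_one]
  | append_singleton w x ih =>
    have hx : ∀ v, D.word (v ++ [x]) = D.word v * D.gen x := fun v => by
      rw [word_append, word_cons, word_nil, mul_one]
    rw [hx, Rep.anti_mul_gen, Module.End.mul_apply, ih, map_smul, Module.End.mul_apply, verma_K,
      dg_qf_inv_word, verma_b, ← List.append_assoc, hx, smul_mul_assoc, smul_mul_assoc, smul_smul,
      smul_smul, pairSum_append_singleton, List.map_append, List.prod_append]
    congr 1
    rw [← sub_sub, sub_eq_add_neg _ (D.lin x (u ++ w)), zpow_add₀ RatFunc.X_ne_zero]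
    simp; ring

/-- The scalar depends only on the degree of y, so linear combinations in one degree act as a
multiple of right multiplication; this carries radical elements into the radical. -/
theorem verma_anti_smul (ν : D.Iinf →₀ ℕ) (u) :
    ∃ c : Kq, ∀ y ∈ D.Fdeg ν, (D.verma Λ hΛ).anti y (D.word u) = c • (D.word u * y) := by
  obtain ⟨w₀, hw₀⟩ := D.exists_content_eq ν
  refine ⟨(w₀.map Λ).prod * qv ^ (D.pairSum u - D.pairSum (u ++ w₀)), fun y hy => ?_⟩
  induction hy using Fdeg_induction with
  | h0 => simp
  | hadd u v hu hv => rw [map_add, LinearMap.add_apply, hu, hv, mul_add, smul_add]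
  | hsmul c u hu => rw [map_smul, LinearMap.smul_apply, hu, mul_smul_comm, smul_comm]
  | hw w hw =>
    have hp := D.perm_of_content_eq (hw.trans hw₀.symm)
    rw [verma_anti_word, (hp.map Λ).prod_eq, D.pairSum_perm (hp.append_left u), word_append]

theorem vermaQ_radicalFree : (D.vermaQ Λ hΛ).RadicalFree := by
  have hsurj := D.radical.mkQ_surjective
  constructor
  · intro ν r _ hr
    refine LinearMap.ext fun v => ?_
    obtain ⟨z, rfl⟩ := hsurj v
    rw [AlgHom.toLinearMap_apply, ← (D.vermaQ_isHom Λ hΛ).plus, D.verma_plus_eq_zero Λ hΛ hr,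
      map_zero, LinearMap.zero_apply]
  · intro ν r hν hr
    refine LinearMap.ext fun v => ?_
    obtain ⟨z, rfl⟩ := hsurj v
    rw [← (D.vermaQ_isHom Λ hΛ).anti, LinearMap.zero_apply, Submodule.mkQ_apply,
      Submodule.Quotient.mk_eq_zero]
    induction z using word_induction with
    | hadd u v hu hv => rw [map_add]; exact add_mem hu hv
    | hsmul c u hu => rw [map_smul]; exact Submodule.smul_mem _ _ hu
    | hw u =>
      obtain ⟨c, hc⟩ := D.verma_anti_smul Λ hΛ ν u
      rw [hc r hν]
      exact Submodule.smul_mem _ _ (D.mul_mem_radical_left _ hr)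

theorem verma_a_mem_Fdeg (x) {ν z} (hz : z ∈ D.Fdeg (ν + Finsupp.single x 1)) :
    (D.verma Λ hΛ).a x z ∈ D.Fdeg ν :=
  Submodule.smul_mem _ _ (sub_mem
    (Submodule.smul_mem _ _ (D.dg_mem_Fdeg _ (D.rder_mem_Fdeg x hz)))
    (Submodule.smul_mem _ _ (D.dg_mem_Fdeg _ (D.lder_mem_Fdeg x hz))))

theorem verma_a_eq_zero (x) {ν z} (hν : ν x = 0) (hz : z ∈ D.Fdeg ν) :
    (D.verma Λ hΛ).a x z = 0 := by
  rw [verma_a, D.rder_eq_zero x hν hz, D.lder_eq_zero x hν hz]; simp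

theorem verma_plus_mem_Fdeg {μ ν y z} (hy : y ∈ D.Fdeg μ) (hz : z ∈ D.Fdeg (ν + μ)) :
    (D.verma Λ hΛ).plus y z ∈ D.Fdeg ν := by
  induction hy using Fdeg_induction with
  | h0 => rw [map_zero]; exact zero_mem _
  | hadd u v hu hv => rw [map_add]; exact add_mem hu hv
  | hsmul c u hu => rw [map_smul]; exact Submodule.smul_mem _ _ hu
  | hw w hw =>
    subst hw
    induction w generalizing ν with
    | nil =>
      rw [content_nil, add_zero] at hz
      rwa [word_nil, map_one]
    | cons x w ih =>
      rw [word_cons, Rep.plus_gen_mul]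
      rw [content_cons, ← add_assoc] at hz
      exact D.verma_a_mem_Fdeg Λ hΛ x (ih hz)

theorem verma_plus_eq_zero_of_not_le {μ ν y z} (hμν : ¬ μ ≤ ν) (hy : y ∈ D.Fdeg μ)
    (hz : z ∈ D.Fdeg ν) : (D.verma Λ hΛ).plus y z = 0 := by
  induction hy using Fdeg_induction with
  | h0 => rw [map_zero]; rfl
  | hadd u v hu hv => rw [map_add, LinearMap.add_apply, hu, hv, add_zero]
  | hsmul c u hu => rw [map_smul, LinearMap.smul_apply, hu, smul_zero]
  | hw w hw =>
    subst hw
    induction w with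
    | nil => exact absurd (by rw [content_nil]; exact zero_le) hμν
    | cons x w ih =>
      rw [word_cons, Rep.plus_gen_mul, Module.End.mul_apply]
      by_cases h : D.content w ≤ ν
      · obtain ⟨κ, rfl⟩ := exists_add_of_le h
        rw [add_comm] at hz
        refine D.verma_a_eq_zero Λ hΛ x (ν := κ) ?_
          (D.verma_plus_mem_Fdeg Λ hΛ (D.word_mem_Fdeg w) hz)
        by_contra hx
        obtain ⟨κ', rfl⟩ := D.exists_add_single hx
        apply hμν
        rw [content_cons, add_comm κ', ← add_assoc, add_comm (D.content w)]
        exact le_self_add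
      · rw [ih h, map_zero]

theorem verma_locallyFinite : (D.verma Λ hΛ).LocallyFinite := by
  classical
  intro z
  induction z using word_induction with
  | hw w =>
    refine (Set.finite_Icc 0 (D.content w)).subset fun ν hν => ⟨zero_le, ?_⟩
    obtain ⟨y, hy, hne⟩ := hν
    by_contra h
    exact hne (D.verma_plus_eq_zero_of_not_le Λ hΛ h hy (D.word_mem_Fdeg w))
  | hadd u v hu hv =>
    refine (hu.union hv).subset fun ν hν => ?_
    obtain ⟨y, hy, hne⟩ := hν
    by_contra h
    rw [Set.mem_union, not_or] at h
    apply hne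
    rw [map_add, not_not.1 fun h' => h.1 ⟨y, hy, h'⟩, not_not.1 fun h' => h.2 ⟨y, hy, h'⟩, add_zero]
  | hsmul c u hu =>
    refine hu.subset fun ν hν => ?_
    obtain ⟨y, hy, hne⟩ := hν
    exact ⟨y, hy, fun h => hne (by rw [map_smul, h, smul_zero])⟩

theorem vermaQ_locallyFinite : (D.vermaQ Λ hΛ).LocallyFinite :=
  (D.vermaQ_isHom Λ hΛ).locallyFinite D.radical.mkQ_surjective (D.verma_locallyFinite Λ hΛ)

theorem verma_anti_mem_Fdeg {μ ν y z} (hy : y ∈ D.Fdeg μ) (hz : z ∈ D.Fdeg ν) :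
    (D.verma Λ hΛ).anti y z ∈ D.Fdeg (ν + μ) := by
  induction hy using Fdeg_induction with
  | h0 => rw [map_zero]; exact zero_mem _
  | hadd u v hu hv => rw [map_add]; exact add_mem hu hv
  | hsmul c u hu => rw [map_smul]; exact Submodule.smul_mem _ _ hu
  | hw w hw =>
    subst hw
    induction w generalizing ν z with
    | nil => rw [content_nil, add_zero, word_nil, Rep.anti_one]; exact hz
    | cons x w ih =>
      rw [word_cons, Rep.anti_gen_mul, content_cons, ← add_assoc]
      exact ih (D.mul_gen_mem_Fdeg x (Submodule.smul_mem _ _ (D.dg_mem_Fdeg _ hz)))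

/-- Right ideals are stable under the operators `S(y^-)`, on homogeneous elements. -/
theorem verma_anti_mem {J : Submodule Kq D.F} (hJ : ∀ x, ∀ z ∈ J, z * D.gen x ∈ J) {ν z}
    (hz : z ∈ D.Fdeg ν) (hzJ : z ∈ J) (y) : (D.verma Λ hΛ).anti y z ∈ J := by
  induction y using word_induction with
  | hadd u v hu hv => rw [map_add]; exact add_mem hu hv
  | hsmul c u hu => rw [map_smul]; exact Submodule.smul_mem _ _ hu
  | hw w =>
    induction w generalizing ν z with
    | nil => rw [word_nil, Rep.anti_one]; exact hzJ
    | cons x w ih =>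
      rw [word_cons, Rep.anti_gen_mul]
      refine ih (D.mul_gen_mem_Fdeg x (Submodule.smul_mem _ _ (D.dg_mem_Fdeg _ hz))) (hJ x _ ?_)
      refine Submodule.smul_mem _ _ ?_
      rw [AlgHom.toLinearMap_apply, D.dg_Fdeg _ hz]
      exact Submodule.smul_mem _ _ hzJ

/-! ### The operator Ω on Verma modules -/

variable (B : ∀ ν : D.Iinf →₀ ℕ, D.DualBases ν)

open SuperBorcherdsCartanDatum.Rep

/-- Degree zero consists of scalars, and pairing there is multiplication of constant terms.
Expanding 1 in the basis gives the sum of the products. -/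
theorem term_zero {V : Type*} [AddCommGroup V] [Module Kq V] (R : D.Rep V) : R.term B 0 = 1 := by
  have h1 : ∀ s, R.anti ((B 0).b s) * R.plus ((B 0).bstar s)
      = (D.counit ((B 0).b s) * D.counit ((B 0).bstar s)) • 1 := fun s => by
    conv_lhs => rw [D.eq_counit_of_mem_Fdeg_zero ((B 0).b_mem s),
      D.eq_counit_of_mem_Fdeg_zero ((B 0).bstar_mem s)]
    rw [map_smul, map_smul, anti_one, map_one, smul_mul_smul_comm, mul_one]
  have h2 := (B 0).expand_b (y := 1) (D.word_nil ▸ D.content_nil ▸ D.word_mem_Fdeg [])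
  have h3 := D.counit_eq_zero_of_mem_radical h2
  rw [map_sub, map_sum, map_one, sub_eq_zero] at h3
  rw [Rep.term, Finset.sum_congr rfl fun s _ => h1 s, ← Finset.sum_smul]
  conv_rhs => rw [← one_smul Kq (1 : Module.End Kq V), h3]
  congr 1
  refine Finset.sum_congr rfl fun s _ => ?_
  rw [map_smul, form_one_left, smul_eq_mul, mul_comm]

theorem verma_omega_one : omega B (D.verma_locallyFinite Λ hΛ) 1 = 1 := by
  rw [omega_apply, finsum_eq_single _ 0, term_zero, Module.End.one_apply]
  intro ν hν
  rw [Rep.term, LinearMap.sum_apply]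
  refine Finset.sum_eq_zero fun s _ => ?_
  rw [Module.End.mul_apply, verma_plus_one, D.counit_eq_zero_of_mem_Fdeg hν ((B ν).bstar_mem s),
    zero_smul, map_zero]

theorem verma_term_mem_Fdeg {ν z} (hz : z ∈ D.Fdeg ν) (μ) :
    (D.verma Λ hΛ).term B μ z ∈ D.Fdeg ν := by
  rw [Rep.term, LinearMap.sum_apply]
  refine Submodule.sum_mem _ fun s _ => ?_
  rw [Module.End.mul_apply]
  by_cases h : μ ≤ ν
  · obtain ⟨κ, rfl⟩ := exists_add_of_le h
    rw [add_comm] at hz ⊢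
    exact D.verma_anti_mem_Fdeg Λ hΛ ((B μ).b_mem s)
      (D.verma_plus_mem_Fdeg Λ hΛ ((B μ).bstar_mem s) hz)
  · rw [D.verma_plus_eq_zero_of_not_le Λ hΛ h ((B μ).bstar_mem s) hz, map_zero]
    exact zero_mem _

theorem verma_omega_mem_Fdeg {ν z} (hz : z ∈ D.Fdeg ν) :
    omega B (D.verma_locallyFinite Λ hΛ) z ∈ D.Fdeg ν := by
  rw [omega_apply]
  exact finsum_induction (· ∈ D.Fdeg ν) (zero_mem _) (fun _ _ => add_mem)
    fun μ => D.verma_term_mem_Fdeg Λ hΛ B hz μ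

/-- On U^+ the radical acts by zero, so `omega_b` applies. Each b_x multiplies the eigenvalue by the
square of the K_x-eigenvalue of the vector it acts on, starting from 1 at the highest weight vector.
-/
theorem vermaQ_omega_word (w) :
    omega B (D.vermaQ_locallyFinite Λ hΛ) (D.radical.mkQ (D.word w))
      = ((w.map Λ).prod * qv ^ (-D.pairSum w)) ^ 2 • D.radical.mkQ (D.word w) := by
  induction w using List.reverseRecOn with
  | nil =>
    rw [word_nil, ← (D.vermaQ_isHom Λ hΛ).omega B (D.verma_locallyFinite Λ hΛ), verma_omega_one]
    simp [pairSum]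
  | append_singleton w x ih =>
    have hx : D.word (w ++ [x]) = (D.verma Λ hΛ).b x (D.word w) := by
      rw [word_append, word_cons, word_nil, mul_one]; rfl
    have hK : (D.vermaQ Λ hΛ).K x (D.radical.mkQ (D.word w))
        = (Λ x * qv ^ (-D.lin x w)) • D.radical.mkQ (D.word w) := by
      rw [← (D.vermaQ_isHom Λ hΛ).K, verma_K, dg_qf_inv_word, smul_smul, map_smul]
    rw [hx, (D.vermaQ_isHom Λ hΛ).b, omega_b B (D.vermaQ_locallyFinite Λ hΛ)
      (D.vermaQ_radicalFree Λ hΛ), hK, map_smul, ih, map_smul, map_smul, map_smul, hK,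
      map_smul, map_smul, smul_smul, smul_smul, pairSum_append_singleton, neg_add,
      zpow_add₀ RatFunc.X_ne_zero, List.map_append, List.prod_append]
    congr 1
    simp; ring

/-- Lifted to F, the scalar action holds modulo the radical; it depends only on the degree because
`pairSum` does. -/
theorem verma_omega_sub_mem_radical {ν z} (hz : z ∈ D.Fdeg ν) {w} (hw : D.content w = ν) :
    omega B (D.verma_locallyFinite Λ hΛ) z
      - ((w.map Λ).prod * qv ^ (-D.pairSum w)) ^ 2 • z ∈ D.radical := by
  rw [← Submodule.Quotient.mk_eq_zero, ← Submodule.mkQ_apply, map_sub, sub_eq_zero, map_smul,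
    (D.vermaQ_isHom Λ hΛ).omega B _ (D.vermaQ_locallyFinite Λ hΛ)]
  induction hz using Fdeg_induction with
  | h0 => simp
  | hadd u v hu hv => simp only [map_add, hu, hv, smul_add]
  | hsmul c u hu => rw [map_smul, map_smul, hu, smul_comm]
  | hw w' hw' =>
    have hp := D.perm_of_content_eq (hw'.trans hw.symm)
    rw [vermaQ_omega_word, (hp.map Λ).prod_eq, D.pairSum_perm hp]

end verma

/-- Left multiplication by `a_x` is a homomorphism of Verma modules. -/
theorem verma_isHom (x : D.Iinf) :
    Rep.IsHom (D.verma (fun y => (D.qf x y)⁻¹) fun y => inv_ne_zero (D.qf_ne_zero x y))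
      (D.verma (fun _ => 1) fun _ => one_ne_zero) (LinearMap.mulLeft Kq (D.gen x)) where
  -- For highest weight zero the two δ-terms of the Leibniz rules cancel: a_x is a singular vector.
  a y z := by
    have h1 : D.delta y x • D.dg (fun w => (D.qf y w)⁻¹) (D.twist y z)
        = D.delta y x • D.dg (D.sgn y) z := by rw [dg_qf_inv_twist]
    simp only [LinearMap.mulLeft_apply, verma_a, rder_gen_mul, lder_gen_mul, map_add, map_smul,
      map_mul (D.dg _), dg_gen, h1, mul_sub, mul_smul_comm, smul_mul_assoc, one_smul, inv_one,
      inv_inv, D.qf_comm y x]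
    congr 1
    rw [smul_smul, D.sgn_comm y x, mul_right_comm, sgn_mul_sgn, one_mul]
    abel
  b y z := by simp only [LinearMap.mulLeft_apply, verma_b, mul_assoc]
  K y z := by
    simp only [LinearMap.mulLeft_apply, verma_K, map_mul (D.dg _), dg_gen, mul_smul_comm,
      smul_mul_assoc, one_smul, D.qf_comm y x]

/-- Homogeneous elements of the radical are in every ideal which contains the elements of the
radical of lower degree, unless `∑_{p < r} (ν_p, ν_r) = 0`. -/
theorem mem_of_pairSum_ne_zero {J : Submodule Kq D.F} (hl : ∀ x, ∀ z ∈ J, D.gen x * z ∈ J)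
    (hr : ∀ x, ∀ z ∈ J, z * D.gen x ∈ J) {w : List D.Iinf} (hw : D.pairSum w ≠ 0)
    (hJ : ∀ μ, D.ht μ < D.ht (D.content w) → ∀ z ∈ D.Fdeg μ, z ∈ D.radical → z ∈ J)
    {r : D.F} (hrw : r ∈ D.Fdeg (D.content w)) (hrad : r ∈ D.radical) : r ∈ J := by
  classical
  have hν : D.content w ≠ 0 := by
    intro h
    have := (D.perm_of_content_eq (h.trans D.content_nil.symm)).eq_nil
    rw [this] at hw
    exact hw rfl
  obtain ⟨f, hf, hrf⟩ := D.exists_eq_sum_gen_mul hν hrw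
  let B := fun ν => Classical.choice (D.nonempty_dualBases ν)
  let Ω := Rep.omega B (D.verma_locallyFinite (fun _ => 1) fun _ => one_ne_zero)
  let c : Kq := (qv ^ (-D.pairSum w)) ^ 2
  -- First evaluation of Ω r: in r = ∑ a_x f_x the factors f_x have smaller height, so the error of
  -- the scalar action on them is a radical element covered by `hJ`.
  have h1 : Ω r - c • r ∈ J := by
    conv in Ω r - c • r => rw [hrf]
    rw [map_sum, Finset.smul_sum, ← Finset.sum_sub_distrib]
    refine Submodule.sum_mem _ fun x hx => ?_
    obtain ⟨μ, hμ⟩ := D.exists_add_single (Finsupp.mem_support_iff.1 hx)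
    have hx0 : ∀ y, (D.qf x y)⁻¹ ≠ 0 := fun y => inv_ne_zero (D.qf_ne_zero x y)
    obtain ⟨u, rfl⟩ := D.exists_content_eq μ
    have e1 : Ω (D.gen x * f x)
        = D.gen x * Rep.omega B (D.verma_locallyFinite (fun y => (D.qf x y)⁻¹) hx0) (f x) :=
      ((D.verma_isHom x).omega B (D.verma_locallyFinite _ _) _ (f x)).symm
    -- The highest weight of the source of a_x supplies the pairings of x with the other letters, so
    -- the scalar is the same for every x.
    have e2 : c = ((u.map fun y => (D.qf x y)⁻¹).prod * qv ^ (-D.pairSum u)) ^ 2 := by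
      have hp : D.pairSum w = D.pairSum (x :: u) := D.pairSum_perm
        (D.perm_of_content_eq (hμ.trans (by rw [content_cons, add_comm])))
      have h3 : ∀ u : List D.Iinf, (u.map fun y => (D.qf x y)⁻¹).prod = qv ^ (-D.lin x u) := by
        intro u
        induction u with
        | nil => simp [lin]
        | cons y u ih =>
          rw [List.map_cons, List.prod_cons, ih, lin_cons, qf, ← zpow_neg,
            ← zpow_add₀ RatFunc.X_ne_zero, neg_add]
      rw [h3, ← zpow_add₀ RatFunc.X_ne_zero, ← neg_add, ← pairSum, ← hp]
    rw [e1, ← mul_smul_comm, ← mul_sub]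
    refine hl x _ (hJ (D.content u) ?_ _ ?_ ?_)
    · rw [hμ, ht_add, ht_single]; omega
    · exact sub_mem (D.verma_omega_mem_Fdeg _ _ B (hf x _ hμ)) (Submodule.smul_mem _ _ (hf x _ hμ))
    · rw [e2]
      exact D.verma_omega_sub_mem_radical _ _ B (hf x _ hμ) rfl
  -- Second evaluation: every component of nonzero degree first sends r to a radical element of
  -- smaller height, which is in J; then S(b^-) preserves J as a right ideal.
  have h2 : Ω r - r ∈ J := by
    rw [← Submodule.Quotient.mk_eq_zero, ← Submodule.mkQ_apply, map_sub, Rep.omega_apply,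
      map_finsum J.mkQ (Rep.LocallyFinite.term B (D.verma_locallyFinite _ _) r),
      finsum_eq_single _ 0, D.term_zero B, Module.End.one_apply, sub_self]
    intro μ hμ
    rw [Submodule.mkQ_apply, Submodule.Quotient.mk_eq_zero, Rep.term, LinearMap.sum_apply]
    refine Submodule.sum_mem _ fun s _ => ?_
    rw [Module.End.mul_apply]
    by_cases h : μ ≤ D.content w
    · obtain ⟨κ, hκ⟩ := exists_add_of_le h
      rw [add_comm] at hκ
      rw [hκ] at hrw
      have hm := D.verma_plus_mem_Fdeg (fun _ => 1) (fun _ => one_ne_zero) ((B μ).bstar_mem s) hrw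
      refine D.verma_anti_mem _ _ hr hm (hJ κ ?_ _ hm ?_) _
      · have := D.ht_pos hμ
        rw [hκ, ht_add]; omega
      · exact D.verma_plus_mem_radical _ _ _ hrad
    · rw [D.verma_plus_eq_zero_of_not_le _ _ h ((B μ).bstar_mem s) hrw, map_zero]
      exact zero_mem _
  have h3 : (1 - c) • r ∈ J := by
    have := sub_mem h1 h2
    rw [sub_sub_sub_cancel_left] at this
    rwa [sub_smul, one_smul]
  have hc : 1 - c ≠ 0 := by
    rw [sub_ne_zero]
    intro h
    exact hw (neg_eq_zero.1 (qv_zpow_eq h.symm))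
  exact (Submodule.smul_mem_iff _ hc).1 h3

end SuperBorcherdsCartanDatum

/-! ### Integrable modules of rank one -/

/-- Locally nilpotent operators `E`, `F` on a graded vector space with
`E F - ε F E = γ (Q^j - Q^{-j})` in degree `j`, where `ε = ± 1`. -/
structure RankOne {k V : Type*} [Field k] [AddCommGroup V] [Module k V] (E F : Module.End k V)
    (wt : ℤ → Submodule k V) (ε γ Q : k) : Prop where
  E_mem : ∀ {j v}, v ∈ wt j → E v ∈ wt (j + 2)
  F_mem : ∀ {j v}, v ∈ wt j → F v ∈ wt (j - 2)
  comm : ∀ {j v}, v ∈ wt j → E (F v) = ε • F (E v) + (γ * (Q ^ j - Q ^ (-j))) • v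
  eps : ε = 1 ∨ ε = -1
  gamma : γ ≠ 0
  Q_ne_zero : Q ≠ 0
  Q_zpow : ∀ n : ℤ, (Q ^ n) ^ 2 = 1 → n = 0
  E_nil : ∀ v, ∃ n : ℕ, (E ^ n) v = 0
  F_nil : ∀ v, ∃ n : ℕ, (F ^ n) v = 0

/-- The coefficients in `E F^t v = g_t F^{t-1} v` for a highest weight vector `v`. -/
def rankOneCoeff {k : Type*} [Field k] (ε γ Q : k) (m : ℤ) : ℕ → k
  | 0 => 0
  | t + 1 => γ * (Q ^ (m - 2 * t) - Q ^ (-(m - 2 * t))) + ε * rankOneCoeff ε γ Q m t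

namespace RankOne

variable {k V : Type*} [Field k] [AddCommGroup V] [Module k V] {E F : Module.End k V}
    {wt : ℤ → Submodule k V} {ε γ Q : k}

theorem eps_mul_self (h : RankOne E F wt ε γ Q) : ε * ε = 1 := by
  rcases h.eps with h | h <;> rw [h] <;> ring

/-- The symmetry of E and F with reversed grading; it turns statements about highest weight vectors
into statements about lowest weight vectors. -/
theorem swap (h : RankOne E F wt ε γ Q) : RankOne F E (fun j => wt (-j)) ε (ε * γ) Q where
  E_mem hv := by
    have := h.F_mem hv
    rwa [show ∀ j : ℤ, -j - 2 = -(j + 2) by intro j; ring] at this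
  F_mem hv := by
    have := h.E_mem hv
    rwa [show ∀ j : ℤ, -j + 2 = -(j - 2) by intro j; ring] at this
  comm {j v} hv := by
    rw [h.comm hv, smul_add, smul_smul, smul_smul, h.eps_mul_self, one_smul, add_assoc, ← add_smul,
      neg_neg]
    rw [show ε * (γ * (Q ^ (-j) - Q ^ j)) + ε * γ * (Q ^ j - Q ^ (-j)) = 0 by ring, zero_smul,
      add_zero]
  eps := h.eps
  gamma := mul_ne_zero (by rcases h.eps with h | h <;> rw [h] <;> simp) h.gamma
  Q_ne_zero := h.Q_ne_zero
  Q_zpow := h.Q_zpow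
  E_nil := h.F_nil
  F_nil := h.E_nil

theorem E_pow_mem (h : RankOne E F wt ε γ Q) {j : ℤ} {v} (hv : v ∈ wt j) (t : ℕ) :
    (E ^ t) v ∈ wt (j + 2 * t) := by
  induction t with
  | zero => simpa using hv
  | succ t ih =>
    rw [pow_succ', Module.End.mul_apply]
    have := h.E_mem ih
    rwa [show j + 2 * (t : ℤ) + 2 = j + 2 * ((t + 1 : ℕ) : ℤ) by push_cast; ring] at this

theorem F_pow_mem (h : RankOne E F wt ε γ Q) {j : ℤ} {v} (hv : v ∈ wt j) (t : ℕ) :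
    (F ^ t) v ∈ wt (j - 2 * t) := by
  induction t with
  | zero => simpa using hv
  | succ t ih =>
    rw [pow_succ', Module.End.mul_apply]
    have := h.F_mem ih
    rwa [show j - 2 * (t : ℤ) - 2 = j - 2 * ((t + 1 : ℕ) : ℤ) by push_cast; ring] at this

/-- The recursion sums two geometric progressions; the factor on the left clears the common
denominator. -/
theorem coeff_closed (h : RankOne E F wt ε γ Q) (m : ℤ) (t : ℕ) :
    rankOneCoeff ε γ Q m (t + 1) * (1 - ε * (Q ^ 2)⁻¹)
    = γ * (ε ^ t * Q ^ m - Q ^ (2 * t - m)) * (1 - (ε * (Q ^ 2)⁻¹) ^ (t + 1)) := by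
  have hQ := h.Q_ne_zero
  have hm : Q ^ m ≠ 0 := zpow_ne_zero _ hQ
  have e1 : ∀ t : ℕ, Q ^ (2 * (t : ℤ) - m) = (Q ^ 2) ^ t / Q ^ m := fun t => by
    rw [zpow_sub₀ hQ, zpow_mul, zpow_natCast, zpow_ofNat]
  have e2 : ∀ t : ℕ, Q ^ (m - 2 * (t : ℤ)) = Q ^ m / (Q ^ 2) ^ t := fun t => by
    rw [zpow_sub₀ hQ, zpow_mul, zpow_natCast, zpow_ofNat]
  have e3 : ∀ t : ℕ, (Q ^ 2) ^ t ≠ 0 := fun t => pow_ne_zero _ (pow_ne_zero _ hQ)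
  induction t with
  | zero => simp [rankOneCoeff]
  | succ t ih =>
    rw [rankOneCoeff, add_mul, mul_assoc ε, ih]
    rw [neg_sub, e1, e1, e2, mul_pow, mul_pow, inv_pow, inv_pow, pow_succ (Q ^ 2) t,
      pow_succ (Q ^ 2) (t + 1), pow_succ (Q ^ 2) t]
    have hu := pow_ne_zero 2 hQ
    have ht := e3 t
    generalize (Q ^ 2) ^ t = w at ht ⊢
    generalize Q ^ 2 = u at hu ⊢
    generalize Q ^ m = a at hm ⊢
    rcases h.eps with he | he
    · subst he
      simp only [one_pow]
      field_simp
      ring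
    · rw [he]
      rcases neg_one_pow_eq_or k t with ht' | ht' <;> simp only [pow_succ, ht'] <;> field_simp <;>
        ring

/-- Either factor of the closed form could vanish only if a power of Q were a sign. The case t = m
is left open, since for ε = -1 the coefficient there depends on the parity of m. -/
theorem coeff_ne_zero (h : RankOne E F wt ε γ Q) {m : ℤ} {t : ℕ} (hmt : (t : ℤ) ≠ m) :
    rankOneCoeff ε γ Q m (t + 1) ≠ 0 := by
  intro h0
  have hc := h.coeff_closed m t
  have hQ := h.Q_ne_zero
  have he : ∀ n : ℕ, (ε ^ n) ^ 2 = 1 := fun n => by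
    rw [← pow_mul, mul_comm, pow_mul, pow_two, h.eps_mul_self, one_pow]
  rw [h0, zero_mul, eq_comm] at hc
  rcases mul_eq_zero.1 hc with hc | hc
  · have hc := sub_eq_zero.1 ((mul_eq_zero.1 hc).resolve_left h.gamma)
    have h2 := h.Q_zpow (2 * t - m - m) (by
      rw [zpow_sub₀ hQ, ← hc, mul_div_assoc, div_self (zpow_ne_zero _ hQ), mul_one, he])
    omega
  · have hc := sub_eq_zero.1 hc
    have h2 := h.Q_zpow (-(2 * (t + 1 : ℕ))) (by
      have h3 := congrArg (fun z => z ^ 2) hc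
      simp only [mul_pow, one_pow] at h3
      rw [he, one_mul] at h3
      simp only [h3, zpow_neg, zpow_mul, zpow_natCast, zpow_ofNat, inv_pow])
    omega

theorem E_F_pow (h : RankOne E F wt ε γ Q) {m : ℤ} {v} (hv : v ∈ wt m) (hE : E v = 0) (t : ℕ) :
    E ((F ^ (t + 1)) v) = rankOneCoeff ε γ Q m (t + 1) • (F ^ t) v := by
  induction t with
  | zero =>
    rw [zero_add, pow_one, h.comm hv, hE]
    simp [rankOneCoeff]
  | succ t ih =>
    rw [pow_succ', Module.End.mul_apply, h.comm (h.F_pow_mem hv (t + 1)), ih, map_smul,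
      ← Module.End.mul_apply, ← pow_succ', smul_smul, ← add_smul]
    congr 1
    conv_rhs => rw [rankOneCoeff]
    ring

/-- If no coefficient vanishes, applying E brings F^{n+1} v back to a nonzero multiple of F^n v,
against the nilpotency of F. -/
theorem eq_zero_of_coeff (h : RankOne E F wt ε γ Q) {m : ℤ} {v} (hv : v ∈ wt m) (hE : E v = 0)
    (hc : ∀ t, rankOneCoeff ε γ Q m (t + 1) ≠ 0) : v = 0 := by
  obtain ⟨n, hn⟩ := h.F_nil v
  induction n with
  | zero => simpa using hn
  | succ n ih =>
    apply ih
    have := h.E_F_pow hv hE n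
    rw [hn, map_zero, eq_comm] at this
    exact (smul_eq_zero.1 this).resolve_left (hc n)

theorem F_pow_eq_zero (h : RankOne E F wt ε γ Q) {n : ℕ} {v} (hv : v ∈ wt n) (hE : E v = 0) :
    (F ^ (n + 1)) v = 0 := by
  -- If the critical coefficient vanishes, F^{n+1} v is a highest weight vector of negative weight,
  -- hence zero. Otherwise no coefficient vanishes and v itself is zero.
  by_cases hn : rankOneCoeff ε γ Q n (n + 1) = 0
  · refine h.eq_zero_of_coeff (h.F_pow_mem hv (n + 1)) ?_ fun t => h.coeff_ne_zero ?_
    · rw [h.E_F_pow hv hE, hn, zero_smul]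
    · omega
  · rw [h.eq_zero_of_coeff hv hE, map_zero]
    intro t
    by_cases ht : t = n
    · rw [ht]; exact hn
    · exact h.coeff_ne_zero (by exact_mod_cast ht)

theorem exists_E_pow_F_pow (h : RankOne E F wt ε γ Q) (m : ℤ) (j t : ℕ)
    (hjt : ∀ i, j ≤ i → i < j + t → (i : ℤ) ≠ m) :
    ∃ C : k, C ≠ 0 ∧ ∀ v ∈ wt m, E v = 0 → (E ^ t) ((F ^ (j + t)) v) = C • (F ^ j) v := by
  induction t with
  | zero => exact ⟨1, one_ne_zero, fun v _ _ => by simp⟩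
  | succ t ih =>
    obtain ⟨C, hC, hCv⟩ := ih fun i h1 h2 => hjt i h1 (by omega)
    refine ⟨rankOneCoeff ε γ Q m (j + t + 1) * C,
      mul_ne_zero (h.coeff_ne_zero (hjt _ (by omega) (by omega))) hC, fun v hv hE => ?_⟩
    rw [pow_succ, Module.End.mul_apply, ← add_assoc, h.E_F_pow hv hE, map_smul, hCv v hv hE,
      smul_smul]

/-- In nonnegative degrees all vectors are sums of vectors `F^i u` with `E u = 0`. -/
theorem highest_induction (h : RankOne E F wt ε γ Q) {p : V → Prop} {m : ℤ} (hm : 0 ≤ m) (h0 : p 0)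
    (hadd : ∀ u v, p u → p v → p (u + v)) (s : ℕ)
    (hF : ∀ i < s, ∀ u ∈ wt (m + 2 * i), E u = 0 → p ((F ^ i) u)) {v} (hv : v ∈ wt m)
    (hs : (E ^ s) v = 0) : p v := by
  induction s generalizing v with
  | zero => rw [pow_zero, Module.End.one_apply] at hs; rwa [hs]
  | succ s ih =>
    -- Since m ≥ 0, the critical index m + 2s lies beyond the coefficients in use. Thus F^s C⁻¹ E^s
    -- v has the same image as v under E^s, and subtracting it lowers s.
    obtain ⟨C, hC, hCv⟩ := h.exists_E_pow_F_pow (m + 2 * s) 0 s (by intros; omega)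
    have hu := h.E_pow_mem hv s
    have hEu : E ((E ^ s) v) = 0 := by rwa [← Module.End.mul_apply, ← pow_succ']
    have h1 := hCv _ hu hEu
    rw [zero_add, pow_zero, Module.End.one_apply] at h1
    have hw : (F ^ s) (C⁻¹ • (E ^ s) v) ∈ wt m := by
      have := h.F_pow_mem (Submodule.smul_mem _ C⁻¹ hu) s
      rwa [add_sub_cancel_right] at this
    have h2 := hF s (by omega) _ (Submodule.smul_mem _ C⁻¹ hu) (by rw [map_smul, hEu, smul_zero])
    rw [← sub_add_cancel v ((F ^ s) (C⁻¹ • (E ^ s) v))]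
    refine hadd _ _ (ih (fun i hi => hF i (by omega)) (sub_mem hv hw) ?_) h2
    rw [map_sub, map_smul, map_smul, h1, smul_smul, inv_mul_cancel₀ hC, one_smul, sub_self]

/-- The top layer of w is recovered from F^a w: E^{s+a} F^a kills the layers F^i u with i < s and is
a nonzero multiple of E^s on the layer i = s. -/
theorem F_pow_injective (h : RankOne E F wt ε γ Q) {n a : ℕ} (ha : a ≤ n) {w} (hw : w ∈ wt n)
    (hF : (F ^ a) w = 0) :
    w = 0 := by
  obtain ⟨s, hs⟩ := h.E_nil w
  induction s with
  | zero => simpa using hs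
  | succ s ih =>
    apply ih
    obtain ⟨C, hC, hCv⟩ := h.exists_E_pow_F_pow (n + 2 * s) 0 (s + a) (by intros; omega)
    obtain ⟨C', hC', hCv'⟩ := h.exists_E_pow_F_pow (n + 2 * s) 0 s (by intros; omega)
    have key : C' • (E ^ (s + a)) ((F ^ a) w) = C • (E ^ s) w := by
      refine h.highest_induction (p := fun w => C' • (E ^ (s + a)) ((F ^ a) w) = C • (E ^ s) w)
        (Int.natCast_nonneg n) (by simp) ?_ (s + 1) ?_ hw hs
      · intro u v hu hv; simp only [map_add, smul_add, hu, hv]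
      · intro i hi u hu hEu
        have hFa : (F ^ a) ((F ^ i) u) = (F ^ (a + i)) u := by rw [pow_add]; rfl
        rw [hFa]
        by_cases his : i = s
        · subst his
          have h1 := hCv u hu hEu
          have h2 := hCv' u hu hEu
          rw [zero_add] at h1 h2
          rw [add_comm a, h1, h2, smul_comm]
        · obtain ⟨r, rfl⟩ : ∃ r, s = r + 1 + i := ⟨s - i - 1, by omega⟩
          have hz : ∀ b : ℕ, b ≤ n → (E ^ (r + 1 + i + b)) ((F ^ (b + i)) u) = 0 := by
            intro b hb
            obtain ⟨c, -, hc⟩ := h.exists_E_pow_F_pow (n + 2 * i) 0 (b + i) (by intros; omega)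
            have := hc u hu hEu
            rw [zero_add, pow_zero, Module.End.one_apply] at this
            rw [show r + 1 + i + b = (r + 1) + (b + i) by omega, pow_add, Module.End.mul_apply,
              this, map_smul, pow_succ, Module.End.mul_apply, hEu, map_zero, smul_zero]
          have h0 := hz 0 (by omega)
          rw [add_zero, zero_add] at h0
          rw [hz a ha, h0, smul_zero, smul_zero]
    rw [hF, map_zero, smul_zero, eq_comm] at key
    exact (smul_eq_zero.1 key).resolve_left hC

theorem E_pow_map {T : Module.End k V} {κ : k} (hT : ∀ v, E (T v) = κ • T (E v)) (n : ℕ) (v) :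
    (E ^ n) (T v) = κ ^ n • T ((E ^ n) v) := by
  induction n with
  | zero => simp
  | succ n ih =>
    rw [pow_succ', Module.End.mul_apply, ih, map_smul, hT, smul_smul, ← pow_succ]; rfl

/-- An operator of negative degree which commutes with `E` up to a scalar vanishes. -/
theorem eq_zero_of_commute (h : RankOne E F wt ε γ Q) {T : Module.End k V} {κ : k} (hκ : κ ≠ 0)
    (hT : ∀ v, E (T v) = κ • T (E v)) {c : ℤ} (hc : 0 < c)
    (hTm : ∀ {j v}, v ∈ wt j → T v ∈ wt (j - c)) {m : ℤ} {v} (hv : v ∈ wt m) : T v = 0 := by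
  -- In degrees ≤ 0 the vectors are sums of E^i u with u of lowest weight -n. Then E^{n+1} kills u,
  -- hence T u; but T u has degree -(n + c), where E^{n+1} is injective because c ≥ 1.
  have low : ∀ {m : ℤ} {v}, m ≤ 0 → v ∈ wt m → T v = 0 := by
    intro m v hm hv
    obtain ⟨s, hs⟩ := h.F_nil v
    refine h.swap.highest_induction (p := fun v => T v = 0) (m := -m) (by omega) (map_zero _)
      (fun u v hu hv => by rw [map_add, hu, hv, add_zero]) s ?_ (by rwa [neg_neg]) hs
    intro i _ u hu hFu
    obtain ⟨n, hn⟩ := Int.eq_ofNat_of_zero_le (show 0 ≤ -m + 2 * i by omega)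
    rw [hn] at hu
    have h1 : (E ^ (n + 1)) u = 0 := h.swap.F_pow_eq_zero hu hFu
    obtain ⟨c', rfl⟩ := Int.eq_ofNat_of_zero_le hc.le
    have h2 : T u = 0 := by
      refine h.swap.F_pow_injective (n := n + c') (a := n + 1) (by omega) ?_ ?_
      · have := hTm hu
        rwa [show -(n : ℤ) - c' = -((n + c' : ℕ) : ℤ) by push_cast; ring] at this
      · rw [E_pow_map hT, h1, map_zero, smul_zero]
    have h3 := E_pow_map hT i u
    rw [h2, map_zero, eq_comm] at h3
    exact (smul_eq_zero.1 h3).resolve_left (pow_ne_zero _ hκ)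
  rcases le_or_gt m 0 with hm | hm
  · exact low hm hv
  · obtain ⟨s, hs⟩ := h.E_nil v
    obtain ⟨n, rfl⟩ := Int.eq_ofNat_of_zero_le hm.le
    refine h.highest_induction (p := fun v => T v = 0) (by omega) (map_zero _)
      (fun u v hu hv => by rw [map_add, hu, hv, add_zero]) s ?_ hv hs
    intro i _ u hu hEu
    -- In degree n > 0 the vector F^i u is up to a scalar E^n of F^{i+n} u, which has degree -n and
    -- is killed by T.
    obtain ⟨C, hC, hCv⟩ := h.exists_E_pow_F_pow (n + 2 * i) i n (by intros; omega)
    have h1 := hCv u hu hEu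
    have h2 : T ((F ^ (i + n)) u) = 0 := by
      refine low ?_ (h.F_pow_mem hu (i + n))
      push_cast; omega
    have h3 := E_pow_map hT n ((F ^ (i + n)) u)
    rw [h2, map_zero, h1, map_smul, smul_smul, eq_comm] at h3
    exact (smul_eq_zero.1 h3).resolve_left (mul_ne_zero (pow_ne_zero _ hκ) hC)

end RankOne

namespace SuperBorcherdsCartanDatum

variable {I P : Type*} [AddCommGroup P] (D : SuperBorcherdsCartanDatum I P)

/-! ### Components of the radical in orthogonal degrees -/

/-- The supercommutator of two generators. -/
noncomputable def supercomm (x y : D.Iinf) : D.F :=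
  D.gen x * D.gen y - D.sgn x y • (D.gen y * D.gen x)

theorem qf_eq_one {x y : D.Iinf} (h : D.form₀ x y = 0) : D.qf x y = 1 := by rw [qf, h, zpow_zero]

/-- All left derivatives vanish: for orthogonal letters the twist is only the sign, and the two
contributions cancel. -/
theorem supercomm_mem_radical {x y : D.Iinf} (h : D.form₀ x y = 0) :
    D.supercomm x y ∈ D.radical := by
  refine D.mem_radical_of_lder ?_ fun w => ?_
  · rw [supercomm, map_sub, map_smul, counit_gen_mul, counit_gen_mul, smul_zero, sub_zero]
  · have e : D.lder w (D.supercomm x y) = 0 := by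
      have h1 := D.delta_smul_eq w x fun w => (D.sgn w y * D.qf w y) • D.gen y
      have h2 := D.delta_smul_eq w y fun w => (D.sgn w x * D.qf w x) • D.gen x
      simp only [D.sgn_comm y x, D.qf_comm y x, D.qf_eq_one h, mul_one] at h1 h2
      rw [supercomm, map_sub, map_smul, lder_gen_mul, lder_gen_mul, lder_gen, lder_gen,
        mul_smul_comm, mul_smul_comm, mul_one, mul_one, smul_comm _ (D.delta w y), h2,
        smul_comm _ (D.delta w x), h1, smul_add, smul_comm (D.sgn x y) (D.delta w x),
        smul_comm (D.delta w y), smul_smul (D.sgn x y) (D.sgn x y), sgn_mul_sgn, one_smul,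
        add_comm, sub_self]
    rw [e]; exact zero_mem _

section orthogonal

/-- `J` is a two-sided ideal containing the supercommutators of orthogonal generators. -/
structure SupercommIdeal (J : Submodule Kq D.F) : Prop where
  gen_mul_mem : ∀ x, ∀ z ∈ J, D.gen x * z ∈ J
  mul_gen_mem : ∀ x, ∀ z ∈ J, z * D.gen x ∈ J
  supercomm_mem : ∀ x y, D.form₀ x y = 0 → D.supercomm x y ∈ J

variable {D} {J : Submodule Kq D.F}

theorem SupercommIdeal.mul_mem_of_right (hI : D.SupercommIdeal J) (y) {z} (hz : z ∈ J) :
    z * y ∈ J := by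
  induction y using mul_gen_induction with
  | h1 => rwa [mul_one]
  | hadd u v hu hv => rw [mul_add]; exact add_mem hu hv
  | hsmul c u hu => rw [mul_smul_comm]; exact Submodule.smul_mem _ _ hu
  | hg w y ih => rw [← mul_assoc]; exact hI.mul_gen_mem w _ ih

theorem SupercommIdeal.gen_mul_gen_mul (hI : D.SupercommIdeal J) {x y : D.Iinf}
    (h : D.form₀ x y = 0) (z) :
    D.gen x * (D.gen y * z) - D.sgn x y • (D.gen y * (D.gen x * z)) ∈ J := by
  have := hI.mul_mem_of_right z (hI.supercomm_mem x y h)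
  rwa [supercomm, sub_mul, smul_mul_assoc, mul_assoc, mul_assoc] at this

-- The Euler identity: modulo supercommutators a_x can be brought back to the place from which ∂_x
-- removed it, so a_x ∂_x counts the occurrences of x.
open Classical in
theorem SupercommIdeal.gen_mul_lder_word (hI : D.SupercommIdeal J) (x : D.Iinf) (v : List D.Iinf)
    (hv : ∀ y ∈ v, D.form₀ x y = 0) :
    D.gen x * D.lder x (D.word v) - (v.count x : Kq) • D.word v ∈ J := by
  induction v with
  | nil => simp [word_nil, lder_one]
  | cons y v ih =>
    have hy := hv y (by simp)
    have h1 := hI.gen_mul_mem y _ (ih fun y hy => hv y (by simp [hy]))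
    have h2 := hI.gen_mul_gen_mul hy (D.lder x (D.word v))
    have h3 : D.delta x y • (D.gen x * D.word v) = D.delta x y • (D.gen y * D.word v) :=
      D.delta_smul_eq x y fun t => D.gen t * D.word v
    have h4 : ((y :: v).count x : Kq) = D.delta x y + (v.count x : Kq) := by
      rw [List.count_cons, delta]
      by_cases h : x = y
      · simp [h, add_comm]
      · simp [h, Ne.symm h]
    rw [word_cons, lder_gen_mul, mul_add, mul_smul_comm, mul_smul_comm, h3, h4, D.qf_eq_one hy,
      mul_one, add_smul, add_sub_add_left_eq_sub]
    have h5 := add_mem (Submodule.smul_mem _ (D.sgn x y) h2) h1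
    rw [smul_sub, smul_smul, sgn_mul_sgn, one_smul, mul_sub, mul_smul_comm,
      sub_add_sub_cancel] at h5
    exact h5

theorem SupercommIdeal.word_front (hI : D.SupercommIdeal J) (x : D.Iinf) (u v : List D.Iinf)
    (hu : ∀ y ∈ u, D.form₀ x y = 0) :
    ∃ c : Kq, D.word (u ++ x :: v) - c • (D.gen x * D.word (u ++ v)) ∈ J := by
  induction u with
  | nil => exact ⟨1, by simp [word_cons]⟩
  | cons y u ih =>
    obtain ⟨c, h1⟩ := ih fun y hy => hu y (by simp [hy])
    refine ⟨c * D.sgn y x, ?_⟩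
    have h2 := hI.gen_mul_gen_mul (x := y) (y := x)
      (by rw [form₀_comm]; exact hu y (by simp)) (D.word (u ++ v))
    have h3 := add_mem (hI.gen_mul_mem y _ h1) (Submodule.smul_mem _ c h2)
    rw [mul_sub, mul_smul_comm, smul_sub, sub_add_sub_cancel, smul_smul] at h3
    rw [List.cons_append, List.cons_append, word_cons, word_cons]
    exact h3

/-- In orthogonal degrees the radical is generated by the supercommutators. -/
theorem SupercommIdeal.mem_of_pairwise (hI : D.SupercommIdeal J) (hJ : J ≤ D.radical)
    (w : List D.Iinf)
    (hw : w.Pairwise fun x y => D.form₀ x y = 0) {r : D.F} (hrw : r ∈ D.Fdeg (D.content w))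
    (hrad : r ∈ D.radical) : r ∈ J := by
  classical
  induction w generalizing r with
  | nil =>
    rw [content_nil] at hrw
    rw [D.eq_counit_of_mem_Fdeg_zero hrw, D.counit_eq_zero_of_mem_radical hrad, zero_smul]
    exact zero_mem _
  | cons x w ih =>
    obtain ⟨hx, hw'⟩ := List.pairwise_cons.1 hw
    -- Modulo J one letter x can be brought to the front of every monomial, so r may be replaced by
    -- a_x r'.
    have h1 : ∃ r' ∈ D.Fdeg (D.content w), r - D.gen x * r' ∈ J := by
      clear hrad
      induction hrw using Fdeg_induction with
      | h0 => exact ⟨0, zero_mem _, by simp⟩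
      | hadd u v hu hv =>
        obtain ⟨u', hu', hu⟩ := hu
        obtain ⟨v', hv', hv⟩ := hv
        refine ⟨u' + v', add_mem hu' hv', ?_⟩
        rw [mul_add, add_sub_add_comm]
        exact add_mem hu hv
      | hsmul c u hu =>
        obtain ⟨u', hu', hu⟩ := hu
        refine ⟨c • u', Submodule.smul_mem _ _ hu', ?_⟩
        rw [mul_smul_comm, ← smul_sub]
        exact Submodule.smul_mem _ _ hu
      | hw v hv =>
        have hp := D.perm_of_content_eq hv
        obtain ⟨v₁, v₂, rfl⟩ := List.append_of_mem (hp.mem_iff.2 (List.mem_cons_self (a := x)))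
        have hp' : (v₁ ++ v₂).Perm w := (List.perm_middle.symm.trans hp).cons_inv
        obtain ⟨c, hcv⟩ := hI.word_front x v₁ v₂ fun y hy =>
          hx y (hp'.mem_iff.1 (by simp [hy]))
        refine ⟨c • D.word (v₁ ++ v₂), Submodule.smul_mem _ _ ?_, ?_⟩
        · have hcc : D.content (v₁ ++ v₂) = D.content w := by
            apply add_left_cancel (a := Finsupp.single x 1)
            rw [content_append, content_cons, content_cons] at hv
            rw [content_append, ← hv]; abel
          exact hcc ▸ D.word_mem_Fdeg _
        · rwa [mul_smul_comm]
    obtain ⟨r', hr', hrr'⟩ := h1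
    suffices h : D.gen x * r' ∈ J by
      rw [← sub_add_cancel r (D.gen x * r')]; exact add_mem hrr' h
    have h2 : D.gen x * r' ∈ D.radical := by
      rw [← sub_sub_cancel r (D.gen x * r')]; exact sub_mem hrad (hJ hrr')
    have h3 : D.gen x * D.lder x r' - (w.count x : Kq) • r' ∈ J := by
      clear h2 hrr'
      induction hr' using Fdeg_induction with
      | h0 => simp
      | hadd u v hu hv =>
        rw [map_add, mul_add, smul_add, add_sub_add_comm]; exact add_mem hu hv
      | hsmul c u hu =>
        rw [map_smul, mul_smul_comm, smul_comm, ← smul_sub]; exact Submodule.smul_mem _ _ hu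
      | hw v hv =>
        have hp := D.perm_of_content_eq hv
        rw [← hp.count_eq x]
        exact hI.gen_mul_lder_word x v fun y hy => hx y (hp.mem_iff.1 hy)
    have h4 := D.lder_mem_radical x h2
    rw [lder_gen_mul, delta_self, one_smul] at h4
    -- Apply ∂_x to a_x r' and use the Euler identity: a multiple of r' is in the radical, and what
    -- matters is whether the factor vanishes.
    have h5 : ∀ c : Kq, r' + c • (D.gen x * D.lder x r') ∈ D.radical →
        (1 + c * (w.count x : Kq)) • r' ∈ D.radical := fun c h => by
      have := sub_mem h (Submodule.smul_mem _ c (hJ h3))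
      rw [smul_sub, smul_smul, add_sub_assoc, sub_sub_cancel] at this
      rwa [add_smul, one_smul]
    by_cases hk : w.count x = 0
    · have h6 := h5 _ h4
      rw [hk, Nat.cast_zero, mul_zero, add_zero, one_smul] at h6
      exact hI.gen_mul_mem x _ (ih hw' hr' h6)
    · have hxx : D.form₀ x x = 0 := hx x (List.count_pos_iff.1 (Nat.pos_of_ne_zero hk))
      have hk' : (w.count x : Kq) ≠ 0 := Nat.cast_ne_zero.2 hk
      rw [D.qf_eq_one hxx, mul_one] at h4
      rcases neg_one_pow_eq_or Kq (D.parity x * D.parity x) with hs | hs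
      -- Sign 1: the factor is one plus the multiplicity of x in w, nonzero in characteristic zero.
      · have h6 := h5 _ h4
        rw [sgn, hs, one_mul] at h6
        refine hI.gen_mul_mem x _ (ih hw' hr' ((Submodule.smul_mem_iff _ ?_).1 h6))
        rw [add_comm]
        exact Nat.cast_add_one_ne_zero _
      -- Sign -1: a_x² is in J, and r' is modulo J a multiple of a_x ∂_x r', so a_x r' is in J
      -- directly.
      · have h6 := hI.gen_mul_gen_mul hxx (D.lder x r')
        rw [sgn, hs, neg_one_smul, sub_neg_eq_add, ← two_smul Kq] at h6
        have h7 := (Submodule.smul_mem_iff _ two_ne_zero).1 h6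
        have h8 := sub_mem h7 (hI.gen_mul_mem x _ h3)
        rw [mul_sub, sub_sub_cancel, mul_smul_comm] at h8
        exact (Submodule.smul_mem_iff _ hk').1 h8

end orthogonal

theorem list_sum_nonpos {l : List ℤ} (h : ∀ z ∈ l, z ≤ 0) : l.sum ≤ 0 := by
  induction l with
  | nil => exact le_rfl
  | cons y l ih =>
    rw [List.sum_cons]
    exact add_nonpos (h y (by simp)) (ih fun z hz => h z (by simp [hz]))

/-! ### Degrees with vanishing pair sums -/

/-- Counting each pair twice pairs every letter with the rest of the word. In this form the signs of
the single summands can be controlled. -/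
theorem two_mul_pairSum (w : List D.Iinf) :
    2 * D.pairSum w = (w.map fun x => D.lin x w - D.form₀ x x).sum := by
  induction w with
  | nil => rfl
  | cons x w ih =>
    have h1 : ∀ v : List D.Iinf, (v.map fun y => D.lin y (x :: w) - D.form₀ y y).sum
        = D.lin x v + (v.map fun y => D.lin y w - D.form₀ y y).sum := by
      intro v
      induction v with
      | nil => rfl
      | cons y v ih =>
        rw [List.map_cons, List.sum_cons, ih, List.map_cons, List.sum_cons, D.lin_cons y,
          D.lin_cons x y v, form₀_comm D x y]; ring
    rw [List.map_cons, List.sum_cons, h1, ← ih, pairSum, lin_cons]; ring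

theorem form₀_nonpos {x y : D.Iinf} (hx : D.A x.idx x.idx ≤ 0) : D.form₀ x y ≤ 0 := by
  have h : D.A x.idx y.idx ≤ 0 := by
    by_cases h : x.idx = y.idx
    · rwa [← h]
    · exact D.offdiag _ _ h
  have h1 : (0 : ℤ) ≤ (x.mul : ℤ) * (y.mul : ℤ) := by positivity
  have h2 : (D.d x.idx : ℤ) * D.A x.idx y.idx ≤ 0 :=
    mul_nonpos_of_nonneg_of_nonpos (by positivity) h
  exact mul_nonpos_of_nonneg_of_nonpos h1 h2

theorem mul_pos' (x : D.Iinf) : 0 < x.mul := x.1.2.pos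

theorem A_eq_zero_of_form₀ {x y : D.Iinf} (h : D.form₀ x y = 0) : D.A x.idx y.idx = 0 := by
  have h1 := D.mul_pos' x
  have h2 := D.mul_pos' y
  have h3 := D.d_pos x.idx
  simp only [form₀, mul_eq_zero, Nat.cast_eq_zero] at h
  omega

theorem eq_simple (x : D.Iinf) (hx : D.A x.idx x.idx = 2) : x = D.simple x.idx :=
  Subtype.ext (Prod.ext rfl (x.2 hx))

/-- Every letter pairs nonpositively with the rest: an imaginary one by the signs of the matrix, a
real one because (x, x) > 0 is subtracted from (x, w) ≤ 0, and then strictly. A vanishing total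
excludes real letters and forces each remaining pairing to be zero. -/
theorem pairwise_of_pairSum {w : List D.Iinf} (h0 : D.pairSum w = 0)
    (h : ∀ i, D.A i i = 2 → D.lin (D.simple i) w ≤ 0) :
    w.Pairwise fun x y => D.form₀ x y = 0 := by
  classical
  have h1 : ∀ x ∈ w, D.lin x w - D.form₀ x x ≤ 0 ∧
      (D.A x.idx x.idx = 2 → D.lin x w - D.form₀ x x < 0) := by
    intro x hx
    have hreal : D.A x.idx x.idx = 2 → D.lin x w - D.form₀ x x < 0 := fun hA => by
      have h2 := h _ hA
      rw [← D.eq_simple x hA] at h2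
      have h3 := D.mul_pos' x
      have h4 := D.d_pos x.idx
      have : 0 < D.form₀ x x := by rw [form₀, hA]; positivity
      omega
    refine ⟨?_, hreal⟩
    rcases D.diag x.idx with hA | hA
    · exact (hreal hA).le
    · have hp : D.lin x w = D.lin x (x :: w.erase x) :=
        ((List.perm_cons_erase hx).map _).sum_eq
      rw [hp, lin_cons, add_sub_cancel_left, lin]
      refine list_sum_nonpos fun z hz => ?_
      obtain ⟨y, -, rfl⟩ := List.mem_map.1 hz
      exact D.form₀_nonpos hA.1
  have h2 : ∀ x ∈ w, D.A x.idx x.idx ≤ 0 := by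
    intro x hx
    rcases D.diag x.idx with hA | hA
    · exfalso
      have h3 := D.two_mul_pairSum w
      have h4 : ((w.erase x).map fun x => D.lin x w - D.form₀ x x).sum ≤ 0 := by
        refine list_sum_nonpos fun z hz => ?_
        obtain ⟨y, hy, rfl⟩ := List.mem_map.1 hz
        exact (h1 y (List.mem_of_mem_erase hy)).1
      have h5 := (h1 x hx).2 hA
      rw [h0, ((List.perm_cons_erase hx).map _).sum_eq, List.map_cons, List.sum_cons] at h3
      omega
    · exact hA.1
  clear h1 h
  induction w with
  | nil => exact List.Pairwise.nil
  | cons x w ih =>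
    have hx := h2 x (by simp)
    have h3 : ∀ v : List D.Iinf, D.lin x v ≤ 0 := fun v => list_sum_nonpos fun z hz => by
      obtain ⟨y, -, rfl⟩ := List.mem_map.1 hz
      exact D.form₀_nonpos hx
    have h4 : ∀ v : List D.Iinf, (∀ y ∈ v, D.A y.idx y.idx ≤ 0) → D.pairSum v ≤ 0 := by
      intro v hv
      induction v with
      | nil => exact le_rfl
      | cons y v ihv =>
        have h5 : D.lin y v ≤ 0 := list_sum_nonpos fun z hz => by
          obtain ⟨t, -, rfl⟩ := List.mem_map.1 hz
          exact D.form₀_nonpos (hv y (by simp))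
        have h6 := ihv fun t ht => hv t (by simp [ht])
        rw [pairSum]; omega
    have h5 := h3 w
    have h6 := h4 w fun y hy => h2 y (by simp [hy])
    rw [pairSum] at h0
    refine List.Pairwise.cons ?_ (ih (by omega) fun y hy => h2 y (by simp [hy]))
    intro y hy
    have hp : D.lin x w = D.lin x (y :: w.erase y) :=
      ((List.perm_cons_erase hy).map _).sum_eq
    rw [lin_cons] at hp
    have h7 := h3 (w.erase y)
    have h8 : D.form₀ x y ≤ 0 := D.form₀_nonpos hx
    omega

end SuperBorcherdsCartanDatum

namespace SuperBorcherdsCartanDatum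

variable {I P : Type*} [AddCommGroup P] (D : SuperBorcherdsCartanDatum I P)

/-! ### Modules over `U` -/

theorem K_mul_Kinv (x : D.Iinf) : D.K x * D.Kinv x = 1 := by
  rw [K, Kinv, t_mul_t, add_neg_cancel, t_zero]

theorem Kinv_mul_K (x : D.Iinf) : D.Kinv x * D.K x = 1 := by
  rw [K, Kinv, t_mul_t, neg_add_cancel, t_zero]

theorem K_mul_a (x y : D.Iinf) : D.K x * D.a y = D.qf x y • (D.a y * D.K x) := by
  rw [K, t_mul_a, kap_apply, qf]

theorem K_mul_b (x y : D.Iinf) : D.K x * D.b y = (D.qf x y)⁻¹ • (D.b y * D.K x) := by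
  rw [K, t_mul_b, kap_apply, qf, zpow_neg]

theorem a_mul_b (y x : D.Iinf) : D.a y * D.b x
    = D.sgn x y • (D.b x * D.a y) + D.delta x y • (D.cden x)⁻¹ • (D.K x - D.Kinv x) := by
  by_cases h : y = x
  · subst h
    rw [delta_self, one_smul, ← a_mul_b_self, sgn, add_sub_cancel]
  · rw [D.a_mul_b_ne y x h, D.delta_ne (Ne.symm h), zero_smul, add_zero, D.sgn_comm, sgn]

section modules

variable (M : Type*) [AddCommGroup M] [Module Kq M] [Module D.U M] [IsScalarTower Kq D.U M]

/-- The action of `U` on a module. -/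
noncomputable def action : D.U →ₐ[Kq] Module.End Kq M := Algebra.lsmul Kq Kq M

theorem action_apply (u : D.U) (m : M) : D.action M u m = u • m := rfl

/-- The operators `a_x`, `b_x`, `K_x`, `K_x⁻¹` on a `U`-module. -/
noncomputable def rep : D.Rep M where
  a x := D.action M (D.a x)
  b x := D.action M (D.b x)
  K x := D.action M (D.K x)
  Kinv x := D.action M (D.Kinv x)
  K_mul_Kinv x := by rw [← map_mul, K_mul_Kinv, map_one]
  Kinv_mul_K x := by rw [← map_mul, Kinv_mul_K, map_one]
  K_comm x y := by rw [← map_mul, ← map_mul, K, K, t_comm]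
  K_mul_a x y := by rw [← map_mul, ← map_mul, ← map_smul, K_mul_a]
  K_mul_b x y := by rw [← map_mul, ← map_mul, ← map_smul, K_mul_b]
  a_mul_b y x := by
    rw [← map_mul, ← map_mul, ← map_sub, ← map_smul, ← map_smul, ← map_smul, ← map_add, a_mul_b]

theorem rep_plus (y : D.F) : (D.rep M).plus y = D.action M (D.plus y) := by
  have : (D.rep M).plus = (D.action M).comp D.plus := by
    apply FreeAlgebra.hom_ext
    funext x
    simp [Rep.plus, plus, rep]
  rw [this]; rfl

theorem rep_anti (y : D.F) :
    (D.rep M).anti y = D.action M (D.antiLift (fun x => D.b x * D.K x) y) := by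
  rw [map_antiLift]
  simp only [map_mul]
  rfl

/-! ### Comparison with the antipode -/

/-- The number of odd letters of a word. -/
noncomputable def oddCount (w : List D.Iinf) : ℕ := (w.map D.parity).sum

theorem e_content (w : List D.Iinf) : D.e (D.content w) = (D.oddCount w).choose 2 := by
  rw [e]
  congr 1
  induction w with
  | nil => simp [content_nil, oddCount]
  | cons x w ih =>
    rw [content_cons, Finsupp.sum_add_index' (by simp) (by intros; ring), ih,
      Finsupp.sum_single_index (by simp), one_mul, oddCount, oddCount, List.map_cons, List.sum_cons]

theorem tw_antiLift_word (n : ℕ) (w : List D.Iinf) :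
    D.tw n (D.antiLift (fun x => D.b x * D.K x) (D.word w))
      = (-1 : Kq) ^ (n * D.oddCount w) • D.antiLift (fun x => D.b x * D.K x) (D.word w) := by
  induction w with
  | nil => simp [word_nil, antiLift_one, oddCount]
  | cons x w ih =>
    rw [word_cons, antiLift_gen_mul, map_mul, ih, map_mul, K, tw_t, b, tw_g, smul_mul_assoc,
      smul_mul_assoc, mul_smul_comm, smul_smul, ← pow_add]
    congr 2
    simp only [oddCount, List.map_cons, List.sum_cons, Gen.parity]
    ring

theorem choose_two_add_parity (x : D.Iinf) (n : ℕ) :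
    (D.parity x + n).choose 2 = n.choose 2 + D.parity x * n := by
  have h : D.parity x < 2 := Nat.mod_lt _ two_pos
  interval_cases D.parity x
  · simp
  · rw [add_comm 1 n, Nat.choose_succ_succ', Nat.choose_one_right]; ring

/-- Each letter contributes -1 from S(b_x) = -b_x K_x, and reversing the product contributes -1 for
each pair of odd letters. -/
theorem S_minus_word (w : List D.Iinf) : D.S (D.minus (D.word w))
    = (-1 : Kq) ^ (w.length + (D.oddCount w).choose 2) •
      D.antiLift (fun x => D.b x * D.K x) (D.word w) := by
  induction w with
  | nil => simp [word_nil, antiLift_one, oddCount, S_one]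
  | cons x w ih =>
    have h1 : D.minus (D.word (x :: w)) = D.g (.b x) * D.minus (D.word w) := by
      rw [word_cons, map_mul, minus, FreeAlgebra.lift_ι_apply]; rfl
    have h2 : D.oddCount (x :: w) = D.parity x + D.oddCount w := by simp [oddCount]
    have h3 : D.Sgen (.b x) = (-1 : Kq) • (D.b x * D.K x) := by rw [neg_one_smul]; rfl
    rw [h1, S_g_mul, ih, map_smul, tw_antiLift_word, h2, choose_two_add_parity, h3, word_cons,
      antiLift_gen_mul, mul_smul_comm, smul_mul_assoc, smul_mul_assoc, smul_smul, smul_smul,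
      List.length_cons]
    congr 1
    simp only [Gen.parity]
    ring

theorem ht_content (w : List D.Iinf) : D.ht (D.content w) = w.length := by
  induction w with
  | nil => rw [content_nil]; rfl
  | cons x w ih => rw [content_cons, ht_add, ht_single, ih, List.length_cons, add_comm]

/-- Both signs depend on the degree only, so the sign in the definition of Ω cancels that of the
antipode in the whole component. -/
theorem sign_smul_S_minus {ν} {y : D.F} (hy : y ∈ D.Fdeg ν) :
    (-1 : Kq) ^ (D.ht ν + D.e ν) • D.S (D.minus y) = D.antiLift (fun x => D.b x * D.K x) y := by
  induction hy using Fdeg_induction with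
  | h0 => simp
  | hadd u v hu hv => rw [map_add, map_add, smul_add, hu, hv, map_add]
  | hsmul c u hu => rw [map_smul, map_smul, smul_comm, hu, map_smul]
  | hw w hw =>
    rw [S_minus_word, ← hw, ht_content, e_content, smul_smul, sign_mul_self, one_smul]

variable {D} in
theorem omegaTerm_eq (B : ∀ ν, D.DualBases ν) (ν : D.Iinf →₀ ℕ) (m : M) :
    omegaTerm B ν m = (D.rep M).term B ν m := by
  rw [omegaTerm, Rep.term, LinearMap.sum_apply]
  refine Finset.sum_congr rfl fun s _ => ?_
  rw [Module.End.mul_apply, rep_plus, rep_anti, action_apply, action_apply,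
    ← D.sign_smul_S_minus ((B ν).b_mem s), smul_assoc]

/-! ### Weights -/

/-- The image of `ν ∈ ℕ I^∞` in `Q_+`. -/
noncomputable def wt (ν : D.Iinf →₀ ℕ) : P := ν.sum fun x n => n • (x.mul • D.root x.idx)

variable {D M}

theorem a_mem_weightSpace (x : D.Iinf) {μ : P} {m : M} (hm : m ∈ D.weightSpace M μ) :
    D.a x • m ∈ D.weightSpace M (x.mul • D.root x.idx + μ) := by
  intro h
  rw [← mul_smul, t_mul_a, smul_assoc, mul_smul, hm h, smul_comm _ (qv ^ h μ) m, smul_smul,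
    ← zpow_add₀ RatFunc.X_ne_zero, map_add, map_nsmul, nsmul_eq_mul]

theorem plus_mem_weightSpace {ν} {y : D.F} (hy : y ∈ D.Fdeg ν) {μ : P} {m : M}
    (hm : m ∈ D.weightSpace M μ) : D.plus y • m ∈ D.weightSpace M (D.wt ν + μ) := by
  induction hy using Fdeg_induction with
  | h0 => simp
  | hadd u v hu hv => rw [map_add, add_smul]; exact add_mem hu hv
  | hsmul c u hu => rw [map_smul, smul_assoc]; exact Submodule.smul_mem _ _ hu
  | hw w hw =>
    subst hw
    induction w with
    | nil => simpa [word_nil, content_nil, wt] using hm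
    | cons x w ih =>
      have h1 : D.plus (D.word (x :: w)) = D.a x * D.plus (D.word w) := by
        rw [word_cons, map_mul, plus, FreeAlgebra.lift_ι_apply]
      have h2 : D.wt (D.content (x :: w)) = x.mul • D.root x.idx + D.wt (D.content w) := by
        rw [content_cons, wt, Finsupp.sum_add_index' (by simp) (by intros; rw [add_smul]),
          Finsupp.sum_single_index (by simp), one_smul, wt]
      rw [h1, h2, mul_smul, add_assoc]
      exact a_mem_weightSpace x ih

theorem weightSpace_induction (h : ⨆ μ : P, D.weightSpace M μ = ⊤) {p : M → Prop}
    (hw : ∀ μ, ∀ m ∈ D.weightSpace M μ, p m) (h0 : p 0) (hadd : ∀ m n, p m → p n → p (m + n))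
    (m : M) : p m := by
  have hm : m ∈ ⨆ μ : P, D.weightSpace M μ := by rw [h]; trivial
  exact Submodule.iSup_induction _ (motive := p) hm hw h0 hadd

variable (D) in
/-- The coefficients of `wt ν` in the basis of simple roots. -/
noncomputable def wtCoeff (ν : D.Iinf →₀ ℕ) : I →₀ ℕ :=
  ν.sum fun x n => Finsupp.single x.idx (n * x.mul)

variable (D) in
theorem wt_eq (ν : D.Iinf →₀ ℕ) : D.wt ν = (D.wtCoeff ν).sum fun i n => n • D.root i := by
  classical
  rw [wtCoeff, Finsupp.sum_sum_index (by simp) (by intros; rw [add_smul]), wt]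
  refine Finsupp.sum_congr fun x _ => ?_
  rw [Finsupp.sum_single_index (by simp), mul_smul]

variable (D) in
theorem mul_le_wtCoeff (ν : D.Iinf →₀ ℕ) (x : D.Iinf) : ν x * x.mul ≤ D.wtCoeff ν x.idx := by
  classical
  by_cases h : ν x = 0
  · simp [h]
  · rw [wtCoeff, Finsupp.sum, Finsupp.finsetSum_apply]
    have := Finset.single_le_sum (f := fun y : D.Iinf =>
      (Finsupp.single y.idx (ν y * y.mul) : I →₀ ℕ) x.idx) (fun _ _ => Nat.zero_le _)
      (Finsupp.mem_support_iff.2 h)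
    simpa using this

variable (D) in
theorem root_sum_injective {b c : I →₀ ℕ}
    (h : (b.sum fun i n => n • D.root i) = c.sum fun i n => n • D.root i) : b = c := by
  have h1 := D.linearIndependent_root.restrict_scalars' ℕ
  apply h1
  simpa [Finsupp.linearCombination_apply] using h

-- A part (i, l) of ν with multiplicity n uses nl of the coefficient N_i, so both l and n are
-- bounded and only finitely many parts are possible, even when i is imaginary.
variable (D) in
theorem finite_wtCoeff_le (N : I →₀ ℕ) : {ν : D.Iinf →₀ ℕ | D.wtCoeff ν ≤ N}.Finite := by
  classical
  have hX : {x : D.Iinf | x.mul ≤ N x.idx}.Finite := by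
    refine Set.Finite.of_finite_image (f := fun x : D.Iinf => (x.idx, x.mul))
      ((N.support.finite_toSet.prod (Set.finite_Iic (N.sum fun _ n => n))).subset ?_) ?_
    · rintro _ ⟨x, hx, rfl⟩
      have h1 := D.mul_pos' x
      have h2 : x.mul ≤ N x.idx := hx
      have h3 : x.idx ∈ N.support := Finsupp.mem_support_iff.2 (by omega)
      exact ⟨h3, h2.trans (Finset.single_le_sum (f := fun i => N i) (fun _ _ => Nat.zero_le _) h3)⟩
    · rintro x - y - h
      exact Subtype.ext (Prod.ext (Prod.ext_iff.1 h).1 (PNat.eq (Prod.ext_iff.1 h).2))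
  let G : D.Iinf →₀ ℕ := Finsupp.indicator hX.toFinset fun x _ => N x.idx
  refine (Set.finite_Iic G).subset fun ν hν x => ?_
  have h1 := D.mul_le_wtCoeff ν x
  have h2 : D.wtCoeff ν x.idx ≤ N x.idx := hν x.idx
  have h3 := D.mul_pos' x
  by_cases h : ν x = 0
  · rw [h]; exact Nat.zero_le _
  · have h4 : x ∈ hX.toFinset := by
      rw [Set.Finite.mem_toFinset]
      exact (Nat.le_mul_of_pos_left _ (Nat.pos_of_ne_zero h)).trans (h1.trans h2)
    rw [Finsupp.indicator_of_mem h4]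
    exact (Nat.le_mul_of_pos_right _ h3).trans (h1.trans h2)

-- If the set is nonempty, κ is a combination of simple roots with fixed coefficients N. By linear
-- independence every ν in the set then has coefficients at most N.
variable (D) in
theorem finite_sub_wt_mem (κ : P) : {ν : D.Iinf →₀ ℕ | κ - D.wt ν ∈ D.Qplus}.Finite := by
  rcases Set.eq_empty_or_nonempty {ν : D.Iinf →₀ ℕ | κ - D.wt ν ∈ D.Qplus} with h | ⟨ν₀, h₀⟩
  · rw [h]; exact Set.finite_empty
  have key : ∀ ν, κ - D.wt ν ∈ D.Qplus → ∃ c : I →₀ ℕ,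
      κ = (D.wtCoeff ν + c).sum fun i n => n • D.root i := by
    intro ν hν
    obtain ⟨c, hc⟩ := AddSubmonoid.exists_finsupp_of_mem_closure_range _ _ hν
    refine ⟨c, ?_⟩
    rw [Finsupp.sum_add_index' (by simp) (by intros; rw [add_smul]), ← wt_eq, ← hc, add_sub_cancel]
  obtain ⟨c₀, h₀⟩ := key ν₀ h₀
  refine (D.finite_wtCoeff_le (D.wtCoeff ν₀ + c₀)).subset fun ν hν => ?_
  obtain ⟨c, hc⟩ := key ν hν
  rw [Set.mem_ofPred_eq, ← D.root_sum_injective (hc.symm.trans h₀)]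
  exact le_self_add

/-- On a weight vector a nonzero action in degree ν produces the weight μ + wt ν, which must lie
below one of finitely many weights. -/
theorem IsOint.locallyFinite (hM : D.IsOint M) : (D.rep M).LocallyFinite := by
  intro m
  refine weightSpace_induction (p := fun m =>
    {ν : D.Iinf →₀ ℕ | ∃ y ∈ D.Fdeg ν, (D.rep M).plus y m ≠ 0}.Finite)
    hM.iSup_weightSpace ?_ ?_ ?_ m
  · intro μ m hm
    obtain ⟨s, hs⟩ := hM.bounded
    refine (s.finite_toSet.biUnion fun lam _ => D.finite_sub_wt_mem (lam - μ)).subset ?_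
    rintro ν ⟨y, hy, hne⟩
    rw [rep_plus, action_apply] at hne
    have h1 := plus_mem_weightSpace hy hm
    obtain ⟨lam, hl, hlam⟩ := hs (D.wt ν + μ) fun h0 => hne (by rwa [h0, Submodule.mem_bot] at h1)
    refine Set.mem_biUnion hl ?_
    rwa [Set.mem_ofPred_eq, sub_sub, add_comm μ]
  · simp
  · intro m n hm hn
    refine (hm.union hn).subset ?_
    rintro ν ⟨y, hy, hne⟩
    by_contra h
    simp only [Set.mem_union, Set.mem_ofPred_eq, not_or, not_exists, not_and, not_not] at h
    exact hne (by rw [map_add, h.1 y hy, h.2 y hy, add_zero])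

end modules

end SuperBorcherdsCartanDatum

namespace SuperBorcherdsCartanDatum

variable {I P : Type*} [AddCommGroup P] (D : SuperBorcherdsCartanDatum I P)

/-! ### The radical annihilates integrable modules -/

/-- `⟨h_i, |w|⟩` -/
def corootSum (i : I) (w : List D.Iinf) : ℤ := (w.map fun y => (y.mul : ℤ) * D.A i y.idx).sum

theorem lin_simple (i : I) (w : List D.Iinf) : D.lin (D.simple i) w = D.d i * D.corootSum i w := by
  induction w with
  | nil => simp [lin, corootSum]
  | cons y w ih =>
    have h : D.form₀ (D.simple i) y = D.d i * ((y.mul : ℤ) * D.A i y.idx) := by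
      simp only [form₀, simple, Iinf.mul, Iinf.idx, PNat.one_coe, Nat.cast_one]; ring
    rw [lin_cons, ih, h, corootSum, corootSum, List.map_cons, List.sum_cons]; ring

theorem lin_eq_of_content_eq (x : D.Iinf) {w w' : List D.Iinf} (h : D.content w = D.content w') :
    D.lin x w = D.lin x w' :=
  ((D.perm_of_content_eq h).map _).sum_eq

theorem dg_qf_inv_Fdeg (x : D.Iinf) {w} {r : D.F} (hr : r ∈ D.Fdeg (D.content w)) :
    D.dg (fun y => (D.qf x y)⁻¹) r = qv ^ (-D.lin x w) • r := by
  induction hr using Fdeg_induction with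
  | h0 => simp
  | hadd u v hu hv => rw [map_add, hu, hv, smul_add]
  | hsmul c u hu => rw [map_smul, hu, smul_comm]
  | hw v hv => rw [dg_qf_inv_word, D.lin_eq_of_content_eq x hv]

theorem dg_qf_Fdeg (x : D.Iinf) {w} {r : D.F} (hr : r ∈ D.Fdeg (D.content w)) :
    D.dg (D.qf x) r = qv ^ D.lin x w • r := by
  have h1 := congrArg (D.dg (D.qf x)) (D.dg_qf_inv_Fdeg x hr)
  rw [dg_dg, map_smul] at h1
  have h2 : (fun y => D.qf x y * (D.qf x y)⁻¹) = fun _ => 1 :=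
    funext fun y => mul_inv_cancel₀ (D.qf_ne_zero x y)
  rw [h2, dg_one] at h1
  conv_rhs => rw [h1, smul_smul, ← zpow_add₀ RatFunc.X_ne_zero, add_neg_cancel, zpow_zero, one_smul]

namespace Rep

variable {D} {V : Type*} [AddCommGroup V] [Module Kq V] (R : D.Rep V)

/-- The elements of the radical which act by zero. -/
noncomputable def annihilator : Submodule Kq D.F :=
  D.radical ⊓ LinearMap.ker R.plus.toLinearMap ⊓ LinearMap.ker R.anti

variable {R} in
theorem mem_annihilator {z : D.F} :
    z ∈ R.annihilator ↔ z ∈ D.radical ∧ R.plus z = 0 ∧ R.anti z = 0 := and_assoc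

theorem gen_mul_mem_annihilator (x) {z} (hz : z ∈ R.annihilator) :
    D.gen x * z ∈ R.annihilator := by
  rw [mem_annihilator] at hz ⊢
  rw [plus_gen_mul, anti_gen_mul, hz.2.1, hz.2.2, mul_zero, zero_mul]
  exact ⟨D.gen_mul_mem_radical x hz.1, rfl, rfl⟩

theorem mul_gen_mem_annihilator (x) {z} (hz : z ∈ R.annihilator) :
    z * D.gen x ∈ R.annihilator := by
  rw [mem_annihilator] at hz ⊢
  rw [plus_mul_gen, anti_mul_gen, hz.2.1, hz.2.2, mul_zero, zero_mul]
  exact ⟨D.mul_gen_mem_radical x hz.1, rfl, rfl⟩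

/-- The eigenspaces of `K_i`. -/
noncomputable def eigen (i : I) (j : ℤ) : Submodule Kq V :=
  LinearMap.ker (R.K (D.simple i) - (D.qi i ^ j) • 1)

variable {R}

theorem mem_eigen {i : I} {j : ℤ} {v : V} :
    v ∈ R.eigen i j ↔ R.K (D.simple i) v = D.qi i ^ j • v := by
  rw [eigen, LinearMap.mem_ker, LinearMap.sub_apply, LinearMap.smul_apply, Module.End.one_apply,
    sub_eq_zero]

theorem qi_ne_zero (i : I) : D.qi i ≠ 0 := pow_ne_zero _ RatFunc.X_ne_zero

theorem qi_zpow (i : I) (j : ℤ) : D.qi i ^ j = qv ^ (D.d i * j) := by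
  rw [qi, ← zpow_natCast, ← zpow_mul]

theorem qf_simple {i : I} (hi : D.A i i = 2) :
    D.qf (D.simple i) (D.simple i) = D.qi i ^ (2 : ℤ) := by
  rw [qi_zpow, qf]
  congr 1
  simp [form₀, simple, Iinf.mul, Iinf.idx, hi]

theorem mem_eigen_of_commute {i : I} {X : Module.End Kq V} {c j : ℤ} {v : V}
    (h : R.K (D.simple i) * X = D.qi i ^ c • (X * R.K (D.simple i))) (hv : v ∈ R.eigen i j) :
    X v ∈ R.eigen i (j + c) := by
  rw [mem_eigen] at hv ⊢
  rw [← Module.End.mul_apply, h, LinearMap.smul_apply, Module.End.mul_apply, hv, map_smul,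
    smul_smul, ← zpow_add₀ (qi_ne_zero i), add_comm]

theorem rankOne {i : I} (hi : D.A i i = 2) (ha : ∀ v, ∃ n : ℕ, (R.a (D.simple i) ^ n) v = 0)
    (hb : ∀ v, ∃ n : ℕ, (R.b (D.simple i) ^ n) v = 0) :
    RankOne (R.a (D.simple i)) (R.b (D.simple i)) (R.eigen i) (D.sgn (D.simple i) (D.simple i))
      (D.cden (D.simple i))⁻¹ (D.qi i) where
  E_mem hv := mem_eigen_of_commute (by rw [R.K_mul_a, qf_simple hi]) hv
  F_mem hv := mem_eigen_of_commute (c := -2) (by rw [R.K_mul_b, qf_simple hi, zpow_neg]) hv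
  comm {j v} hv := by
    have h1 := congrArg (fun T => T v) (R.a_mul_b (D.simple i) (D.simple i))
    have h2 : R.Kinv (D.simple i) v = D.qi i ^ (-j) • v := by
      have := congrArg (R.Kinv (D.simple i)) (mem_eigen.1 hv)
      rw [← Module.End.mul_apply, R.Kinv_mul_K, Module.End.one_apply, map_smul] at this
      conv_rhs => rw [this]
      rw [smul_smul, ← zpow_add₀ (qi_ne_zero i), neg_add_cancel, zpow_zero, one_smul]
    simp only [LinearMap.add_apply, LinearMap.smul_apply, LinearMap.sub_apply,
      Module.End.mul_apply] at h1
    rw [h1, delta_self, one_smul, mem_eigen.1 hv, h2, ← sub_smul, smul_smul]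
  eps := neg_one_pow_eq_or Kq _
  gamma := inv_ne_zero (D.cden_ne_zero _)
  Q_ne_zero := qi_ne_zero i
  Q_zpow n hn := by
    rw [qi_zpow] at hn
    have h1 := D.d_pos i
    have h2 := qv_zpow_eq hn
    rcases mul_eq_zero.1 h2 with h | h
    · omega
    · exact h
  E_nil := ha
  F_nil := hb

/-- The powers of a_x lie in distinct degrees, and only finitely many degrees act nontrivially on a
vector. Thus integrability for a_i comes with the boundedness of the weights. -/
theorem LocallyFinite.exists_pow_a (hR : R.LocallyFinite) (x : D.Iinf) (v : V) :
    ∃ n : ℕ, (R.a x ^ n) v = 0 := by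
  by_contra! h
  refine Set.infinite_of_injective_forall_mem (f := fun n : ℕ => Finsupp.single x n)
    (Finsupp.single_injective x) (fun n => ?_) (hR v)
  refine ⟨D.gen x ^ n, ?_, ?_⟩
  · induction n with
    | zero =>
      rw [pow_zero, Finsupp.single_zero, ← word_nil, ← content_nil]; exact D.word_mem_Fdeg _
    | succ n ih => rw [pow_succ, Finsupp.single_add]; exact D.mul_gen_mem_Fdeg x ih
  · rw [map_pow, plus, FreeAlgebra.lift_ι_apply]; exact h n

variable {ν : D.Iinf →₀ ℕ} {r : D.F}

theorem lder_mem_annihilator (hrν : r ∈ D.Fdeg ν) (hrad : r ∈ D.radical)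
    (hJ : ∀ μ, D.ht μ < D.ht ν → ∀ z ∈ D.Fdeg μ, z ∈ D.radical → z ∈ R.annihilator) (x) :
    D.lder x r ∈ R.annihilator := by
  by_cases h : ν x = 0
  · rw [D.lder_eq_zero x h hrν]; exact zero_mem _
  · obtain ⟨μ, rfl⟩ := D.exists_add_single h
    exact hJ μ (by rw [ht_add, ht_single]; omega) _ (D.lder_mem_Fdeg x hrν)
      (D.lder_mem_radical x hrad)

theorem rder_mem_annihilator (hrν : r ∈ D.Fdeg ν) (hrad : r ∈ D.radical)
    (hJ : ∀ μ, D.ht μ < D.ht ν → ∀ z ∈ D.Fdeg μ, z ∈ D.radical → z ∈ R.annihilator) (x) :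
    D.rder x r ∈ R.annihilator := by
  by_cases h : ν x = 0
  · rw [D.rder_eq_zero x h hrν]; exact zero_mem _
  · obtain ⟨μ, rfl⟩ := D.exists_add_single h
    exact hJ μ (by rw [ht_add, ht_single]; omega) _ (D.rder_mem_Fdeg x hrν)
      (D.rder_mem_radical x hrad)

theorem dg_eq_smul (χ : D.Iinf → Kq) (hχ : ∀ y, χ y ≠ 0) (hrν : r ∈ D.Fdeg ν) :
    ∃ c : Kq, c ≠ 0 ∧ D.dg χ r = c • r :=
  ⟨_, Finset.prod_ne_zero_iff.2 fun y _ => pow_ne_zero _ (hχ y), D.dg_Fdeg χ hrν⟩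

theorem dg_mem_annihilator (χ : D.Iinf → Kq) (hrν : r ∈ D.Fdeg ν) (hr : r ∈ R.annihilator) :
    D.dg χ r ∈ R.annihilator := by
  rw [D.dg_Fdeg χ hrν]; exact Submodule.smul_mem _ _ hr

theorem sgn_ne_zero (x y : D.Iinf) : D.sgn x y ≠ 0 :=
  left_ne_zero_of_mul (by rw [D.sgn_mul_sgn x y]; exact one_ne_zero)

theorem dg_lder_mem_annihilator (χ : D.Iinf → Kq) (hrν : r ∈ D.Fdeg ν) (hrad : r ∈ D.radical)
    (hJ : ∀ μ, D.ht μ < D.ht ν → ∀ z ∈ D.Fdeg μ, z ∈ D.radical → z ∈ R.annihilator) (x) :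
    D.dg χ (D.lder x r) ∈ R.annihilator := by
  by_cases h : ν x = 0
  · rw [D.lder_eq_zero x h hrν, map_zero]; exact zero_mem _
  · have h1 := lder_mem_annihilator hrν hrad hJ x
    obtain ⟨μ, rfl⟩ := D.exists_add_single h
    exact dg_mem_annihilator χ (D.lder_mem_Fdeg x hrν) h1

/-- The correction terms in `a_mul_anti` contain derivatives of r. These are radical elements of
smaller height and act by zero, so only a nonzero scalar is left. -/
theorem a_commute_anti (hrν : r ∈ D.Fdeg ν) (hrad : r ∈ D.radical)
    (hJ : ∀ μ, D.ht μ < D.ht ν → ∀ z ∈ D.Fdeg μ, z ∈ D.radical → z ∈ R.annihilator) (x) :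
    ∃ κ : Kq, κ ≠ 0 ∧ R.a x * R.anti r = κ • (R.anti r * R.a x) := by
  obtain ⟨κ, hκ, h⟩ := dg_eq_smul (fun w => D.sgn x w * (D.qf x w)⁻¹)
    (fun w => mul_ne_zero (sgn_ne_zero x w) (inv_ne_zero (D.qf_ne_zero x w))) hrν
  refine ⟨κ, hκ, ?_⟩
  rw [a_mul_anti, h, (mem_annihilator.1 (rder_mem_annihilator hrν hrad hJ x)).2.2,
    (mem_annihilator.1 (dg_lder_mem_annihilator _ hrν hrad hJ x)).2.2, mul_zero, sub_zero,
    smul_zero, add_zero, map_smul, smul_mul_assoc]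

theorem b_commute_plus (hrν : r ∈ D.Fdeg ν) (hrad : r ∈ D.radical)
    (hJ : ∀ μ, D.ht μ < D.ht ν → ∀ z ∈ D.Fdeg μ, z ∈ D.radical → z ∈ R.annihilator) (x) :
    ∃ κ : Kq, κ ≠ 0 ∧ R.b x * R.plus r = κ • (R.plus r * R.b x) := by
  obtain ⟨κ, hκ, h⟩ := dg_eq_smul (D.sgn x) (sgn_ne_zero x) hrν
  refine ⟨κ⁻¹, inv_ne_zero hκ, ?_⟩
  rw [plus_mul_b, h, (mem_annihilator.1 (rder_mem_annihilator hrν hrad hJ x)).2.1,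
    (mem_annihilator.1 (dg_lder_mem_annihilator _ hrν hrad hJ x)).2.1, mul_zero, zero_mul, sub_zero,
    smul_zero, add_zero, map_smul, mul_smul_comm, smul_smul, inv_mul_cancel₀ hκ, one_smul]

/-- Weights which are not dominant for `-h_i` do not occur in the radical. -/
theorem mem_annihilator_of_corootSum_pos (hR : R.LocallyFinite) {i : I} (hi : D.A i i = 2)
    (hb : ∀ v, ∃ n : ℕ, (R.b (D.simple i) ^ n) v = 0) (hV : ⨆ j, R.eigen i j = ⊤)
    {w : List D.Iinf} (hw : 0 < D.corootSum i w) {r : D.F} (hrw : r ∈ D.Fdeg (D.content w))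
    (hrad : r ∈ D.radical)
    (hJ : ∀ μ, D.ht μ < D.ht (D.content w) → ∀ z ∈ D.Fdeg μ, z ∈ D.radical → z ∈ R.annihilator) :
    r ∈ R.annihilator := by
  have h := rankOne hi (hR.exists_pow_a _) hb
  have hext : ∀ T : Module.End Kq V, (∀ j, ∀ v ∈ R.eigen i j, T v = 0) → T = 0 := fun T hT => by
    rw [← LinearMap.ker_eq_top, eq_top_iff, ← hV]
    exact iSup_le fun j v hv => hT j v hv
  refine mem_annihilator.2 ⟨hrad, hext _ fun j v hv => ?_, hext _ fun j v hv => ?_⟩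
  -- r^+ raises the K_i-weight and commutes with b_i up to a scalar, so the rank one statement is
  -- used with the roles of a_i and b_i exchanged.
  · obtain ⟨κ, hκ, hc⟩ := b_commute_plus hrw hrad hJ (D.simple i)
    refine h.swap.eq_zero_of_commute hκ (fun v => congrArg (fun T => T v) hc) hw ?_ (m := -j)
      (by rwa [neg_neg])
    intro j v hv
    have h1 := mem_eigen_of_commute (X := R.plus r) (c := D.corootSum i w)
      (by rw [K_mul_plus, D.dg_qf_Fdeg _ hrw, lin_simple, ← qi_zpow, map_smul, smul_mul_assoc]) hv
    rwa [neg_sub, sub_eq_add_neg, add_comm]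
  · obtain ⟨κ, hκ, hc⟩ := a_commute_anti hrw hrad hJ (D.simple i)
    refine h.eq_zero_of_commute hκ (fun v => congrArg (fun T => T v) hc) hw ?_ hv
    intro j v hv
    exact mem_eigen_of_commute (c := -D.corootSum i w)
      (by rw [K_mul_anti, D.dg_qf_inv_Fdeg _ hrw, lin_simple, ← mul_neg, ← qi_zpow, map_smul,
        smul_mul_assoc]) hv

end Rep

variable {D} in
/-- The partial sums `Ω_{≤ n}` are eventually constant. -/
theorem omegaLE_eq {M : Type*} [AddCommGroup M] [Module Kq M]
    [Module D.U M] (B : ∀ ν, D.DualBases ν) (m : M)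
    (h : (Function.support fun ν => omegaTerm B ν m).Finite) :
    ∃ n₀ : ℕ, ∀ n ≥ n₀, omegaLE B n m = ∑ᶠ ν, omegaTerm B ν m := by
  -- Beyond the largest height of a nonzero term the truncation has no effect.
  obtain ⟨n₀, hn₀⟩ := (h.image D.ht).bddAbove
  refine ⟨n₀, fun n hn => finsum_congr fun ν => ?_⟩
  by_cases hν : D.ht ν ≤ n
  · rw [finsum_eq_if, if_pos hν]
  · rw [finsum_eq_if, if_neg hν]
    by_contra hne
    exact hν ((hn₀ ⟨ν, Ne.symm hne, rfl⟩).trans hn)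

/-! ### Induction on the height for integrable modules -/

section modules

variable {D} {M : Type*} [AddCommGroup M] [Module Kq M] [Module D.U M] [IsScalarTower Kq D.U M]

/-- Vanishing pairing means a_ij = 0, where U has the supercommutation relations. On the other side
the factors K commute with the b's of the other letter, so the relation for the b's applies. -/
theorem supercomm_mem_annihilator {x y : D.Iinf} (h : D.form₀ x y = 0) :
    D.supercomm x y ∈ (D.rep M).annihilator := by
  have hA := D.A_eq_zero_of_form₀ h
  have hK : D.K x * D.K y = D.K y * D.K x := D.t_comm _ _
  have hxy : D.b x * D.K y = D.K y * D.b x := by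
    rw [b_mul_K, form₀_comm, h, zpow_zero, one_smul]
  have hyx : D.b y * D.K x = D.K x * D.b y := by rw [b_mul_K, h, zpow_zero, one_smul]
  refine Rep.mem_annihilator.2 ⟨D.supercomm_mem_radical h, ?_, ?_⟩
  · rw [rep_plus, supercomm, map_sub, map_smul, map_mul, map_mul, plus, FreeAlgebra.lift_ι_apply,
      FreeAlgebra.lift_ι_apply, D.comm_a x y hA, sgn, sub_self, map_zero]
  · have hg : ∀ z : D.Iinf, D.antiLift (fun x => D.b x * D.K x) (D.gen z) = D.b z * D.K z := by
      intro z
      have := D.antiLift_gen_mul (fun x => D.b x * D.K x) z 1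
      rwa [mul_one, antiLift_one, one_mul] at this
    have h1 : D.b y * D.K y * (D.b x * D.K x) = D.b y * D.b x * (D.K y * D.K x) := by
      rw [mul_assoc, ← mul_assoc (D.K y), ← hxy]; simp only [mul_assoc]
    have h2 : D.b x * D.K x * (D.b y * D.K y) = D.b x * D.b y * (D.K y * D.K x) := by
      rw [mul_assoc, ← mul_assoc (D.K x), ← hyx, ← hK]; simp only [mul_assoc]
    rw [rep_anti, supercomm, map_sub, map_smul, antiLift_gen_mul, antiLift_gen_mul, hg, hg, h1, h2,
      D.comm_b x y hA, smul_mul_assoc, smul_smul, sgn, sign_mul_self, one_smul, sub_self, map_zero]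

theorem weightSpace_le_eigen (i : I) (μ : P) :
    D.weightSpace M μ ≤ (D.rep M).eigen i (D.coroot i μ) := by
  intro m hm
  rw [Rep.mem_eigen, Rep.qi_zpow]
  refine (hm (D.kap (D.simple i))).trans ?_
  congr 2
  simp [kap, simple, Iinf.mul, Iinf.idx]

theorem IsOint.mem_annihilator (hM : D.IsOint M) (n : ℕ) : ∀ ν, D.ht ν = n →
    ∀ r ∈ D.Fdeg ν, r ∈ D.radical → r ∈ (D.rep M).annihilator := by
  induction n using Nat.strong_induction_on with
  | _ n ih =>
    rintro ν rfl r hr hrad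
    obtain ⟨w, rfl⟩ := D.exists_content_eq ν
    have hJ : ∀ μ, D.ht μ < D.ht (D.content w) → ∀ z ∈ D.Fdeg μ, z ∈ D.radical →
        z ∈ (D.rep M).annihilator := fun μ hμ => ih _ hμ μ rfl
    have hl := fun x z hz => Rep.gen_mul_mem_annihilator (D.rep M) x (z := z) hz
    have hr' := fun x z hz => Rep.mul_gen_mem_annihilator (D.rep M) x (z := z) hz
    -- A zero pair sum is exactly the case in which the scalar of Ω is 1 and the Verma argument
    -- gives nothing.
    by_cases hp : D.pairSum w = 0
    · by_cases hi : ∃ i, D.A i i = 2 ∧ 0 < D.corootSum i w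
      · obtain ⟨i, hi, hw⟩ := hi
        refine Rep.mem_annihilator_of_corootSum_pos hM.locallyFinite hi (fun v => ?_) ?_ hw hr hrad
          hJ
        · obtain ⟨n, hn⟩ := hM.locallyNilpotent i hi v
          refine ⟨n, ?_⟩
          change (D.action M (D.b (D.simple i)) ^ n) v = 0
          rwa [← map_pow, action_apply]
        · rw [eq_top_iff, ← hM.iSup_weightSpace]
          exact iSup_le fun μ => (weightSpace_le_eigen i μ).trans (le_iSup _ _)
      · push Not at hi
        -- No real coroot is positive on the degree, so its parts are pairwise orthogonal and the
        -- annihilator contains the generators of the radical there.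
        refine SupercommIdeal.mem_of_pairwise
          ⟨hl, hr', fun x y h => supercomm_mem_annihilator h⟩
          (fun z hz => (Rep.mem_annihilator.1 hz).1) w
          (D.pairwise_of_pairSum hp fun i h => ?_) hr hrad
        rw [lin_simple]
        exact mul_nonpos_of_nonneg_of_nonpos (Nat.cast_nonneg _) (hi i h)
    · exact D.mem_of_pairSum_ne_zero hl hr' hp hJ hr hrad

theorem IsOint.radicalFree (hM : D.IsOint M) : (D.rep M).RadicalFree :=
  ⟨fun ν z hz hr => (Rep.mem_annihilator.1 (hM.mem_annihilator _ ν rfl z hz hr)).2.1,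
    fun ν z hz hr => (Rep.mem_annihilator.1 (hM.mem_annihilator _ ν rfl z hz hr)).2.2⟩

end modules

end SuperBorcherdsCartanDatum

/-! ### The proposition -/

open SuperBorcherdsCartanDatum.Rep in
theorem mainTheorem9 {I P M : Type*} [AddCommGroup P] [Module.Free ℤ P]
    (D : SuperBorcherdsCartanDatum I P)
    [AddCommGroup M] [Module Kq M] [Module D.U M] [IsScalarTower Kq D.U M]
    (hM : D.IsOint M) (B : ∀ ν : D.Iinf →₀ ℕ, D.DualBases ν) :
    -- only finitely many terms of the series do not vanish on a given vector
    (∀ m : M, {ν : D.Iinf →₀ ℕ | ∃ s, D.plus ((B ν).bstar s) • m ≠ 0}.Finite) ∧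
    ∃ Ω : M →ₗ[Kq] M,
      (∀ m : M, Ω m = ∑ᶠ ν : D.Iinf →₀ ℕ, SuperBorcherdsCartanDatum.omegaTerm B ν m) ∧
      (∀ m : M, ∃ n₀ : ℕ, ∀ n ≥ n₀, SuperBorcherdsCartanDatum.omegaLE B n m = Ω m) ∧
      (∀ (x : D.Iinf) (m : M), D.Kinv x • D.a x • Ω m = D.K x • Ω (D.a x • m)) ∧
      (∀ (x : D.Iinf) (m : M), Ω (D.b x • m) = D.b x • D.K x • Ω (D.K x • m)) ∧
      (∀ (x : D.Iinf) (m : M), Ω (D.K x • m) = D.K x • Ω m) := by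
  have hf := hM.locallyFinite
  have h0 := hM.radicalFree
  have hΩ : ∀ m, omega B hf m = ∑ᶠ ν : D.Iinf →₀ ℕ, SuperBorcherdsCartanDatum.omegaTerm B ν m :=
    fun m => finsum_congr fun ν => (D.omegaTerm_eq M B ν m).symm
  refine ⟨fun m => (hf m).subset ?_, omega B hf, hΩ, fun m => ?_, fun x m => ?_,
    omega_b B hf h0, omega_K B hf⟩
  · rintro ν ⟨s, hs⟩
    exact ⟨_, (B ν).bstar_mem s, by rwa [D.rep_plus, D.action_apply]⟩
  · rw [hΩ]
    refine SuperBorcherdsCartanDatum.omegaLE_eq B m ?_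
    simp only [D.omegaTerm_eq M]
    exact hf.term B m
  -- The identity a_x Ω = K_x² Ω a_x, multiplied by K_x⁻¹.
  · have h := omega_a B hf h0 x m
    change D.a x • omega B hf m = D.K x • D.K x • omega B hf (D.a x • m) at h
    rw [h, ← mul_smul, D.Kinv_mul_K, one_smul]
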